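/- Let $Z$ be a Euclidean space with inner product $(\cdot,\cdot)$; write $v^\vee=2v/|v|^2$ for $0\neq v\in Z$, let $s_v$ be the orthogonal reflection in $v^\perp$ and $\tau(v)$ the translation by $v$. Identify the affine linear functions on $Z$ with formal sums $rc+v$ ($r\in\mathbb R$, $v\in Z$), where $c$ is the constant function one and $v$ stands for $z\mapsto (v,z)$; for $\lambda\in Z$ and $v\neq0$ put $(\lambda,(rc+v)^\vee):=(\lambda,v^\vee)$. Affine isometries act on them by $(ga)(z)=a(g^{-1}z)$, and $s_{rc+v}=\tau(-rv^\vee)s_v$. **Initial data.** Let $D=(R_0,\Delta_0,\bullet,\Lambda,\Lambda^d)$, where $R_0\subset Z$ is a finite set of nonzero vectors forming an irreducible reduced crystallographic root system in its span, $\Delta_0=(\alpha_1,\dots,\alpha_n)$ is an ordered basis of $R_0$, $\bullet\in\{u,t\}$, and $\Lambda,\Lambda^d$ are full lattices in $Z$ such that, with $\mu_\alpha=1$ if $\bullet=u$, $\mu_\alpha=|\alpha|^2/2$ if $\bullet=t$, and $\alpha^d=\mu_\alpha\alpha^\vee$, $$R_0\subseteq\Lambda,\quad (\Lambda,\alpha^\vee)\subseteq\mathbb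 Z,\quad \alpha^d\in\Lambda^d,\quad (\Lambda^d,(\alpha^{d})^\vee)\subseteq\mathbb Z\qquad(\alpha\in R_0).$$ Put $R^\bullet=\{m\mu_\alpha c+\alpha: m\in\mathbb Z,\ \alpha\in R_0\}$, and let $W^\bullet$ be the group generated by the reflections $s_a$, $a\in R^\bullet$. Let $\varphi$ and $\theta$ be the highest root and the highest short root of $R_0$ with respect to $\Delta_0$, and put $a_0=c-\varphi$ if $\bullet=u$, $a_0=\tfrac{|\theta|^2}{2}c-\theta$ if $\bullet=t$, $a_i=\alpha_i$ for $1\le i\le n$, and $s_i=s_{a_i}$. Let $S=\{i\in\{0,\dots,n\}:(\Lambda,a_i^\vee)=2\mathbb Z\}$ and $R=R^\bullet\cup\bigcup_{i\in S}W^\bullet(2a_i)$. Let $W=W_0\ltimes\tau(\Lambda^d)$ be the extended affine Weyl group, where $W_0$ is the Weyl group of $R_0$. Let $R^{\bullet\pm}$ be the positive and negative elements of $R^\bullet$ with respect to $(a_0,\dots,a_n)$, $l(w)=\#(R^{\bullet+}\cap w^{-1}R^{\bullet-})$ for $w\in W$, and $\Omega=\{\omega\in W: l(\omega)=0\}$.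 **Hecke algebra.** Let $\kappa:R\to\mathbb C^*$ be a $W$-invariant function ($\kappa\in\mathcal M(D)$), and put $\kappa_{2a}:=\kappa_a$ for $a\in R$ with $2a\notin R$. Let $\kappa^\bullet=\kappa|_{R^\bullet}$. The extended affine braid group $\mathcal B$ is generated by $T_w$ ($w\in W$) with relations $T_vT_w=T_{vw}$ whenever $l(vw)=l(v)+l(w)$. The extended affine Hecke algebra $H(D,\kappa^\bullet)$ is the quotient of $\mathbb C[\mathcal B]$ by the two-sided ideal generated by $(T_i-\kappa_{a_i})(T_i+\kappa_{a_i}^{-1})$, $0\le i\le n$, where $T_i=T_{s_i}$; for $\omega\in\Omega$ the element $T_\omega$ is denoted by $\omega$. **The $q$-action.** Let $q>0$ be real, $q\neq1$. Let $T_\Lambda=\mathrm{Hom}_{\mathbb Z}(\Lambda,\mathbb C^*)$, and let $\mathbb C[T_\Lambda]$ be its algebra of regular functions, spanned by the functions $t\mapsto t^\lambda:=t(\lambda)$, $\lambda\in\Lambda$. For $w=\tau(\xi)v\in W$ with $\xi\in\Lambda^d$, $v\in W_0$, define $w_qt\in T_\Lambda$ by $(w_qt)^\lambda=q^{(\lambda,\xi)}t^{v^{-1}\lambda}$,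 and $(w_qp)(t)=p(w_q^{-1}t)$. Put $t_q^{rc+\lambda}=q^rt^\lambda$. **Theorem.** There is a unique injective homomorphism of unital $\mathbb C$-algebras $$\pi_{\kappa,q}:H(D,\kappa^\bullet)\longrightarrow\mathrm{End}_{\mathbb C}(\mathbb C[T_\Lambda])$$ such that for all $0\le i\le n$, $\omega\in\Omega$ and $p\in\mathbb C[T_\Lambda]$ $$(\pi_{\kappa,q}(T_i)p)(t)=\kappa_{a_i}(s_{i,q}p)(t)+\frac{\kappa_{a_i}-\kappa_{a_i}^{-1}+(\kappa_{2a_i}-\kappa_{2a_i}^{-1})t_q^{a_i}}{1-t_q^{2a_i}}\bigl(p(t)-(s_{i,q}p)(t)\bigr)$$ for all $t\in T_\Lambda$ with $t_q^{2a_i}\neq1$, and $$(\pi_{\kappa,q}(\omega)p)(t)=(\omega_qp)(t)\qquad\text{for all }t\in T_\Lambda.$$ -/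

import Mathlib

noncomputable section

/-! ### Affine linear functions on a Euclidean space

The pair `(r, v) : ℝ × Z` stands for the affine linear function `z ↦ r + (v, z)`, that is, for
`r c + v` with `c` the constant function one.  Its gradient is `v`. -/

section Euclidean

variable {Z : Type*} [NormedAddCommGroup Z] [InnerProductSpace ℝ Z]

/-- The covector `v^∨ = 2 v / |v|^2`. -/
def coroot (v : Z) : Z := (2 / ‖v‖ ^ 2) • v

/-- The value at `z` of the affine linear function `a = r c + v`. -/
def affEval (a : ℝ × Z) (z : Z) : ℝ := a.1 + inner ℝ a.2 z

/-- The orthogonal reflection `s_v` in the hyperplane orthogonal to `v`. -/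
def linRefl (v : Z) : Z ≃ₗᵢ[ℝ] Z := (ℝ ∙ v)ᗮ.reflection

/-- The orthogonal reflection `s_a` in the zero set of the affine linear function `a = r c + v`,
namely `s_a = τ(-r v^∨) s_v`. -/
def affRefl (a : ℝ × Z) : Z ≃ᵃⁱ[ℝ] Z :=
  AffineIsometryEquiv.constVAdd ℝ Z (-(a.1 • coroot a.2)) *
    (linRefl a.2).toAffineIsometryEquiv

/-- The contragredient action of `g` on affine linear functions, `(g a)(z) = a(g⁻¹ z)`;
see `affEval_affAct`. -/
def affAct (g : Z ≃ᵃⁱ[ℝ] Z) (a : ℝ × Z) : ℝ × Z :=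
  (a.1 - inner ℝ (g.linearIsometryEquiv a.2) (g 0), g.linearIsometryEquiv a.2)

theorem affineIsometry_apply (g : Z ≃ᵃⁱ[ℝ] Z) (z : Z) :
    g z = g.linearIsometryEquiv z + g 0 := by
  have h := g.map_vadd (0 : Z) z
  simpa using h

theorem linearIsometryEquiv_inv (g : Z ≃ᵃⁱ[ℝ] Z) :
    (g⁻¹).linearIsometryEquiv = (g.linearIsometryEquiv)⁻¹ := by
  rfl

theorem linearIsometryEquiv_mul (g h : Z ≃ᵃⁱ[ℝ] Z) :
    (g * h).linearIsometryEquiv = g.linearIsometryEquiv * h.linearIsometryEquiv := by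
  rfl

theorem affEval_affAct (g : Z ≃ᵃⁱ[ℝ] Z) (a : ℝ × Z) (z : Z) :
    affEval (affAct g a) z = affEval a (g⁻¹ z) := by
  have h : z = g.linearIsometryEquiv (g⁻¹ z) + g 0 := by
    rw [← affineIsometry_apply]; exact (g.apply_symm_apply z).symm
  conv_lhs => rw [h]
  simp [affEval, affAct, inner_add_right]

theorem linRefl_apply (v z : Z) : linRefl v z = z - inner ℝ (coroot v) z • v := by
  rw [linRefl, Submodule.reflection_orthogonal_apply, Submodule.reflection_singleton_apply]
  simp only [coroot, inner_smul_left, RCLike.ofReal_real_eq_id, id, conj_trivial]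
  module

theorem affRefl_apply (a : ℝ × Z) (z : Z) : affRefl a z = z - affEval a z • coroot a.2 := by
  have h : affRefl a z = -(a.1 • coroot a.2) + linRefl a.2 z := rfl
  rw [h, linRefl_apply]
  simp only [affEval, coroot, inner_smul_left, conj_trivial]
  module

/-! ### Finite root systems -/

/-- `R₀` is a finite set of nonzero vectors forming an irreducible, reduced, crystallographic root
system in its real span. -/
structure IsIrreducibleRootSystem (R₀ : Set Z) : Prop where
  finite : R₀.Finite
  nonempty : R₀.Nonempty
  zero_notMem : (0 : Z) ∉ R₀
  reflection_mem : ∀ α ∈ R₀, ∀ β ∈ R₀, linRefl α β ∈ R₀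
  crystallographic : ∀ α ∈ R₀, ∀ β ∈ R₀, ∃ m : ℤ, inner ℝ (coroot α) β = m
  reduced : ∀ α ∈ R₀, ∀ r : ℝ, r • α ∈ R₀ → r = 1 ∨ r = -1
  irreducible : ∀ A B : Set Z, A ∪ B = R₀ → (∀ α ∈ A, ∀ β ∈ B, inner ℝ α β = 0) →
    A = ∅ ∨ B = ∅

/-- `Δ₀ = (α₁, …, αₙ)` is an ordered basis of the root system `R₀`. -/
structure IsRootBasis {n : ℕ} (R₀ : Set Z) (Δ₀ : Fin n → Z) : Prop where
  mem : ∀ i, Δ₀ i ∈ R₀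
  linearIndependent : LinearIndependent ℝ Δ₀
  pos_or_neg : ∀ α ∈ R₀, (∃ m : Fin n → ℕ, α = ∑ i, m i • Δ₀ i) ∨
    (∃ m : Fin n → ℕ, α = -∑ i, m i • Δ₀ i)

/-- `α` is a maximal element of the set `X` of roots for the order in which `α ≤ β` means that
`β - α` is a sum of simple roots. -/
def IsMaximalRoot {n : ℕ} (Δ₀ : Fin n → Z) (X : Set Z) (α : Z) : Prop :=
  α ∈ X ∧ ∀ β ∈ X, (∃ m : Fin n → ℕ, β - α = ∑ i, m i • Δ₀ i) → β = α

/-- The roots of minimal length. -/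
def shortRoots (R₀ : Set Z) : Set Z := {α ∈ R₀ | ∀ β ∈ R₀, ‖α‖ ≤ ‖β‖}

theorem exists_isMaximalRoot {n : ℕ} {Δ₀ : Fin n → Z} (hΔ : LinearIndependent ℝ Δ₀) {X : Set Z}
    (hfin : X.Finite) (hne : X.Nonempty) : ∃ α, IsMaximalRoot Δ₀ X α := by
  obtain ⟨f, hf⟩ : ∃ f : Z →ₗ[ℝ] ℝ, ∀ i, f (Δ₀ i) = 1 := by
    let b := Module.Basis.span hΔ
    obtain ⟨f, hf⟩ := LinearMap.exists_extend (b.constr ℝ (fun _ => (1 : ℝ)))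
    refine ⟨f, fun i => ?_⟩
    have h1 : (b i : Z) = Δ₀ i := congrArg Subtype.val (Module.Basis.span_apply hΔ i)
    have h2 := LinearMap.congr_fun hf (b i)
    simp only [LinearMap.comp_apply, Submodule.subtype_apply, Module.Basis.constr_basis] at h2
    rw [← h1, h2]
  obtain ⟨α, hα, hmax⟩ := hfin.exists_maximalFor f X hne
  refine ⟨α, hα, fun β hβ ⟨m, hm⟩ => ?_⟩
  have h1 : f β - f α = ((∑ i, m i : ℕ) : ℝ) := by
    rw [← map_sub, hm, map_sum]
    simp [hf]
  have h2 : f β ≤ f α := hmax hβ (by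
    have : (0 : ℝ) ≤ ((∑ i, m i : ℕ) : ℝ) := Nat.cast_nonneg _
    show f α ≤ f β
    linarith)
  have h3 : (∑ i, m i) = 0 := by
    have : ((∑ i, m i : ℕ) : ℝ) ≤ 0 := by linarith
    exact_mod_cast le_antisymm this (Nat.cast_nonneg _)
  have h4 : ∀ i, m i = 0 := by simpa using h3
  have h5 : β - α = 0 := by rw [hm]; simp [h4]
  exact sub_eq_zero.mp h5

end Euclidean

/-! ### Initial data -/

/-- The symbol `•`, which is `u` (untwisted) or `t` (twisted). -/
inductive TwistKind : Type
  | u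
  | t

/-- `μ^u_α = 1` and `μ^t_α = |α|^2 / 2`. -/
def TwistKind.mu {Z : Type*} [NormedAddCommGroup Z] : TwistKind → Z → ℝ
  | .u, _ => 1
  | .t, α => ‖α‖ ^ 2 / 2

/-- `α^d = μ^•_α α^∨`. -/
def TwistKind.dual {Z : Type*} [NormedAddCommGroup Z] [InnerProductSpace ℝ Z]
    (κ : TwistKind) (α : Z) : Z := κ.mu α • coroot α

/-- Initial data `D = (R₀, Δ₀, •, Λ, Λ^d)` in the Euclidean space `Z`, with `R₀` of rank `n`.
The lattices `Λ` and `Λ^d` are full: discrete and spanning `Z`. -/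
structure InitialData (Z : Type*) [NormedAddCommGroup Z] [InnerProductSpace ℝ Z] (n : ℕ) where
  R₀ : Set Z
  isRootSystem : IsIrreducibleRootSystem R₀
  Δ₀ : Fin n → Z
  isBasis : IsRootBasis R₀ Δ₀
  kind : TwistKind
  Λ : Submodule ℤ Z
  discrete_Λ : DiscreteTopology Λ
  span_Λ : Submodule.span ℝ (Λ : Set Z) = ⊤
  Λd : Submodule ℤ Z
  discrete_Λd : DiscreteTopology Λd
  span_Λd : Submodule.span ℝ (Λd : Set Z) = ⊤
  root_mem_Λ : ∀ α ∈ R₀, α ∈ Λ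
  Λ_integral : ∀ v ∈ Λ, ∀ α ∈ R₀, ∃ m : ℤ, inner ℝ v (coroot α) = m
  dual_mem_Λd : ∀ α ∈ R₀, kind.dual α ∈ Λd
  Λd_integral : ∀ v ∈ Λd, ∀ α ∈ R₀, ∃ m : ℤ, inner ℝ v (coroot (kind.dual α)) = m

namespace InitialData

variable {Z : Type*} [NormedAddCommGroup Z] [InnerProductSpace ℝ Z] {n : ℕ}

/-! #### The affine root systems `R^•` and `R` -/

/-- The reduced affine root system `R^• = {m μ_α c + α}`. -/
def Rred (D : InitialData Z n) : Set (ℝ × Z) :=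
  {a | ∃ m : ℤ, ∃ α ∈ D.R₀, a = (m * D.kind.mu α, α)}

theorem exists_highestRoot (D : InitialData Z n) : ∃ φ, IsMaximalRoot D.Δ₀ D.R₀ φ :=
  exists_isMaximalRoot D.isBasis.linearIndependent D.isRootSystem.finite D.isRootSystem.nonempty

theorem exists_highestShortRoot (D : InitialData Z n) :
    ∃ θ, IsMaximalRoot D.Δ₀ (shortRoots D.R₀) θ := by
  refine exists_isMaximalRoot D.isBasis.linearIndependent
    (D.isRootSystem.finite.subset fun _ h => h.1) ?_
  obtain ⟨α, hα, h⟩ :=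
    Set.exists_min_image D.R₀ (fun v => ‖v‖) D.isRootSystem.finite D.isRootSystem.nonempty
  exact ⟨α, hα, h⟩

/-- The highest root `φ`: the maximal root, which is unique because `R₀` is irreducible. -/
def highestRoot (D : InitialData Z n) : Z := D.exists_highestRoot.choose

/-- The highest short root `θ`: the maximal short root, which is unique because `R₀` is
irreducible. -/
def highestShortRoot (D : InitialData Z n) : Z := D.exists_highestShortRoot.choose

/-- `a₀ = c - φ` if `• = u` and `a₀ = (|θ|^2 / 2) c - θ` if `• = t`. -/
def a₀ (D : InitialData Z n) : ℝ × Z :=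
  match D.kind with
  | .u => (1, -D.highestRoot)
  | .t => (‖D.highestShortRoot‖ ^ 2 / 2, -D.highestShortRoot)

/-- The ordered basis `Δ = (a₀, a₁, …, aₙ)` with `aᵢ = αᵢ` for `i ≥ 1`. -/
def Δ (D : InitialData Z n) : Fin (n + 1) → ℝ × Z :=
  Fin.cons D.a₀ (fun i => ((0 : ℝ), D.Δ₀ i))

/-- The affine Weyl group `W^•` of `R^•`. -/
def Wred (D : InitialData Z n) : Subgroup (Z ≃ᵃⁱ[ℝ] Z) :=
  Subgroup.closure (affRefl '' D.Rred)

/-- `S = {i | (Λ, aᵢ^∨) = 2ℤ}`. -/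
def S (D : InitialData Z n) : Set (Fin (n + 1)) :=
  {i | (fun v => inner ℝ v (coroot (D.Δ i).2)) '' (D.Λ : Set Z) =
    Set.range (fun m : ℤ => 2 * (m : ℝ))}

/-- `R = R^• ∪ ⋃_{i ∈ S} W^• (2 aᵢ)`. -/
def R (D : InitialData Z n) : Set (ℝ × Z) :=
  D.Rred ∪ {a | ∃ i ∈ D.S, ∃ w ∈ D.Wred, a = affAct w ((2 : ℝ) • D.Δ i)}

/-! #### The extended affine Weyl group -/

/-- The finite Weyl group `W₀`. -/
def W₀ (D : InitialData Z n) : Subgroup (Z ≃ₗᵢ[ℝ] Z) :=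
  Subgroup.closure (linRefl '' D.R₀)

theorem neg_mem (D : InitialData Z n) {α : Z} (hα : α ∈ D.R₀) : -α ∈ D.R₀ := by
  have h := D.isRootSystem.reflection_mem α hα α hα
  rwa [linRefl, Submodule.reflection_orthogonalComplement_singleton_eq_neg] at h

theorem mu_ne_zero (D : InitialData Z n) {α : Z} (hα : α ∈ D.R₀) : D.kind.mu α ≠ 0 := by
  have : α ≠ 0 := fun h => D.isRootSystem.zero_notMem (h ▸ hα)
  cases D.kind with
  | u => simp [TwistKind.mu]
  | t => simp [TwistKind.mu, this]

theorem W₀_mem_Λ (D : InitialData Z n) {w : Z ≃ₗᵢ[ℝ] Z} (hw : w ∈ D.W₀) :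
    ∀ v ∈ D.Λ, w v ∈ D.Λ := by
  have key : ∀ α ∈ D.R₀, ∀ v ∈ D.Λ, linRefl α v ∈ D.Λ := by
    intro α hα v hv
    obtain ⟨m, hm⟩ := D.Λ_integral v hv α hα
    rw [linRefl_apply, real_inner_comm, hm, Int.cast_smul_eq_zsmul]
    exact D.Λ.sub_mem hv (D.Λ.smul_mem m (D.root_mem_Λ α hα))
  refine Subgroup.closure_induction'' (p := fun w _ => ∀ v ∈ D.Λ, w v ∈ D.Λ) ?_ ?_ ?_ ?_ hw
  · rintro _ ⟨α, hα, rfl⟩; exact key α hα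
  · rintro _ ⟨α, hα, rfl⟩
    have : (linRefl α)⁻¹ = linRefl α := Submodule.reflection_inv
    rw [this]; exact key α hα
  · intro v hv; exact hv
  · intro x y _ _ hx hy v hv; exact hx _ (hy v hv)

theorem W₀_mem_Λd (D : InitialData Z n) {w : Z ≃ₗᵢ[ℝ] Z} (hw : w ∈ D.W₀) :
    ∀ v ∈ D.Λd, w v ∈ D.Λd := by
  have key : ∀ α ∈ D.R₀, ∀ v ∈ D.Λd, linRefl α v ∈ D.Λd := by
    intro α hα v hv
    obtain ⟨m, hm⟩ := D.Λd_integral v hv α hα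
    have h0 : ‖α‖ ≠ 0 := by
      rw [norm_ne_zero_iff]; exact fun h => D.isRootSystem.zero_notMem (h ▸ hα)
    have hμ := D.mu_ne_zero hα
    have h1 : inner ℝ (coroot α) v • α
        = inner ℝ v (coroot (D.kind.dual α)) • D.kind.dual α := by
      simp only [TwistKind.dual, coroot, inner_smul_left, inner_smul_right, smul_smul, norm_smul,
        conj_trivial, mul_pow, Real.norm_eq_abs, sq_abs, real_inner_comm α v]
      congr 1
      field_simp
    rw [linRefl_apply, h1, hm, Int.cast_smul_eq_zsmul]
    exact D.Λd.sub_mem hv (D.Λd.smul_mem m (D.dual_mem_Λd α hα))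
  refine Subgroup.closure_induction'' (p := fun w _ => ∀ v ∈ D.Λd, w v ∈ D.Λd) ?_ ?_ ?_ ?_ hw
  · rintro _ ⟨α, hα, rfl⟩; exact key α hα
  · rintro _ ⟨α, hα, rfl⟩
    have : (linRefl α)⁻¹ = linRefl α := Submodule.reflection_inv
    rw [this]; exact key α hα
  · intro v hv; exact hv
  · intro x y _ _ hx hy v hv; exact hx _ (hy v hv)

/-- The extended affine Weyl group `W = W₀ ⋉ Λ^d`: the affine isometries `z ↦ w z + ξ` with
`w ∈ W₀` and `ξ ∈ Λ^d`. -/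
def W (D : InitialData Z n) : Subgroup (Z ≃ᵃⁱ[ℝ] Z) where
  carrier := {g | g.linearIsometryEquiv ∈ D.W₀ ∧ g 0 ∈ D.Λd}
  one_mem' := ⟨D.W₀.one_mem, D.Λd.zero_mem⟩
  mul_mem' := by
    rintro g h ⟨hg, hg0⟩ ⟨hh, hh0⟩
    refine ⟨D.W₀.mul_mem hg hh, ?_⟩
    change g (h 0) ∈ D.Λd
    rw [affineIsometry_apply]
    exact D.Λd.add_mem (D.W₀_mem_Λd hg _ hh0) hg0
  inv_mem' := by
    rintro g ⟨hg, hg0⟩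
    refine ⟨D.W₀.inv_mem hg, ?_⟩
    have h : g⁻¹ 0 = -(g.linearIsometryEquiv⁻¹ (g 0)) := by
      apply g.injective
      rw [affineIsometry_apply g (-_), map_neg]
      have h1 : g (g⁻¹ 0) = 0 := g.apply_symm_apply 0
      have h2 : g.linearIsometryEquiv (g.linearIsometryEquiv⁻¹ (g 0)) = g 0 :=
        g.linearIsometryEquiv.apply_symm_apply (g 0)
      rw [h1, h2, neg_add_cancel]
    change g⁻¹ 0 ∈ D.Λd
    rw [h]
    exact D.Λd.neg_mem (D.W₀_mem_Λd (D.W₀.inv_mem hg) _ hg0)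

theorem affRefl_mem_W (D : InitialData Z n) {a : ℝ × Z} (ha : a ∈ D.Rred) :
    affRefl a ∈ D.W := by
  obtain ⟨m, α, hα, rfl⟩ := ha
  refine ⟨Subgroup.subset_closure ⟨α, hα, rfl⟩, ?_⟩
  have h : affRefl ((m * D.kind.mu α, α) : ℝ × Z) 0 = -(m • D.kind.dual α) := by
    rw [affRefl_apply, ← Int.cast_smul_eq_zsmul ℝ]
    simp [affEval, TwistKind.dual, smul_smul]
  rw [h]
  exact D.Λd.neg_mem (D.Λd.smul_mem m (D.dual_mem_Λd α hα))

theorem Δ_mem_Rred (D : InitialData Z n) (i : Fin (n + 1)) : D.Δ i ∈ D.Rred := by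
  refine Fin.cases ?_ (fun j => ?_) i
  · have hφ := D.neg_mem D.exists_highestRoot.choose_spec.1
    have hθ := D.neg_mem D.exists_highestShortRoot.choose_spec.1.1
    simp only [Δ, Fin.cons_zero, a₀, Rred, Set.mem_ofPred_eq]
    cases D.kind with
    | u => exact ⟨1, _, hφ, by simp [TwistKind.mu, highestRoot]⟩
    | t => exact ⟨1, _, hθ, by simp [TwistKind.mu, highestShortRoot]⟩
  · exact ⟨0, D.Δ₀ j, D.isBasis.mem j, by simp [Δ]⟩

/-- The simple reflection `sᵢ = s_{aᵢ}`, as an element of `W`. -/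
def s (D : InitialData Z n) (i : Fin (n + 1)) : D.W :=
  ⟨affRefl (D.Δ i), D.affRefl_mem_W (D.Δ_mem_Rred i)⟩

/-- The positive affine roots of `R^•` with respect to `Δ`. -/
def RredPos (D : InitialData Z n) : Set (ℝ × Z) :=
  {a ∈ D.Rred | ∃ m : Fin (n + 1) → ℕ, a = ∑ i, m i • D.Δ i}

/-- The negative affine roots of `R^•` with respect to `Δ`. -/
def RredNeg (D : InitialData Z n) : Set (ℝ × Z) := {a | -a ∈ D.RredPos}

/-- The length `l(w) = #(R^{•+} ∩ w⁻¹ R^{•-})`. -/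
def length (D : InitialData Z n) (w : D.W) : ℕ :=
  {a ∈ D.RredPos | affAct (w : Z ≃ᵃⁱ[ℝ] Z) a ∈ D.RredNeg}.ncard

/-! #### Multiplicity functions and the extended affine Hecke algebra -/

/-- The `W`-invariant functions `κ : R → ℂˣ`. -/
structure Multiplicity (D : InitialData Z n) where
  toFun : D.R → ℂˣ
  invariant : ∀ w ∈ D.W, ∀ a b : D.R, (b : ℝ × Z) = affAct w a → toFun b = toFun a

/-- The restriction `κ^•` of `κ` to `R^•`. -/
def Multiplicity.restrict {D : InitialData Z n} (κ : D.Multiplicity) : D.Rred → ℂˣ :=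
  fun a => κ.toFun ⟨a, Or.inl a.2⟩

/-- The value `κ_{aᵢ}` at the simple affine root `aᵢ`. -/
def simpleValue (D : InitialData Z n) (k : D.Rred → ℂˣ) (i : Fin (n + 1)) : ℂ :=
  k ⟨D.Δ i, D.Δ_mem_Rred i⟩

open Classical in
/-- `κ_{2a}` for `a ∈ R`, which is understood as `κ_a` if `2a ∉ R`. -/
def Multiplicity.double {D : InitialData Z n} (κ : D.Multiplicity) (a : D.R) : ℂ :=
  if h : (2 : ℝ) • (a : ℝ × Z) ∈ D.R then κ.toFun ⟨_, h⟩ else κ.toFun a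

/-- The extended affine braid group: generators `T_w` for `w ∈ W`, and relations
`T_v T_w = T_{vw}` if `l(vw) = l(v) + l(w)`. -/
abbrev Braid (D : InitialData Z n) : Type _ :=
  PresentedGroup {r : FreeGroup D.W | ∃ v w : D.W, D.length (v * w) = D.length v + D.length w ∧
    r = FreeGroup.of v * FreeGroup.of w * (FreeGroup.of (v * w))⁻¹}

/-- The generator `T_w` in the group algebra of the extended affine braid group. -/
def braidT (D : InitialData Z n) (w : D.W) : MonoidAlgebra ℂ D.Braid :=
  MonoidAlgebra.of ℂ D.Braid (PresentedGroup.of w)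

/-- The relations `(Tᵢ - kᵢ)(Tᵢ + kᵢ⁻¹) = 0`. -/
inductive HeckeRel (D : InitialData Z n) (k : D.Rred → ℂˣ) :
    MonoidAlgebra ℂ D.Braid → MonoidAlgebra ℂ D.Braid → Prop
  | quadratic (i : Fin (n + 1)) : HeckeRel D k
      ((D.braidT (D.s i) - algebraMap ℂ _ (D.simpleValue k i)) *
        (D.braidT (D.s i) + algebraMap ℂ _ (D.simpleValue k i)⁻¹)) 0

/-- The extended affine Hecke algebra `H(D, k)`: the quotient of the group algebra of the extended
affine braid group by the two-sided ideal generated by the quadratic relations. -/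
abbrev Hecke (D : InitialData Z n) (k : D.Rred → ℂˣ) : Type _ := RingQuot (D.HeckeRel k)

/-- The element `T_w` of `H(D, k)`. -/
def T (D : InitialData Z n) (k : D.Rred → ℂˣ) (w : D.W) : D.Hecke k :=
  RingQuot.mkAlgHom ℂ (D.HeckeRel k) (D.braidT w)

/-! #### The torus and the `q`-action -/

/-- The complex torus `T_Λ = Hom(Λ, ℂˣ)`. -/
abbrev Torus (D : InitialData Z n) : Type _ := AddChar D.Λ ℂˣ

/-- The algebra `ℂ[T_Λ]` of regular functions on `T_Λ`: the algebra of functions on `T_Λ` generated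
by the functions `e^v : t ↦ t^v` with `v ∈ Λ`. -/
def regular (D : InitialData Z n) : Subalgebra ℂ (D.Torus → ℂ) :=
  Algebra.adjoin ℂ (Set.range fun (v : D.Λ) (t : D.Torus) => ((t v : ℂˣ) : ℂ))

/-- The positive real number `q^r` as a nonzero complex number. -/
def qpow {q : ℝ} (hq : 0 < q) (r : ℝ) : ℂˣ :=
  Units.mk0 ((q ^ r : ℝ) : ℂ) (Complex.ofReal_ne_zero.mpr (Real.rpow_pos_of_pos hq r).ne')

theorem qpow_add {q : ℝ} (hq : 0 < q) (r r' : ℝ) :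
    qpow hq (r + r') = qpow hq r * qpow hq r' := by
  ext; simp [qpow, Real.rpow_add hq]

/-- The left action `w_q` of `w ∈ W` on `T_Λ`: if `w = τ(ξ) v` with `v ∈ W₀` and `ξ ∈ Λ^d`, then
`w_q t = q^ξ (v t)`, so that `(w_q t)^λ = q^{(λ, ξ)} t^{v⁻¹ λ}`. -/
def torusAct (D : InitialData Z n) {q : ℝ} (hq : 0 < q) (w : D.W) (t : D.Torus) : D.Torus where
  toFun v := qpow hq (inner ℝ (v : Z) ((w : Z ≃ᵃⁱ[ℝ] Z) 0)) *
    t ⟨(w : Z ≃ᵃⁱ[ℝ] Z).linearIsometryEquiv⁻¹ v, D.W₀_mem_Λ (D.W₀.inv_mem w.2.1) _ v.2⟩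
  map_zero_eq_one' := by
    have h : (⟨(w : Z ≃ᵃⁱ[ℝ] Z).linearIsometryEquiv⁻¹ ((0 : D.Λ) : Z),
        D.W₀_mem_Λ (D.W₀.inv_mem w.2.1) _ (0 : D.Λ).2⟩ : D.Λ) = 0 :=
      Subtype.ext (map_zero _)
    rw [h, AddChar.map_zero_eq_one, mul_one]
    ext; simp [qpow]
  map_add_eq_mul' := by
    intro x y
    have h : (⟨(w : Z ≃ᵃⁱ[ℝ] Z).linearIsometryEquiv⁻¹ ((x + y : D.Λ) : Z),
        D.W₀_mem_Λ (D.W₀.inv_mem w.2.1) _ (x + y).2⟩ : D.Λ) =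
        ⟨(w : Z ≃ᵃⁱ[ℝ] Z).linearIsometryEquiv⁻¹ x, D.W₀_mem_Λ (D.W₀.inv_mem w.2.1) _ x.2⟩ +
        ⟨(w : Z ≃ᵃⁱ[ℝ] Z).linearIsometryEquiv⁻¹ y, D.W₀_mem_Λ (D.W₀.inv_mem w.2.1) _ y.2⟩ :=
      Subtype.ext (map_add _ _ _)
    rw [h, AddChar.map_add_eq_mul, Submodule.coe_add, inner_add_left, qpow_add]
    exact mul_mul_mul_comm _ _ _ _

/-- The action `(w_q p)(t) = p(w_q⁻¹ t)` on functions on `T_Λ`. -/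
def qAct (D : InitialData Z n) {q : ℝ} (hq : 0 < q) (w : D.W) (p : D.Torus → ℂ) :
    D.Torus → ℂ :=
  fun t => p (D.torusAct hq w⁻¹ t)

theorem Rred_snd_mem_Λ (D : InitialData Z n) {a : ℝ × Z} (ha : a ∈ D.Rred) : a.2 ∈ D.Λ := by
  obtain ⟨m, α, hα, rfl⟩ := ha
  exact D.root_mem_Λ α hα

/-- `t_q^{aᵢ}` for the simple affine root `aᵢ`, where `t_q^{r c + λ} = q^r t^λ`. -/
def evalSimple (D : InitialData Z n) {q : ℝ} (hq : 0 < q) (i : Fin (n + 1)) (t : D.Torus) : ℂ :=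
  qpow hq (D.Δ i).1 * t ⟨(D.Δ i).2, D.Rred_snd_mem_Λ (D.Δ_mem_Rred i)⟩

/-- The simple affine root `aᵢ` as an element of `R`. -/
def simpleRoot (D : InitialData Z n) (i : Fin (n + 1)) : D.R := ⟨D.Δ i, Or.inl (D.Δ_mem_Rred i)⟩

/-- `π` is given on the generators `Tᵢ` (`0 ≤ i ≤ n`) and `ω` (`ω ∈ Ω`, that is, `l(ω) = 0`) by the
formulas of the basic representation.  The first formula is an identity of rational functions on
`T_Λ`, and is imposed at the points `t` at which its denominator `1 - t_q^{2aᵢ}` is nonzero. -/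
structure IsBasicRepresentation (D : InitialData Z n) (κ : D.Multiplicity) {q : ℝ} (hq : 0 < q)
    (π : D.Hecke κ.restrict →ₐ[ℂ] Module.End ℂ D.regular) : Prop where
  map_simple : ∀ (i : Fin (n + 1)) (p : D.regular) (t : D.Torus),
    1 - D.evalSimple hq i t ^ 2 ≠ 0 →
    (π (D.T κ.restrict (D.s i)) p : D.Torus → ℂ) t =
      (κ.toFun (D.simpleRoot i) : ℂ) * D.qAct hq (D.s i) p t +
      ((κ.toFun (D.simpleRoot i) : ℂ) - (κ.toFun (D.simpleRoot i) : ℂ)⁻¹ +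
          (κ.double (D.simpleRoot i) - (κ.double (D.simpleRoot i))⁻¹) * D.evalSimple hq i t) /
        (1 - D.evalSimple hq i t ^ 2) *
      ((p : D.Torus → ℂ) t - D.qAct hq (D.s i) p t)
  map_omega : ∀ (ω : D.W), D.length ω = 0 → ∀ (p : D.regular) (t : D.Torus),
    (π (D.T κ.restrict ω) p : D.Torus → ℂ) t = D.qAct hq ω p t

end InitialData

end

/-!
# The basic representation of the extended affine Hecke algebra

*Existence.*  Put `x = t_q^{aᵢ}` and `b = (k + k' x) / (1 - x²)`, where `k = κ - κ⁻¹` for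
`κ = κ_{aᵢ}`, and `k'` is the same expression in `κ_{2aᵢ}`.  The prescribed operator of `Tᵢ` is
`p ↦ b p + (κ - b) (p ∘ sᵢ)`.  It preserves regular functions, because `p - p ∘ sᵢ` is divisible
by `1 - x` for every character `p`, and by `1 - x²` if all pairings `(Λ, aᵢ^∨)` are even, while
`k' = k` if they are not (`exists_dividedDifference`).  Under `sᵢ` the coefficient `b` goes to
`k - b`, which gives the quadratic relation (`heckeEnd_sq`).

The braid relation for a pair `i`, `j` is an identity between operators on functions on an orbit of
the dihedral group generated by `sᵢ` and `sⱼ`, so that it amounts to finitely many identities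
between rational functions of the two coordinates `t_q^{aᵢ}` and `t_q^{aⱼ}`.  These are all
consequences of a few relations between the values of `b` at the positive roots of the root system
of rank two, the simplest of which is the functional equation of `x ↦ 1 / (1 - x)`
(`lusztigOp_braid_three`, `lusztigOp_braid_four`, `lusztigOp_braid_six`).  An extended affine Weyl
group has a presentation by reduced words: a family of operators that satisfies the braid relations,
and on which the elements of length `0` act by permutation of the indices, extends to a family
indexed by `W` which is multiplicative whenever lengths add (`BraidFamily.exists_extension`).  This
is proved by the usual comparison of two descents of the same element; only pairs `i`, `j` for which
`sᵢ` and `sⱼ` generate a finite group occur in it (`cartan_mul_le`).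

*Injectivity.*  The elements `T_w` span the Hecke algebra (`span_T`).  At a point `t` of the torus
that avoids countably many proper closed subsets, the operator of `T_w` is a linear combination of
evaluations at points `v⁻¹ t`, in which `v = w` has a nonzero coefficient, and all other `v` are
shorter than `w` (`exists_expansion`).  As `q ≠ 1`, the group `W` acts freely on the orbit of such
a point, and evaluations at distinct points of the torus are independent on regular functions
(`eq_zero_of_sum_chi_eq_zero`).  Hence a nontrivial combination of the operators of the `T_w` is not
zero: look at an element of maximal length.

*Uniqueness.*  The formula determines the operator of `Tᵢ`, because regular functions are determined
by their values at generic points (`exists_isGeneric`), and the `Tᵢ` and `T_ω` generate the Hecke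
algebra (`hecke_hom_ext`).
-/

noncomputable section

/-! ### Cones of natural combinations of independent vectors -/

section Cone

variable {V : Type*} [AddCommGroup V] {ι : Type*}

/-- The monoid of linear combinations of the vectors `Δ i` with natural coefficients. -/
def natCone [Fintype ι] (Δ : ι → V) : AddSubmonoid V where
  carrier := {v | ∃ m : ι → ℕ, v = ∑ i, m i • Δ i}
  zero_mem' := ⟨0, by simp⟩
  add_mem' := by
    rintro _ _ ⟨m, rfl⟩ ⟨m', rfl⟩
    exact ⟨m + m', by simp [add_smul, Finset.sum_add_distrib]⟩

theorem self_mem_natCone [Fintype ι] (Δ : ι → V) (i : ι) : Δ i ∈ natCone Δ := by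
  classical
  exact ⟨Pi.single i 1, by simp [Pi.single_apply, ite_smul]⟩

variable [Module ℝ V]

theorem exists_coord {Δ : ι → V} (h : LinearIndependent ℝ Δ) (i : ι) :
    ∃ f : V →ₗ[ℝ] ℝ, f (Δ i) = 1 ∧ ∀ j, j ≠ i → f (Δ j) = 0 := by
  classical
  let b := Module.Basis.span h
  obtain ⟨f, hf⟩ := LinearMap.exists_extend (b.constr ℝ (Pi.single i (1 : ℝ)))
  have key : ∀ j, f (Δ j) = (Pi.single i (1 : ℝ) : ι → ℝ) j := by
    intro j
    have h1 : (b j : V) = Δ j := congrArg Subtype.val (Module.Basis.span_apply h j)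
    have h2 := LinearMap.congr_fun hf (b j)
    simp only [LinearMap.comp_apply, Submodule.subtype_apply, Module.Basis.constr_basis] at h2
    rw [← h1, h2]
  exact ⟨f, by simp [key], fun j hj => by simp [key, hj]⟩

/-- The `i`-th coordinate with respect to the independent family `Δ`, extended to a linear form
on the whole space. -/
def coord {Δ : ι → V} (h : LinearIndependent ℝ Δ) (i : ι) : V →ₗ[ℝ] ℝ :=
  (exists_coord h i).choose

theorem coord_self {Δ : ι → V} (h : LinearIndependent ℝ Δ) (i : ι) : coord h i (Δ i) = 1 :=
  (exists_coord h i).choose_spec.1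

theorem coord_of_ne {Δ : ι → V} (h : LinearIndependent ℝ Δ) {i j : ι} (hij : j ≠ i) :
    coord h i (Δ j) = 0 :=
  (exists_coord h i).choose_spec.2 j hij

variable [Fintype ι]

theorem coord_sum {Δ : ι → V} (h : LinearIndependent ℝ Δ) (m : ι → ℕ) (i : ι) :
    coord h i (∑ j, m j • Δ j) = m i := by
  rw [map_sum, Finset.sum_eq_single i]
  · rw [map_nsmul, coord_self]; simp
  · intro j _ hj; rw [map_nsmul, coord_of_ne h hj, smul_zero]
  · simp

theorem coord_nonneg {Δ : ι → V} (h : LinearIndependent ℝ Δ) {v : V} (hv : v ∈ natCone Δ)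
    (i : ι) : 0 ≤ coord h i v := by
  obtain ⟨m, rfl⟩ := hv
  rw [coord_sum]; positivity

theorem eq_sum_coord {Δ : ι → V} (h : LinearIndependent ℝ Δ) {v : V} (hv : v ∈ natCone Δ) :
    v = ∑ i, coord h i v • Δ i := by
  obtain ⟨m, rfl⟩ := hv
  simp only [coord_sum, Nat.cast_smul_eq_nsmul]

theorem eq_zero_of_mem_natCone_of_neg_mem {Δ : ι → V} (h : LinearIndependent ℝ Δ) {v : V}
    (h1 : v ∈ natCone Δ) (h2 : -v ∈ natCone Δ) : v = 0 := by
  rw [eq_sum_coord h h1]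
  refine Finset.sum_eq_zero fun i _ => ?_
  have h3 := coord_nonneg h h1 i
  have h4 := coord_nonneg h h2 i
  rw [map_neg] at h4
  rw [le_antisymm (by linarith) h3, zero_smul]

end Cone

/-! ### Finite root systems -/

section Finite

variable {Z : Type*} [NormedAddCommGroup Z] [InnerProductSpace ℝ Z]

theorem inner_coroot (v z : Z) : inner ℝ (coroot v) z = 2 * inner ℝ v z / ‖v‖ ^ 2 := by
  rw [coroot, inner_smul_left]; simp; ring

theorem inner_coroot_self {v : Z} (hv : v ≠ 0) : inner ℝ (coroot v) v = 2 := by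
  rw [inner_coroot, real_inner_self_eq_norm_sq]
  have : ‖v‖ ≠ 0 := norm_ne_zero_iff.mpr hv
  field_simp

theorem inner_coroot_mul (v z : Z) (hv : v ≠ 0) :
    inner ℝ (coroot v) z * ‖v‖ ^ 2 = 2 * inner ℝ v z := by
  rw [inner_coroot]
  have : ‖v‖ ≠ 0 := norm_ne_zero_iff.mpr hv
  field_simp

theorem inner_coroot_pos_iff {v : Z} (hv : v ≠ 0) (z : Z) :
    0 < inner ℝ (coroot v) z ↔ 0 < inner ℝ v z := by
  have : 0 < ‖v‖ ^ 2 := by positivity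
  rw [inner_coroot, div_pos_iff_of_pos_right this]
  constructor <;> intro h <;> linarith

theorem inner_coroot_neg_iff {v : Z} (hv : v ≠ 0) (z : Z) :
    inner ℝ (coroot v) z < 0 ↔ inner ℝ v z < 0 := by
  have : 0 < ‖v‖ ^ 2 := by positivity
  rw [inner_coroot, div_neg_iff]
  constructor
  · rintro (h | h)
    · linarith
    · linarith
  · intro h; right; exact ⟨by linarith, this⟩

variable {n : ℕ} {R₀ : Set Z} {Δ₀ : Fin n → Z}

namespace IsIrreducibleRootSystem

theorem ne_zero (hR : IsIrreducibleRootSystem R₀) {α : Z} (h : α ∈ R₀) : α ≠ 0 :=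
  fun h0 => hR.zero_notMem (h0 ▸ h)

/-- Two roots for which the product of the two Cartan integers is at least `4` are proportional,
by the equality case of the Cauchy–Schwarz inequality. -/
theorem eq_or_eq_neg_of_four_le (hR : IsIrreducibleRootSystem R₀) {α β : Z} (hα : α ∈ R₀)
    (hβ : β ∈ R₀) (h : 4 ≤ inner ℝ (coroot α) β * inner ℝ (coroot β) α) :
    β = α ∨ β = -α := by
  have hα0 := hR.ne_zero hα
  have hβ0 := hR.ne_zero hβ
  have ha : 0 < ‖α‖ := norm_pos_iff.mpr hα0
  have hb : 0 < ‖β‖ := norm_pos_iff.mpr hβ0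
  have h1 : (‖α‖ * ‖β‖) ^ 2 ≤ (inner ℝ α β) ^ 2 := by
    rw [inner_coroot, inner_coroot, real_inner_comm α β, div_mul_div_comm,
      le_div_iff₀ (by positivity)] at h
    nlinarith
  have h2 : |inner ℝ α β / (‖α‖ * ‖β‖)| = 1 := by
    rw [abs_div, abs_of_pos (mul_pos ha hb), div_eq_one_iff_eq (mul_pos ha hb).ne']
    refine le_antisymm (abs_real_inner_le_norm α β) ?_
    exact abs_of_pos (mul_pos ha hb) ▸ sq_le_sq.mp h1
  obtain ⟨-, r, -, rfl⟩ := (abs_real_inner_div_norm_mul_norm_eq_one_iff α β).mp h2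
  rcases hR.reduced α hα r hβ with rfl | rfl
  · left; simp
  · right; simp

theorem refl_eq (hR : IsIrreducibleRootSystem R₀) {α β : Z} (hα : α ∈ R₀) (hβ : β ∈ R₀) :
    ∃ m : ℤ, inner ℝ (coroot α) β = m ∧ linRefl α β = β - (m : ℝ) • α ∧
      β - (m : ℝ) • α ∈ R₀ := by
  obtain ⟨m, hm⟩ := hR.crystallographic α hα β hβ
  have h : linRefl α β = β - (m : ℝ) • α := by rw [linRefl_apply, hm]
  exact ⟨m, hm, h, h ▸ hR.reflection_mem α hα β hβ⟩

end IsIrreducibleRootSystem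

/-- A vector is dominant if its inner products with the simple roots are nonnegative. -/
def IsDominant (Δ₀ : Fin n → Z) (v : Z) : Prop := ∀ i, 0 ≤ inner ℝ (Δ₀ i) v

theorem IsDominant.inner_nonneg {v : Z} (h : IsDominant Δ₀ v) {u : Z} (hu : u ∈ natCone Δ₀) :
    0 ≤ inner ℝ u v := by
  obtain ⟨m, rfl⟩ := hu
  rw [sum_inner]
  refine Finset.sum_nonneg fun i _ => ?_
  rw [← Nat.cast_smul_eq_nsmul ℝ, inner_smul_left]
  exact mul_nonneg (by simp) (h i)

namespace IsRootBasis

theorem mem_or_neg_mem (hB : IsRootBasis R₀ Δ₀) {α : Z} (h : α ∈ R₀) :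
    α ∈ natCone Δ₀ ∨ -α ∈ natCone Δ₀ := by
  rcases hB.pos_or_neg α h with ⟨m, hm⟩ | ⟨m, hm⟩
  · exact Or.inl ⟨m, hm⟩
  · exact Or.inr ⟨m, by rw [hm, neg_neg]⟩

theorem inner_nonpos (hR : IsIrreducibleRootSystem R₀) (hB : IsRootBasis R₀ Δ₀) {i j : Fin n}
    (hij : i ≠ j) : inner ℝ (Δ₀ i) (Δ₀ j) ≤ 0 := by
  by_contra! hpos
  obtain ⟨m, hm, -, hmem⟩ := hR.refl_eq (hB.mem i) (hB.mem j)
  have hm0 : (0 : ℝ) < m := by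
    rw [← hm]; exact (inner_coroot_pos_iff (hR.ne_zero (hB.mem i)) _).mpr hpos
  rcases hB.mem_or_neg_mem hmem with h | h
  · have h1 := coord_nonneg hB.linearIndependent h i
    rw [map_sub, map_smul, coord_self, coord_of_ne _ hij.symm, smul_eq_mul] at h1
    linarith
  · have h1 := coord_nonneg hB.linearIndependent h j
    rw [map_neg, map_sub, map_smul, coord_self, coord_of_ne _ hij, smul_eq_mul] at h1
    linarith

theorem isDominant_of_isMaximalRoot (hR : IsIrreducibleRootSystem R₀) (hB : IsRootBasis R₀ Δ₀)
    {X : Set Z} (hXR : X ⊆ R₀)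
    (hX : ∀ i, ∀ α ∈ X, inner ℝ (Δ₀ i) α < 0 → linRefl (Δ₀ i) α ∈ X)
    {α : Z} (h : IsMaximalRoot Δ₀ X α) : IsDominant Δ₀ α := by
  intro i
  by_contra! hneg
  have hi0 := hR.ne_zero (hB.mem i)
  obtain ⟨m, hm, heq, -⟩ := hR.refl_eq (hB.mem i) (hXR h.1)
  have hm0 : m < 0 := by
    have : inner ℝ (coroot (Δ₀ i)) α < 0 := (inner_coroot_neg_iff hi0 _).mpr hneg
    rw [hm] at this; exact_mod_cast this
  have h1 := h.2 _ (hX i α h.1 hneg) ?_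
  · rw [heq, sub_eq_self, smul_eq_zero] at h1
    rcases h1 with h1 | h1
    · exact hm0.ne (by exact_mod_cast h1)
    · exact hi0 h1
  · have h2 : (-m).toNat • Δ₀ i ∈ natCone Δ₀ := nsmul_mem (self_mem_natCone _ i) _
    have h3 : linRefl (Δ₀ i) α - α = (-m).toNat • Δ₀ i := by
      rw [heq, ← Nat.cast_smul_eq_nsmul ℝ]
      have : (((-m).toNat : ℕ) : ℝ) = -m := by
        have : (((-m).toNat : ℕ) : ℤ) = -m := Int.toNat_of_nonneg (by omega)
        exact_mod_cast this
      rw [this]; module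
    rw [h3]; exact h2

/-- Every root lies below a dominant root of the same length. -/
theorem exists_isDominant_ge (hR : IsIrreducibleRootSystem R₀) (hB : IsRootBasis R₀ Δ₀) {α : Z}
    (hα : α ∈ R₀) :
    ∃ β ∈ R₀, ‖β‖ = ‖α‖ ∧ β - α ∈ natCone Δ₀ ∧ IsDominant Δ₀ β := by
  let X : Set Z := {β ∈ R₀ | ‖β‖ = ‖α‖ ∧ β - α ∈ natCone Δ₀}
  obtain ⟨β, hβ⟩ := exists_isMaximalRoot hB.linearIndependent (X := X)
    (hR.finite.subset fun _ h => h.1) ⟨α, hα, rfl, by simp [zero_mem]⟩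
  refine ⟨β, hβ.1.1, hβ.1.2.1, hβ.1.2.2,
    isDominant_of_isMaximalRoot hR hB (fun _ h => h.1) ?_ hβ⟩
  rintro i γ ⟨hγ, hn, hc⟩ hneg
  refine ⟨hR.reflection_mem _ (hB.mem i) _ hγ, by rw [LinearIsometryEquiv.norm_map, hn], ?_⟩
  obtain ⟨m, hm, heq, -⟩ := hR.refl_eq (hB.mem i) hγ
  have hm0 : m < 0 := by
    have : inner ℝ (coroot (Δ₀ i)) γ < 0 :=
      (inner_coroot_neg_iff (hR.ne_zero (hB.mem i)) _).mpr hneg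
    rw [hm] at this; exact_mod_cast this
  have h3 : linRefl (Δ₀ i) γ - α = (γ - α) + (-m).toNat • Δ₀ i := by
    rw [heq, ← Nat.cast_smul_eq_nsmul ℝ]
    have : (((-m).toNat : ℕ) : ℝ) = -m := by
      have : (((-m).toNat : ℕ) : ℤ) = -m := Int.toNat_of_nonneg (by omega)
      exact_mod_cast this
    rw [this]; module
  rw [h3]
  exact add_mem hc (nsmul_mem (self_mem_natCone _ i) _)

theorem neg_mem_of_inner_neg (hB : IsRootBasis R₀ Δ₀) {γ δ : Z} (hγ : IsDominant Δ₀ γ)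
    (hδ : δ ∈ R₀) (h : inner ℝ δ γ < 0) : -δ ∈ natCone Δ₀ :=
  (hB.mem_or_neg_mem hδ).resolve_left fun h1 => absurd (hγ.inner_nonneg h1) (not_le.mpr h)

theorem mem_natCone_of_isDominant (hR : IsIrreducibleRootSystem R₀) (hB : IsRootBasis R₀ Δ₀)
    {γ : Z} (hγR : γ ∈ R₀) (hγ : IsDominant Δ₀ γ) : γ ∈ natCone Δ₀ := by
  refine (hB.mem_or_neg_mem hγR).resolve_right fun h1 => ?_
  have h2 := hγ.inner_nonneg h1
  rw [inner_neg_left, real_inner_self_eq_norm_sq] at h2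
  have : 0 < ‖γ‖ ^ 2 := by have := norm_pos_iff.mpr (hR.ne_zero hγR); positivity
  linarith

/-- If the simple roots indexed by `J` are orthogonal to the others, then a positive root is
supported on `J` or on its complement: otherwise, for one of minimal height, reflecting in a simple
root removes all of one of the two components of the root, whereas the reflection changes the sign
of that component. -/
theorem coord_eq_zero_of_orthogonal (hR : IsIrreducibleRootSystem R₀) (hB : IsRootBasis R₀ Δ₀)
    (N : ℕ) :
    ∀ (J : Set (Fin n)), (∀ i ∈ J, ∀ j ∉ J, inner ℝ (Δ₀ i) (Δ₀ j) = 0) →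
    ∀ m : Fin n → ℕ, ∑ i, m i = N → ∑ i, m i • Δ₀ i ∈ R₀ →
    ∀ a ∈ J, ∀ b ∉ J, m a ≠ 0 → m b ≠ 0 → False := by
  induction N using Nat.strong_induction_on with
  | _ N ih =>
    intro J hJ m hmN hmR a ha b hb hma hmb
    set α := ∑ i, m i • Δ₀ i with hα
    have hpos : ∃ i, 0 < inner ℝ (Δ₀ i) α := by
      by_contra! hcon
      have h1 : inner ℝ α α ≤ 0 := by
        conv_lhs => arg 2; rw [hα]
        rw [sum_inner]
        refine Finset.sum_nonpos fun i _ => ?_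
        rw [← Nat.cast_smul_eq_nsmul ℝ, inner_smul_left]
        exact mul_nonpos_of_nonneg_of_nonpos (by simp) (hcon i)
      rw [real_inner_self_eq_norm_sq] at h1
      have := norm_pos_iff.mpr (hR.ne_zero hmR)
      nlinarith
    obtain ⟨i, hi⟩ := hpos
    have hi0 := hR.ne_zero (hB.mem i)
    obtain ⟨p, hp, -, hmem⟩ := hR.refl_eq (hB.mem i) hmR
    have hp0 : (0 : ℝ) < p := by rw [← hp]; exact (inner_coroot_pos_iff hi0 _).mpr hi
    have li := hB.linearIndependent
    have hcoord : ∀ k, coord li k (α - (p : ℝ) • Δ₀ i) = m k - p * coord li k (Δ₀ i) := by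
      intro k
      rw [map_sub, map_smul, smul_eq_mul, hα, coord_sum]
    have hne : ∃ k, k ≠ i ∧ m k ≠ 0 := by
      by_cases hai : a = i
      · exact ⟨b, fun h => hb (h.trans hai.symm ▸ ha), hmb⟩
      · exact ⟨a, hai, hma⟩
    have hcone : α - (p : ℝ) • Δ₀ i ∈ natCone Δ₀ := by
      refine (hB.mem_or_neg_mem hmem).resolve_right fun h => ?_
      obtain ⟨k, hk, hmk⟩ := hne
      have h1 := coord_nonneg li h k
      rw [map_neg, hcoord, coord_of_ne li hk.symm, mul_zero, sub_zero] at h1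
      have : (0 : ℝ) < m k := by positivity
      linarith
    obtain ⟨m', hm'⟩ := hcone
    have hm'k : ∀ k, (m' k : ℝ) = m k - p * coord li k (Δ₀ i) := by
      intro k; rw [← hcoord, hm', coord_sum]
    have hoff : ∀ k, k ≠ i → m' k = m k := by
      intro k hk
      have := hm'k k
      rw [coord_of_ne li hk.symm, mul_zero, sub_zero] at this
      exact_mod_cast this
    have hon : (m' i : ℝ) = m i - p := by
      have := hm'k i
      rwa [coord_self, mul_one] at this
    have hlt : ∑ k, m' k < N := by
      rw [← hmN]
      refine Finset.sum_lt_sum (fun k _ => ?_) ⟨i, Finset.mem_univ _, ?_⟩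
      · by_cases hk : k = i
        · subst hk
          have : (m' k : ℝ) ≤ m k := by linarith
          exact_mod_cast this
        · exact (hoff k hk).le
      · have : (m' i : ℝ) < m i := by linarith
        exact_mod_cast this
    have hm'R : ∑ k, m' k • Δ₀ k ∈ R₀ := hm' ▸ hmem
    -- the component of the root that contains `i` is `p • Δ₀ i`
    have hcomp : ∀ K : Set (Fin n), i ∈ K → (∀ k ∉ K, inner ℝ (Δ₀ i) (Δ₀ k) = 0) →
        (∀ k ∈ K, m' k = 0) → False := by
      intro K hiK hK hzero
      have h1 : inner ℝ (Δ₀ i) α = p * ‖Δ₀ i‖ ^ 2 := by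
        rw [hα, inner_sum, Finset.sum_eq_single i]
        · rw [← Nat.cast_smul_eq_nsmul ℝ, inner_smul_right, real_inner_self_eq_norm_sq]
          have h2 := hzero i hiK
          rw [h2] at hon
          rw [show (m i : ℝ) = p by push_cast at hon; linarith]
        · intro k _ hk
          rw [← Nat.cast_smul_eq_nsmul ℝ, inner_smul_right]
          by_cases hkK : k ∈ K
          · rw [← hoff k hk, hzero k hkK]; simp
          · rw [hK k hkK, mul_zero]
        · simp
      have h2 := inner_coroot_mul (Δ₀ i) α hi0
      rw [hp, h1] at h2
      have : 0 < ‖Δ₀ i‖ ^ 2 := by have := norm_pos_iff.mpr hi0; positivity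
      nlinarith
    by_cases hiJ : i ∈ J
    · refine hcomp J hiJ (fun k hk => hJ i hiJ k hk) fun k hk => ?_
      by_contra hk0
      refine ih _ hlt J hJ m' rfl hm'R k hk b hb hk0 ?_
      rwa [hoff b (fun h => hb (h ▸ hiJ))]
    · refine hcomp Jᶜ hiJ (fun k hk => ?_) fun k hk => ?_
      · rw [real_inner_comm]; exact hJ k (not_not.mp hk) i hiJ
      · by_contra hk0
        refine ih _ hlt J hJ m' rfl hm'R a ha k hk ?_ hk0
        rwa [hoff a (fun h => hiJ (h ▸ ha))]

/-- Two dominant roots of an irreducible root system are not orthogonal. -/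
theorem inner_pos_of_isDominant (hR : IsIrreducibleRootSystem R₀) (hB : IsRootBasis R₀ Δ₀)
    {β γ : Z} (hβR : β ∈ R₀) (hγR : γ ∈ R₀) (hβ : IsDominant Δ₀ β) (hγ : IsDominant Δ₀ γ) :
    0 < inner ℝ β γ := by
  have hβc := mem_natCone_of_isDominant hR hB hβR hβ
  have hγc := mem_natCone_of_isDominant hR hB hγR hγ
  refine lt_of_le_of_ne (hγ.inner_nonneg hβc) fun h0 => ?_
  obtain ⟨m, hm⟩ := hβc
  let J : Set (Fin n) := {i | m i ≠ 0}
  have hJγ : ∀ i ∈ J, inner ℝ (Δ₀ i) γ = 0 := by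
    intro i hi
    have h1 : ∑ k, (m k : ℝ) * inner ℝ (Δ₀ k) γ = 0 := by
      rw [h0, hm, sum_inner]
      refine Finset.sum_congr rfl fun k _ => ?_
      rw [← Nat.cast_smul_eq_nsmul ℝ, inner_smul_left]; simp
    have h2 := (Finset.sum_eq_zero_iff_of_nonneg
      (fun k _ => mul_nonneg (Nat.cast_nonneg _) (hγ k))).mp h1 i (Finset.mem_univ _)
    exact (mul_eq_zero.mp h2).resolve_left (by exact_mod_cast hi)
  have hJ : ∀ i ∈ J, ∀ j ∉ J, inner ℝ (Δ₀ i) (Δ₀ j) = 0 := by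
    intro i hi j hj
    have h1 : ∑ k, (m k : ℝ) * -inner ℝ (Δ₀ k) (Δ₀ j) = -inner ℝ (Δ₀ j) β := by
      rw [real_inner_comm, hm, sum_inner, ← Finset.sum_neg_distrib]
      refine Finset.sum_congr rfl fun k _ => ?_
      rw [← Nat.cast_smul_eq_nsmul ℝ, inner_smul_left]; simp
    have hterm : ∀ k ∈ Finset.univ, 0 ≤ (m k : ℝ) * -inner ℝ (Δ₀ k) (Δ₀ j) := by
      intro k _
      by_cases hkj : k = j
      · subst hkj
        have : m k = 0 := by simpa [J] using hj
        simp [this]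
      · exact mul_nonneg (Nat.cast_nonneg _) (by linarith [inner_nonpos hR hB hkj])
    have h2 : ∑ k, (m k : ℝ) * -inner ℝ (Δ₀ k) (Δ₀ j) = 0 :=
      le_antisymm (by rw [h1]; linarith [hβ j]) (Finset.sum_nonneg hterm)
    have h3 := (Finset.sum_eq_zero_iff_of_nonneg hterm).mp h2 i (Finset.mem_univ _)
    have h4 := (mul_eq_zero.mp h3).resolve_left (by exact_mod_cast hi)
    linarith
  -- the roots split into those supported on `J` and those supported on its complement
  let P : Set (Fin n) → Set Z := fun K => {α ∈ R₀ | ∃ c : Fin n → ℝ, (∀ k ∉ K, c k = 0) ∧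
    α = ∑ k, c k • Δ₀ k}
  have hunion : P J ∪ P Jᶜ = R₀ := by
    refine Set.Subset.antisymm (Set.union_subset (fun _ h => h.1) fun _ h => h.1) ?_
    have hposroot : ∀ m' : Fin n → ℕ, ∑ k, m' k • Δ₀ k ∈ R₀ →
        (∀ k ∉ J, m' k = 0) ∨ (∀ k ∉ Jᶜ, m' k = 0) := by
      intro m' hm'
      by_contra! hcon
      obtain ⟨⟨b, hb, hmb⟩, a, ha, hma⟩ := hcon
      exact coord_eq_zero_of_orthogonal hR hB _ J hJ m' rfl hm' a (not_not.mp ha) b hb hma hmb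
    intro α hα
    rcases hB.pos_or_neg α hα with ⟨m', hm'⟩ | ⟨m', hm'⟩
    · rcases hposroot m' (hm' ▸ hα) with h | h
      · exact Or.inl ⟨hα, fun k => m' k, fun k hk => by simp [h k hk],
          by simp [hm', Nat.cast_smul_eq_nsmul]⟩
      · exact Or.inr ⟨hα, fun k => m' k, fun k hk => by simp [h k hk],
          by simp [hm', Nat.cast_smul_eq_nsmul]⟩
    · have hneg : ∑ k, m' k • Δ₀ k ∈ R₀ := by
        have h := hR.reflection_mem α hα α hα
        rw [linRefl, Submodule.reflection_orthogonalComplement_singleton_eq_neg, hm', neg_neg] at h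
        exact h
      rcases hposroot m' hneg with h | h
      · exact Or.inl ⟨hα, fun k => -(m' k : ℝ), fun k hk => by simp [h k hk],
          by simp [hm', Nat.cast_smul_eq_nsmul]⟩
      · exact Or.inr ⟨hα, fun k => -(m' k : ℝ), fun k hk => by simp [h k hk],
          by simp [hm', Nat.cast_smul_eq_nsmul]⟩
  have horth : ∀ α ∈ P J, ∀ α' ∈ P Jᶜ, inner ℝ α α' = 0 := by
    rintro _ ⟨-, c, hc, rfl⟩ _ ⟨-, c', hc', rfl⟩
    rw [sum_inner]
    refine Finset.sum_eq_zero fun i _ => ?_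
    rw [inner_sum]
    refine Finset.sum_eq_zero fun j _ => ?_
    rw [inner_smul_left, inner_smul_right]
    by_cases hi : i ∈ J
    · by_cases hj : j ∈ J
      · rw [hc' j (not_not.mpr hj)]; simp
      · rw [hJ i hi j hj]; simp
    · rw [hc i hi]; simp
  have hβP : β ∈ P J := ⟨hβR, fun k => m k, fun k hk => by simpa [J] using hk,
    by simp [hm, Nat.cast_smul_eq_nsmul]⟩
  rcases hR.irreducible _ _ hunion horth with h | h
  · rw [h] at hβP; exact hβP
  · have hall : ∀ i, inner ℝ (Δ₀ i) γ = 0 := by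
      intro i
      by_cases hi : i ∈ J
      · exact hJγ i hi
      · have : Δ₀ i ∈ P Jᶜ := by
          classical
          refine ⟨hB.mem i, Pi.single i 1, fun k hk => ?_, by simp [Pi.single_apply, ite_smul]⟩
          rw [Pi.single_apply, if_neg]
          rintro rfl
          exact hk hi
        rw [h] at this; exact this.elim
    obtain ⟨m', hm'⟩ := hγc
    have h1 : inner ℝ γ γ = 0 := by
      conv_lhs => arg 2; rw [hm']
      rw [sum_inner]
      refine Finset.sum_eq_zero fun i _ => ?_
      rw [← Nat.cast_smul_eq_nsmul ℝ, inner_smul_left, hall i, mul_zero]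
    exact hR.ne_zero hγR (inner_self_eq_zero.mp h1)

/-- A dominant root `β` is dominated by a positive multiple of any other dominant root `γ`: the
reflection `β - m γ` is a root that pairs negatively with `γ`, hence a negative root. -/
theorem smul_sub_mem_natCone (hR : IsIrreducibleRootSystem R₀) (hB : IsRootBasis R₀ Δ₀)
    {β γ : Z} (hβR : β ∈ R₀) (hγR : γ ∈ R₀) (hβ : IsDominant Δ₀ β) (hγ : IsDominant Δ₀ γ) :
    ∃ m : ℕ, 0 < m ∧ inner ℝ (coroot γ) β = m ∧ m • γ - β ∈ natCone Δ₀ := by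
  have hpos := inner_pos_of_isDominant hR hB hβR hγR hβ hγ
  have hγ0 := hR.ne_zero hγR
  obtain ⟨m, hm, heq, hmem⟩ := hR.refl_eq hγR hβR
  have hm0 : (0 : ℝ) < m := by
    rw [← hm]; exact (inner_coroot_pos_iff hγ0 _).mpr (by rwa [real_inner_comm])
  have hm0' : 0 < m := by exact_mod_cast hm0
  lift m to ℕ using hm0'.le
  refine ⟨m, by exact_mod_cast hm0', by simpa using hm, ?_⟩
  have h1 := hB.neg_mem_of_inner_neg hγ hmem ?_
  · rw [neg_sub] at h1
    simpa [Nat.cast_smul_eq_nsmul] using h1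
  · have h2 := inner_coroot_mul γ β hγ0
    rw [hm] at h2
    rw [inner_sub_left, inner_smul_left, real_inner_self_eq_norm_sq]
    simp only [conj_trivial]
    rw [h2, real_inner_comm γ β] at *
    linarith

/-- The highest root dominates every root. -/
theorem highest_sub_mem (hR : IsIrreducibleRootSystem R₀) (hB : IsRootBasis R₀ Δ₀) {φ α : Z}
    (hφ : IsMaximalRoot Δ₀ R₀ φ) (hα : α ∈ R₀) : φ - α ∈ natCone Δ₀ := by
  have hφd : IsDominant Δ₀ φ := isDominant_of_isMaximalRoot hR hB subset_rfl
    (fun i β hβ _ => hR.reflection_mem _ (hB.mem i) _ hβ) hφ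
  obtain ⟨β, hβR, -, hβα, hβd⟩ := exists_isDominant_ge hR hB hα
  suffices h : φ - β ∈ natCone Δ₀ by
    have := add_mem h hβα
    rwa [sub_add_sub_cancel] at this
  obtain ⟨m, hm0, hm, hmc⟩ := smul_sub_mem_natCone hR hB hβR hφ.1 hβd hφd
  obtain ⟨m', hm'0, hm', hmc'⟩ := smul_sub_mem_natCone hR hB hφ.1 hβR hφd hβd
  by_cases h1 : m = 1
  · subst h1; simpa using hmc
  by_cases h2 : m' = 1
  · subst h2
    rw [one_smul] at hmc'
    rw [hφ.2 β hβR hmc', sub_self]; exact zero_mem _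
  have h4 : (4 : ℝ) ≤ inner ℝ (coroot φ) β * inner ℝ (coroot β) φ := by
    rw [hm, hm']
    have h3 : 2 * 2 ≤ m * m' := Nat.mul_le_mul (by omega) (by omega)
    exact_mod_cast h3
  rcases hR.eq_or_eq_neg_of_four_le hφ.1 hβR h4 with h | h
  · rw [h, sub_self]; exact zero_mem _
  · have := inner_pos_of_isDominant hR hB hφ.1 hβR hφd hβd
    rw [h, inner_neg_right, real_inner_self_eq_norm_sq] at this
    nlinarith [norm_nonneg φ]

/-- The multiple of the highest short root `θ` by the ratio `|α|² / |θ|²`, which is an integer,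
dominates the root `α`. -/
theorem highestShort_sub_mem (hR : IsIrreducibleRootSystem R₀) (hB : IsRootBasis R₀ Δ₀) {θ α : Z}
    (hθ : IsMaximalRoot Δ₀ (shortRoots R₀) θ) (hα : α ∈ R₀) :
    ∃ k : ℕ, ‖α‖ ^ 2 = k * ‖θ‖ ^ 2 ∧ k • θ - α ∈ natCone Δ₀ := by
  have hθR := hθ.1.1
  have hθd : IsDominant Δ₀ θ := by
    refine isDominant_of_isMaximalRoot hR hB (fun _ h => h.1) ?_ hθ
    rintro i β ⟨hβ, hs⟩ -
    exact ⟨hR.reflection_mem _ (hB.mem i) _ hβ, fun γ hγ => by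
      rw [LinearIsometryEquiv.norm_map]; exact hs γ hγ⟩
  obtain ⟨β, hβR, hβn, hβα, hβd⟩ := exists_isDominant_ge hR hB hα
  suffices h : ∃ k : ℕ, ‖β‖ ^ 2 = k * ‖θ‖ ^ 2 ∧ k • θ - β ∈ natCone Δ₀ by
    obtain ⟨k, hk, hc⟩ := h
    refine ⟨k, hβn ▸ hk, ?_⟩
    have := add_mem hc hβα
    rwa [sub_add_sub_cancel] at this
  obtain ⟨m, hm0, hm, hmc⟩ := smul_sub_mem_natCone hR hB hβR hθR hβd hθd
  obtain ⟨m', hm'0, hm', hmc'⟩ := smul_sub_mem_natCone hR hB hθR hβR hθd hβd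
  have hrel : (m : ℝ) * ‖θ‖ ^ 2 = m' * ‖β‖ ^ 2 := by
    rw [← hm, ← hm', inner_coroot_mul _ _ (hR.ne_zero hθR), inner_coroot_mul _ _ (hR.ne_zero hβR),
      real_inner_comm]
  by_cases h1 : m' = 1
  · subst h1
    exact ⟨m, by rw [hrel]; simp, hmc⟩
  have hle : m' ≤ m := by
    have h2 : ‖θ‖ ^ 2 ≤ ‖β‖ ^ 2 := pow_le_pow_left₀ (norm_nonneg _) (hθ.1.2 β hβR) 2
    have h3 : 0 < ‖θ‖ ^ 2 := by have := norm_pos_iff.mpr (hR.ne_zero hθR); positivity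
    have h4 : (m' : ℝ) * ‖θ‖ ^ 2 ≤ m * ‖θ‖ ^ 2 := by
      rw [hrel]; exact mul_le_mul_of_nonneg_left h2 (by positivity)
    exact_mod_cast le_of_mul_le_mul_right h4 h3
  have h4 : (4 : ℝ) ≤ inner ℝ (coroot θ) β * inner ℝ (coroot β) θ := by
    rw [hm, hm']
    have h3 : 2 * 2 ≤ m * m' := Nat.mul_le_mul (by omega) (by omega)
    exact_mod_cast h3
  rcases hR.eq_or_eq_neg_of_four_le hθR hβR h4 with h | h
  · exact ⟨1, by rw [h]; simp, by rw [h, one_smul, sub_self]; exact zero_mem _⟩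
  · have := inner_pos_of_isDominant hR hB hθR hβR hθd hβd
    rw [h, inner_neg_right, real_inner_self_eq_norm_sq] at this
    nlinarith [norm_nonneg θ]

end IsRootBasis

end Finite

/-! ### The action on affine linear functions -/

section Affine

variable {Z : Type*} [NormedAddCommGroup Z] [InnerProductSpace ℝ Z]

theorem affAct_one (a : ℝ × Z) : affAct 1 a = a := by
  have h : (1 : Z ≃ᵃⁱ[ℝ] Z) 0 = 0 := rfl
  have h' : (1 : Z ≃ᵃⁱ[ℝ] Z).linearIsometryEquiv a.2 = a.2 := rfl
  simp [affAct, h, h']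

theorem affAct_mul (g h : Z ≃ᵃⁱ[ℝ] Z) (a : ℝ × Z) :
    affAct (g * h) a = affAct g (affAct h a) := by
  have h1 : (g * h) 0 = g.linearIsometryEquiv (h 0) + g 0 := affineIsometry_apply g (h 0)
  have h2 : ∀ z, (g * h).linearIsometryEquiv z =
    g.linearIsometryEquiv (h.linearIsometryEquiv z) := fun z => rfl
  simp only [affAct, h1, h2, inner_add_right, LinearIsometryEquiv.inner_map_map, Prod.mk.injEq,
    and_true]
  ring

theorem affAct_add (g : Z ≃ᵃⁱ[ℝ] Z) (a b : ℝ × Z) :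
    affAct g (a + b) = affAct g a + affAct g b := by
  simp only [affAct, Prod.snd_add, Prod.fst_add, map_add, inner_add_left, Prod.mk_add_mk]
  congr 1; ring

theorem affAct_smul (g : Z ≃ᵃⁱ[ℝ] Z) (r : ℝ) (a : ℝ × Z) :
    affAct g (r • a) = r • affAct g a := by
  simp only [affAct, Prod.smul_snd, Prod.smul_fst, map_smul, inner_smul_left, Prod.smul_mk,
    smul_eq_mul, conj_trivial]
  congr 1; ring

/-- The action of an affine isometry on affine linear functions, as a linear map. -/
def affActₗ (g : Z ≃ᵃⁱ[ℝ] Z) : (ℝ × Z) →ₗ[ℝ] (ℝ × Z) where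
  toFun := affAct g
  map_add' := affAct_add g
  map_smul' := affAct_smul g

theorem affAct_neg (g : Z ≃ᵃⁱ[ℝ] Z) (a : ℝ × Z) : affAct g (-a) = -affAct g a :=
  map_neg (affActₗ g) a

theorem affAct_const (g : Z ≃ᵃⁱ[ℝ] Z) (r : ℝ) : affAct g (r, 0) = (r, 0) := by
  simp [affAct]

theorem affAct_inv_self (g : Z ≃ᵃⁱ[ℝ] Z) (a : ℝ × Z) : affAct g⁻¹ (affAct g a) = a := by
  rw [← affAct_mul, inv_mul_cancel, affAct_one]

theorem affRefl_linear (a : ℝ × Z) (z : Z) :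
    (affRefl a).linearIsometryEquiv z = z - inner ℝ (coroot a.2) z • a.2 :=
  linRefl_apply a.2 z

theorem affAct_affRefl (a b : ℝ × Z) :
    affAct (affRefl a) b = b - inner ℝ (coroot a.2) b.2 • a := by
  have h0 : affRefl a 0 = -(a.1 • coroot a.2) := by
    rw [affRefl_apply]; simp [affEval]
  have h1 : inner ℝ (b.2 - inner ℝ (coroot a.2) b.2 • a.2) (coroot a.2) =
      -inner ℝ (coroot a.2) b.2 := by
    by_cases ha : a.2 = 0
    · simp [ha, coroot]
    · rw [inner_sub_left, inner_smul_left, real_inner_comm (coroot a.2) a.2, inner_coroot_self ha,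
        real_inner_comm]
      simp only [conj_trivial]; ring
  simp only [affAct, affRefl_linear, h0, inner_neg_right, inner_smul_right, h1]
  ext
  · simp; ring
  · simp

/-- An affine isometry is determined by its action on affine linear functions. -/
theorem affineIsometry_ext_of_affAct {g h : Z ≃ᵃⁱ[ℝ] Z} (H : ∀ a, affAct g a = affAct h a) :
    g = h := by
  have key : ∀ z, g⁻¹ z = h⁻¹ z := by
    intro z
    refine ext_inner_left ℝ fun v => ?_
    have h1 := congrArg (fun a => affEval a z) (H (0, v))
    simp only [affEval_affAct] at h1
    simpa only [affEval, zero_add] using h1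
  exact inv_injective (AffineIsometryEquiv.ext key)

theorem coroot_map (g : Z ≃ₗᵢ[ℝ] Z) (v : Z) : coroot (g v) = g (coroot v) := by
  simp [coroot]

theorem affRefl_affAct (g : Z ≃ᵃⁱ[ℝ] Z) (a : ℝ × Z) :
    affRefl (affAct g a) = g * affRefl a * g⁻¹ := by
  ext z
  have h1 : (g * affRefl a * g⁻¹) z = g (affRefl a (g⁻¹ z)) := rfl
  have h2 : g (g⁻¹ z) = z := g.apply_symm_apply z
  rw [h1, affRefl_apply, affRefl_apply, affEval_affAct, affineIsometry_apply g (_ - _), map_sub,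
    map_smul, ← coroot_map, sub_add_eq_add_sub, ← affineIsometry_apply, h2]
  rfl

end Affine

/-! ### The affine root system -/

namespace InitialData

variable {Z : Type*} [NormedAddCommGroup Z] [InnerProductSpace ℝ Z] {n : ℕ} (D : InitialData Z n)

theorem mu_pos {α : Z} (hα : α ∈ D.R₀) : 0 < D.kind.mu α := by
  have h := D.mu_ne_zero hα
  cases hk : D.kind with
  | u => simp [TwistKind.mu]
  | t =>
    rw [hk] at h
    exact lt_of_le_of_ne (by simp only [TwistKind.mu]; positivity) h.symm

theorem mu_map (g : Z ≃ₗᵢ[ℝ] Z) (α : Z) : D.kind.mu (g α) = D.kind.mu α := by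
  cases D.kind <;> simp [TwistKind.mu]

theorem mu_neg (α : Z) : D.kind.mu (-α) = D.kind.mu α := by
  cases D.kind <;> simp [TwistKind.mu]

/-- The gradient of `a₀` is minus a root `ψ`, a natural multiple of which dominates any given
root `α`, the multiple being the ratio of `μ_α` and `μ_ψ`. -/
theorem exists_a₀ : ∃ ψ ∈ D.R₀, D.a₀ = (D.kind.mu ψ, -ψ) ∧
    ∀ α ∈ D.R₀, ∃ k : ℕ, D.kind.mu α = k * D.kind.mu ψ ∧ k • ψ - α ∈ natCone D.Δ₀ := by
  cases hk : D.kind with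
  | u =>
    have hφ := D.exists_highestRoot.choose_spec
    refine ⟨D.highestRoot, hφ.1, by simp [a₀, hk, TwistKind.mu], fun α hα => ⟨1, ?_, ?_⟩⟩
    · simp [TwistKind.mu]
    · rw [one_smul]; exact D.isBasis.highest_sub_mem D.isRootSystem hφ hα
  | t =>
    have hθ := D.exists_highestShortRoot.choose_spec
    refine ⟨D.highestShortRoot, hθ.1.1, by simp [a₀, hk, TwistKind.mu], fun α hα => ?_⟩
    obtain ⟨k, hk, hc⟩ := D.isBasis.highestShort_sub_mem D.isRootSystem hθ hα
    refine ⟨k, ?_, hc⟩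
    simp only [TwistKind.mu, hk, highestShortRoot]; ring

theorem Δ_zero : D.Δ 0 = D.a₀ := rfl

theorem Δ_succ (i : Fin n) : D.Δ i.succ = (0, D.Δ₀ i) := rfl

theorem a₀_fst_pos : 0 < D.a₀.1 := by
  obtain ⟨ψ, hψ, h, -⟩ := D.exists_a₀
  rw [h]; exact D.mu_pos hψ

theorem Δ_fst_nonneg (i : Fin (n + 1)) : 0 ≤ (D.Δ i).1 := by
  refine Fin.cases ?_ (fun j => ?_) i
  · exact D.a₀_fst_pos.le
  · simp [Δ_succ]

theorem fst_nonneg_of_mem_natCone {a : ℝ × Z} (h : a ∈ natCone D.Δ) : 0 ≤ a.1 := by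
  obtain ⟨m, rfl⟩ := h
  rw [Prod.fst_sum]
  exact Finset.sum_nonneg fun i _ => by
    rw [Prod.smul_fst]; exact nsmul_nonneg (D.Δ_fst_nonneg i) _

theorem linearIndependent_Δ : LinearIndependent ℝ D.Δ := by
  have h1 : LinearIndependent ℝ (fun i => ((0 : ℝ), D.Δ₀ i)) :=
    D.isBasis.linearIndependent.map' (LinearMap.inr ℝ ℝ Z) (LinearMap.ker_eq_bot.mpr
      LinearMap.inr_injective)
  refine linearIndependent_finCons.mpr ⟨h1, fun h2 => ?_⟩
  have h3 : Submodule.span ℝ (Set.range fun i => ((0 : ℝ), D.Δ₀ i)) ≤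
      LinearMap.ker (LinearMap.fst ℝ ℝ Z) := by
    rw [Submodule.span_le]
    rintro _ ⟨i, rfl⟩
    simp
  have h4 := h3 h2
  rw [LinearMap.mem_ker, LinearMap.fst_apply] at h4
  exact D.a₀_fst_pos.ne' h4

theorem mk_zero_mem_natCone {v : Z} (h : v ∈ natCone D.Δ₀) : ((0 : ℝ), v) ∈ natCone D.Δ := by
  obtain ⟨m, rfl⟩ := h
  have h1 : ((0 : ℝ), ∑ i, m i • D.Δ₀ i) = ∑ i : Fin n, m i • D.Δ i.succ := by
    simp only [Δ_succ, Prod.smul_mk, smul_zero]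
    ext
    · simp [Prod.fst_sum]
    · simp [Prod.snd_sum]
  rw [h1]
  exact sum_mem fun i _ => nsmul_mem (self_mem_natCone _ _) _

theorem mem_RredPos {a : ℝ × Z} : a ∈ D.RredPos ↔ a ∈ D.Rred ∧ a ∈ natCone D.Δ := Iff.rfl

theorem mem_RredNeg {a : ℝ × Z} : a ∈ D.RredNeg ↔ -a ∈ D.RredPos := Iff.rfl

theorem snd_mem_R₀ {a : ℝ × Z} (h : a ∈ D.Rred) : a.2 ∈ D.R₀ := by
  obtain ⟨m, α, hα, rfl⟩ := h; exact hα

theorem snd_ne_zero {a : ℝ × Z} (h : a ∈ D.Rred) : a.2 ≠ 0 :=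
  D.isRootSystem.ne_zero (D.snd_mem_R₀ h)

theorem neg_mem_Rred {a : ℝ × Z} (h : a ∈ D.Rred) : -a ∈ D.Rred := by
  obtain ⟨m, α, hα, rfl⟩ := h
  exact ⟨-m, -α, D.neg_mem hα, by rw [mu_neg]; simp⟩

/-- Every affine root is positive or negative: for `m ≥ 1` the root `m μ_α c + α` is
`m k a₀ + (m - 1) k ψ + (k ψ + α)`, where `μ_α = k μ_ψ`. -/
theorem mem_RredPos_or_RredNeg {a : ℝ × Z} (h : a ∈ D.Rred) : a ∈ D.RredPos ∨ a ∈ D.RredNeg := by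
  obtain ⟨ψ, hψ, ha₀, hdom⟩ := D.exists_a₀
  have hψc : ψ ∈ natCone D.Δ₀ := by
    refine (D.isBasis.mem_or_neg_mem hψ).resolve_right fun hneg => ?_
    obtain ⟨k, -, hc⟩ := hdom _ (D.neg_mem hψ)
    have h1 : (k + 1) • ψ ∈ natCone D.Δ₀ := by
      rw [add_smul, one_smul]; simpa using hc
    have h2 : -((k + 1) • ψ) ∈ natCone D.Δ₀ := by
      rw [← smul_neg]; exact nsmul_mem hneg _
    have h3 := eq_zero_of_mem_natCone_of_neg_mem D.isBasis.linearIndependent h1 h2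
    rw [← Nat.cast_smul_eq_nsmul ℝ, smul_eq_zero] at h3
    exact h3.elim (by positivity) (D.isRootSystem.ne_zero hψ)
  have key : ∀ m : ℕ, ∀ α ∈ D.R₀,
      (((m + 1 : ℕ) : ℝ) * D.kind.mu α, α) ∈ natCone D.Δ := by
    intro m α hα
    obtain ⟨k, hk, hc⟩ := hdom _ (D.neg_mem hα)
    rw [mu_neg] at hk
    have h1 : (m * k) • ψ + (k • ψ - -α) ∈ natCone D.Δ₀ := add_mem (nsmul_mem hψc _) hc
    have h2 : ((m + 1) * k) • D.Δ 0 + ((0 : ℝ), (m * k) • ψ + (k • ψ - -α)) ∈ natCone D.Δ :=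
      add_mem (nsmul_mem (self_mem_natCone _ _) _) (D.mk_zero_mem_natCone h1)
    convert h2 using 1
    rw [Δ_zero, ha₀, hk]
    simp only [← Nat.cast_smul_eq_nsmul ℝ]
    ext
    · simp; ring
    · simp only [Prod.snd_add, Prod.smul_snd]
      push_cast; module
  have key' : ∀ m : ℕ, ∀ α ∈ D.R₀, ((m : ℝ) * D.kind.mu α, α) ∈ natCone D.Δ ∨
      -((m : ℝ) * D.kind.mu α, α) ∈ natCone D.Δ := by
    intro m α hα
    rcases m with _ | m
    · rcases D.isBasis.mem_or_neg_mem hα with h1 | h1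
      · left; simpa using D.mk_zero_mem_natCone h1
      · right; simpa using D.mk_zero_mem_natCone h1
    · exact Or.inl (key m α hα)
  have hmain : a ∈ natCone D.Δ ∨ -a ∈ natCone D.Δ := by
    obtain ⟨m, α, hα, rfl⟩ := h
    obtain ⟨N, rfl | rfl⟩ := m.eq_nat_or_neg
    · simpa using key' N α hα
    · have h1 := key' N (-α) (D.neg_mem hα)
      have h2 : -((N : ℝ) * D.kind.mu (-α), -α) = (((-(N : ℤ) : ℤ) : ℝ) * D.kind.mu α, α) := by
        rw [mu_neg]; simp
      rw [h2] at h1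
      rw [← h2, neg_neg]
      rw [← h2] at h1
      rw [or_comm]
      exact h1
  rcases hmain with h1 | h1
  · exact Or.inl ⟨h, h1⟩
  · exact Or.inr ⟨D.neg_mem_Rred h, h1⟩

theorem Δ_mem_RredPos (i : Fin (n + 1)) : D.Δ i ∈ D.RredPos :=
  ⟨D.Δ_mem_Rred i, self_mem_natCone _ i⟩

theorem notMem_RredNeg_of_mem_RredPos {a : ℝ × Z} (h : a ∈ D.RredPos) : a ∉ D.RredNeg := by
  intro h'
  have h1 := eq_zero_of_mem_natCone_of_neg_mem D.linearIndependent_Δ h.2 h'.2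
  exact D.snd_ne_zero h.1 (by rw [h1]; rfl)

/-- The lattice `Λ^d` pairs with a root `α` in `μ_α ℤ`. -/
theorem exists_inner_Λd {α ξ : Z} (hα : α ∈ D.R₀) (hξ : ξ ∈ D.Λd) :
    ∃ m : ℤ, inner ℝ α ξ = m * D.kind.mu α := by
  obtain ⟨m, hm⟩ := D.Λd_integral ξ hξ α hα
  refine ⟨m, ?_⟩
  have hμ := D.mu_ne_zero hα
  have h0 : ‖α‖ ≠ 0 := norm_ne_zero_iff.mpr (D.isRootSystem.ne_zero hα)
  rw [← hm]
  simp only [TwistKind.dual, coroot, inner_smul_right, smul_smul, norm_smul, mul_pow,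
    Real.norm_eq_abs, sq_abs, real_inner_comm α ξ]
  field_simp

theorem W₀_mem_R₀ {w : Z ≃ₗᵢ[ℝ] Z} (hw : w ∈ D.W₀) : ∀ α ∈ D.R₀, w α ∈ D.R₀ := by
  refine Subgroup.closure_induction'' (p := fun w _ => ∀ α ∈ D.R₀, w α ∈ D.R₀) ?_ ?_ ?_ ?_ hw
  · rintro _ ⟨α, hα, rfl⟩; exact D.isRootSystem.reflection_mem α hα
  · rintro _ ⟨α, hα, rfl⟩
    have : (linRefl α)⁻¹ = linRefl α := Submodule.reflection_inv
    rw [this]; exact D.isRootSystem.reflection_mem α hα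
  · intro v hv; exact hv
  · intro x y _ _ hx hy v hv; exact hx _ (hy v hv)

/-- The action of the extended affine Weyl group on affine linear functions. -/
def act (w : D.W) (a : ℝ × Z) : ℝ × Z := affAct (w : Z ≃ᵃⁱ[ℝ] Z) a

theorem act_mul (v w : D.W) (a : ℝ × Z) : D.act (v * w) a = D.act v (D.act w a) :=
  affAct_mul _ _ a

theorem act_one (a : ℝ × Z) : D.act 1 a = a := affAct_one a

theorem act_add (w : D.W) (a b : ℝ × Z) : D.act w (a + b) = D.act w a + D.act w b :=
  affAct_add _ a b

theorem act_smul (w : D.W) (r : ℝ) (a : ℝ × Z) : D.act w (r • a) = r • D.act w a :=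
  affAct_smul _ r a

theorem act_neg (w : D.W) (a : ℝ × Z) : D.act w (-a) = -D.act w a := affAct_neg _ a

theorem act_inv_act (w : D.W) (a : ℝ × Z) : D.act w⁻¹ (D.act w a) = a := by
  rw [← act_mul, inv_mul_cancel, act_one]

theorem act_act_inv (w : D.W) (a : ℝ × Z) : D.act w (D.act w⁻¹ a) = a := by
  rw [← act_mul, mul_inv_cancel, act_one]

theorem act_mem_Rred (w : D.W) {a : ℝ × Z} (h : a ∈ D.Rred) : D.act w a ∈ D.Rred := by
  obtain ⟨m, α, hα, rfl⟩ := h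
  have hwα := D.W₀_mem_R₀ w.2.1 α hα
  obtain ⟨k, hk⟩ := D.exists_inner_Λd hwα w.2.2
  refine ⟨m - k, _, hwα, ?_⟩
  simp only [act, affAct, hk]
  rw [mu_map]; push_cast; congr 1; ring

theorem act_mem_RredNeg_iff (w : D.W) {a : ℝ × Z} :
    D.act w a ∈ D.RredNeg ↔ D.act w (-a) ∈ D.RredPos := by
  rw [mem_RredNeg, act_neg]

theorem act_s (i : Fin (n + 1)) (b : ℝ × Z) :
    D.act (D.s i) b = b - inner ℝ (coroot (D.Δ i).2) b.2 • D.Δ i :=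
  affAct_affRefl (D.Δ i) b

theorem act_s_self (i : Fin (n + 1)) : D.act (D.s i) (D.Δ i) = -D.Δ i := by
  rw [act_s, inner_coroot_self (D.snd_ne_zero (D.Δ_mem_Rred i)), two_smul]; abel

theorem s_mul_s (i : Fin (n + 1)) : D.s i * D.s i = 1 := by
  refine Subtype.ext (affineIsometry_ext_of_affAct fun a => ?_)
  change D.act (D.s i * D.s i) a = D.act 1 a
  have h := inner_coroot_self (D.snd_ne_zero (D.Δ_mem_Rred i))
  rw [act_mul, act_one, act_s, act_s]
  simp only [Prod.snd_sub, Prod.smul_snd, inner_sub_right, inner_smul_right, h]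
  module

theorem s_inv (i : Fin (n + 1)) : (D.s i)⁻¹ = D.s i :=
  inv_eq_of_mul_eq_one_left (D.s_mul_s i)

theorem s_mul_cancel_left (i : Fin (n + 1)) (w : D.W) : D.s i * (D.s i * w) = w := by
  rw [← mul_assoc, s_mul_s, one_mul]

/-! ### The length function -/

/-- A simple reflection permutes the positive roots other than the simple root itself. -/
theorem act_s_mem_RredPos (i : Fin (n + 1)) {a : ℝ × Z} (h : a ∈ D.RredPos) (hne : a ≠ D.Δ i) :
    D.act (D.s i) a ∈ D.RredPos := by
  have li := D.linearIndependent_Δ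
  refine (D.mem_RredPos_or_RredNeg (D.act_mem_Rred _ h.1)).resolve_right fun hneg => hne ?_
  obtain ⟨m, hm⟩ := h.2
  have hzero : ∀ j, j ≠ i → m j = 0 := by
    intro j hj
    have h1 := coord_nonneg li hneg.2 j
    rw [act_s, map_neg, map_sub, map_smul, coord_of_ne li hj.symm, smul_zero, sub_zero, hm,
      coord_sum] at h1
    have : (m j : ℝ) ≤ 0 := by linarith
    exact_mod_cast le_antisymm this (Nat.cast_nonneg _)
  have ha : a = (m i : ℝ) • D.Δ i := by
    rw [hm, Finset.sum_eq_single i (fun j _ hj => by rw [hzero j hj, zero_smul]) (by simp),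
      Nat.cast_smul_eq_nsmul]
  have h2 : (m i : ℝ) • (D.Δ i).2 ∈ D.R₀ := by
    have := D.snd_mem_R₀ h.1
    rwa [ha] at this
  rcases D.isRootSystem.reduced _ (D.snd_mem_R₀ (D.Δ_mem_Rred i)) _ h2 with h3 | h3
  · rw [ha, h3, one_smul]
  · have : (0 : ℝ) ≤ m i := Nat.cast_nonneg _
    linarith

theorem act_s_mem_RredNeg (i : Fin (n + 1)) {a : ℝ × Z} (h : a ∈ D.RredNeg) (hne : a ≠ -D.Δ i) :
    D.act (D.s i) a ∈ D.RredNeg := by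
  rw [act_mem_RredNeg_iff]
  exact D.act_s_mem_RredPos i h fun h1 => hne (by rw [← h1, neg_neg])

/-- The positive roots that `w` makes negative. -/
def inversions (w : D.W) : Set (ℝ × Z) := {a ∈ D.RredPos | D.act w a ∈ D.RredNeg}

theorem length_eq (w : D.W) : D.length w = (D.inversions w).ncard := rfl

theorem finite_inversions (w : D.W) : (D.inversions w).Finite := by
  let B : Z → ℤ := fun α =>
    ⌈inner ℝ ((w : Z ≃ᵃⁱ[ℝ] Z).linearIsometryEquiv α) ((w : Z ≃ᵃⁱ[ℝ] Z) 0) / D.kind.mu α⌉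
  let S : Z → Set (ℝ × Z) := fun α =>
    (fun m : ℤ => ((m : ℝ) * D.kind.mu α, α)) '' Set.Icc 0 (B α)
  refine (D.isRootSystem.finite.biUnion (t := S) fun α _ =>
    (Set.finite_Icc 0 (B α)).image _).subset ?_
  rintro a ⟨hpos, hneg⟩
  obtain ⟨m, α, hα, rfl⟩ := hpos.1
  refine Set.mem_biUnion hα ⟨m, ⟨?_, ?_⟩, rfl⟩
  · have h1 := D.fst_nonneg_of_mem_natCone hpos.2
    have h2 : (0 : ℝ) ≤ m := nonneg_of_mul_nonneg_left h1 (D.mu_pos hα)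
    exact_mod_cast h2
  · have h1 := D.fst_nonneg_of_mem_natCone hneg.2
    simp only [act, affAct, Prod.fst_neg] at h1
    have h2 : (m : ℝ) ≤ B α := by
      refine le_trans ?_ (Int.le_ceil _)
      rw [le_div_iff₀ (D.mu_pos hα)]
      linarith
    exact_mod_cast h2

theorem length_s_mul_of_pos {i : Fin (n + 1)} {w : D.W} (h : D.act w⁻¹ (D.Δ i) ∈ D.RredPos) :
    D.length (D.s i * w) = D.length w + 1 := by
  have hnot : D.act w⁻¹ (D.Δ i) ∉ D.inversions w := by
    rintro ⟨-, h2⟩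
    rw [act_act_inv] at h2
    exact D.notMem_RredNeg_of_mem_RredPos (D.Δ_mem_RredPos i) h2
  rw [length_eq, length_eq, ← Set.ncard_insert_of_notMem hnot (D.finite_inversions w)]
  congr 1
  ext a
  constructor
  · rintro ⟨h1, h2⟩
    by_cases ha : a = D.act w⁻¹ (D.Δ i)
    · exact Or.inl ha
    · refine Or.inr ⟨h1, ?_⟩
      rw [act_mul] at h2
      refine (D.mem_RredPos_or_RredNeg (D.act_mem_Rred w h1.1)).resolve_left fun h3 => ?_
      refine D.notMem_RredNeg_of_mem_RredPos (D.act_s_mem_RredPos i h3 fun h4 => ha ?_) h2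
      rw [← h4, act_inv_act]
  · rintro (rfl | ⟨h1, h2⟩)
    · refine ⟨h, ?_⟩
      rw [act_mul, act_act_inv, act_s_self, mem_RredNeg, neg_neg]
      exact D.Δ_mem_RredPos i
    · refine ⟨h1, ?_⟩
      rw [act_mul]
      refine D.act_s_mem_RredNeg i h2 fun h3 => ?_
      have h4 : a = -D.act w⁻¹ (D.Δ i) := by rw [← act_neg, ← h3, act_inv_act]
      refine D.notMem_RredNeg_of_mem_RredPos h1 ?_
      rw [mem_RredNeg, h4, neg_neg]; exact h

theorem length_s_mul_of_neg {i : Fin (n + 1)} {w : D.W} (h : D.act w⁻¹ (D.Δ i) ∈ D.RredNeg) :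
    D.length w = D.length (D.s i * w) + 1 := by
  have h1 : D.act (D.s i * w)⁻¹ (D.Δ i) ∈ D.RredPos := by
    rw [mul_inv_rev, s_inv, act_mul, act_s_self, act_neg]; exact h
  have := D.length_s_mul_of_pos h1
  rwa [s_mul_cancel_left] at this

theorem act_inv_Δ_mem (i : Fin (n + 1)) (w : D.W) :
    D.act w⁻¹ (D.Δ i) ∈ D.RredPos ∨ D.act w⁻¹ (D.Δ i) ∈ D.RredNeg :=
  D.mem_RredPos_or_RredNeg (D.act_mem_Rred _ (D.Δ_mem_Rred i))

theorem act_inv_mem_RredNeg_of_length {i : Fin (n + 1)} {w : D.W}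
    (h : D.length w = D.length (D.s i * w) + 1) : D.act w⁻¹ (D.Δ i) ∈ D.RredNeg := by
  refine (D.act_inv_Δ_mem i w).resolve_left fun h1 => ?_
  have := D.length_s_mul_of_pos h1
  omega

theorem length_s_mul_le (i : Fin (n + 1)) (w : D.W) : D.length (D.s i * w) ≤ D.length w + 1 := by
  rcases D.act_inv_Δ_mem i w with h | h
  · exact (D.length_s_mul_of_pos h).le
  · have := D.length_s_mul_of_neg h; omega

theorem length_eq_zero_iff {w : D.W} :
    D.length w = 0 ↔ ∀ a ∈ D.RredPos, D.act w a ∈ D.RredPos := by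
  rw [length_eq, Set.ncard_eq_zero (D.finite_inversions w)]
  constructor
  · intro h a ha
    refine (D.mem_RredPos_or_RredNeg (D.act_mem_Rred w ha.1)).resolve_right fun h1 => ?_
    have : a ∈ D.inversions w := ⟨ha, h1⟩
    rw [h] at this; exact this
  · intro h
    refine Set.eq_empty_of_forall_notMem fun a ha => ?_
    exact D.notMem_RredNeg_of_mem_RredPos (h a ha.1) ha.2

theorem length_one : D.length 1 = 0 :=
  D.length_eq_zero_iff.mpr fun a ha => by rwa [act_one]

theorem length_inv_of_length_eq_zero {ω : D.W} (h : D.length ω = 0) : D.length ω⁻¹ = 0 := by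
  rw [length_eq_zero_iff] at h ⊢
  intro a ha
  refine (D.mem_RredPos_or_RredNeg (D.act_mem_Rred _ ha.1)).resolve_right fun h1 => ?_
  have h2 := h _ h1
  rw [act_neg, act_act_inv] at h2
  exact D.notMem_RredNeg_of_mem_RredPos ha h2

theorem length_s (i : Fin (n + 1)) : D.length (D.s i) = 1 := by
  have h := D.length_s_mul_of_pos (i := i) (w := 1) (by
    rw [inv_one, act_one]; exact D.Δ_mem_RredPos i)
  rwa [mul_one, length_one] at h

theorem length_omega_mul {ω : D.W} (h : D.length ω = 0) (w : D.W) :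
    D.length (ω * w) = D.length w := by
  have h' := D.length_inv_of_length_eq_zero h
  rw [length_eq_zero_iff] at h h'
  rw [length_eq, length_eq]
  congr 1
  ext a
  refine and_congr_right fun ha => ?_
  rw [act_mul, mem_RredNeg, mem_RredNeg, ← act_neg]
  exact ⟨fun h1 => by simpa [act_inv_act] using h' _ h1, fun h1 => h _ h1⟩

theorem exists_descent {w : D.W} (h : D.length w ≠ 0) :
    ∃ i, D.act w⁻¹ (D.Δ i) ∈ D.RredNeg := by
  by_contra! hcon
  have hpos : ∀ i, D.act w⁻¹ (D.Δ i) ∈ D.RredPos := fun i =>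
    (D.act_inv_Δ_mem i w).resolve_right (hcon i)
  have h1 : D.length w⁻¹ = 0 := by
    rw [length_eq_zero_iff]
    rintro a ⟨ha, m, hm⟩
    refine ⟨D.act_mem_Rred _ ha, ?_⟩
    rw [hm]
    have : D.act w⁻¹ (∑ i, m i • D.Δ i) = ∑ i, m i • D.act w⁻¹ (D.Δ i) := by
      change affActₗ _ _ = _
      simp only [map_sum, map_nsmul]
      rfl
    rw [this]
    exact sum_mem fun i _ => nsmul_mem (D.mem_RredPos.mp (hpos i)).2 _
  have h2 := D.length_inv_of_length_eq_zero h1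
  rw [inv_inv] at h2
  exact h h2

/-- An element of length zero permutes the simple affine roots, because these are the
indecomposable positive roots. -/
theorem exists_act_omega_eq {ω : D.W} (h : D.length ω = 0) (i : Fin (n + 1)) :
    ∃ j, D.act ω (D.Δ i) = D.Δ j := by
  have li := D.linearIndependent_Δ
  have h' := D.length_inv_of_length_eq_zero h
  rw [length_eq_zero_iff] at h h'
  obtain ⟨hR, m, hm⟩ := h _ (D.Δ_mem_RredPos i)
  -- the preimages of the simple roots occurring in `ω aᵢ` are multiples of `aᵢ`
  have hsum : D.Δ i = ∑ j, m j • D.act ω⁻¹ (D.Δ j) := by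
    have h1 : D.act ω⁻¹ (D.act ω (D.Δ i)) = ∑ j, m j • D.act ω⁻¹ (D.Δ j) := by
      rw [hm]
      change affActₗ _ _ = _
      simp only [map_sum, map_nsmul]
      rfl
    rwa [act_inv_act] at h1
  have hex : ∃ j, m j ≠ 0 := by
    by_contra! hcon
    refine D.snd_ne_zero hR ?_
    rw [hm]; simp [hcon]
  obtain ⟨j, hj⟩ := hex
  refine ⟨j, ?_⟩
  have hβ := h' _ (D.Δ_mem_RredPos j)
  obtain ⟨c, hc⟩ := hβ.2
  have hc0 : ∀ k, k ≠ i → c k = 0 := by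
    intro k hk
    have h1 := congrArg (coord li k) hsum
    rw [coord_of_ne li hk.symm, map_sum] at h1
    have hnn : ∀ l ∈ Finset.univ, 0 ≤ coord li k (m l • D.act ω⁻¹ (D.Δ l)) := fun l _ =>
      coord_nonneg li (nsmul_mem (h' _ (D.Δ_mem_RredPos l)).2 _) k
    have h2 := (Finset.sum_eq_zero_iff_of_nonneg hnn).mp h1.symm j (Finset.mem_univ _)
    rw [map_nsmul, hc, coord_sum, nsmul_eq_mul, mul_eq_zero] at h2
    exact_mod_cast h2.resolve_left (by exact_mod_cast hj)
  have hβi : D.act ω⁻¹ (D.Δ j) = (c i : ℝ) • D.Δ i := by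
    rw [hc, Finset.sum_eq_single i (fun k _ hk => by rw [hc0 k hk, zero_smul]) (by simp),
      Nat.cast_smul_eq_nsmul]
  have h2 : (c i : ℝ) • (D.Δ i).2 ∈ D.R₀ := by
    have := D.snd_mem_R₀ hβ.1
    rwa [hβi] at this
  have h3 : (c i : ℝ) = 1 := by
    rcases D.isRootSystem.reduced _ (D.snd_mem_R₀ (D.Δ_mem_Rred i)) _ h2 with h3 | h3
    · exact h3
    · have : (0 : ℝ) ≤ c i := Nat.cast_nonneg _
      linarith
  rw [h3, one_smul] at hβi
  rw [← hβi, act_act_inv]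

theorem omega_mul_s {ω : D.W} {i j : Fin (n + 1)} (h : D.act ω (D.Δ i) = D.Δ j) :
    ω * D.s i = D.s j * ω := by
  have h1 : affRefl (D.Δ j) = (ω : Z ≃ᵃⁱ[ℝ] Z) * affRefl (D.Δ i) * (ω : Z ≃ᵃⁱ[ℝ] Z)⁻¹ := by
    rw [← affRefl_affAct, ← h]; rfl
  refine Subtype.ext ?_
  change (ω : Z ≃ᵃⁱ[ℝ] Z) * affRefl (D.Δ i) = affRefl (D.Δ j) * (ω : Z ≃ᵃⁱ[ℝ] Z)
  rw [h1, inv_mul_cancel_right]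

/-! ### Pairs of simple affine roots -/

theorem exists_cartan (i j : Fin (n + 1)) :
    ∃ m : ℤ, inner ℝ (coroot (D.Δ i).2) (D.Δ j).2 = m :=
  D.isRootSystem.crystallographic _ (D.snd_mem_R₀ (D.Δ_mem_Rred i)) _
    (D.snd_mem_R₀ (D.Δ_mem_Rred j))

/-- The Cartan integer `(aⱼ, aᵢ^∨)`. -/
def cartan (i j : Fin (n + 1)) : ℤ := (D.exists_cartan i j).choose

theorem inner_coroot_Δ (i j : Fin (n + 1)) :
    inner ℝ (coroot (D.Δ i).2) (D.Δ j).2 = D.cartan i j := (D.exists_cartan i j).choose_spec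

theorem act_s_Δ (i j : Fin (n + 1)) :
    D.act (D.s i) (D.Δ j) = D.Δ j - (D.cartan i j : ℝ) • D.Δ i := by
  rw [act_s, inner_coroot_Δ]

theorem cartan_nonpos {i j : Fin (n + 1)} (hij : i ≠ j) : D.cartan i j ≤ 0 := by
  have li := D.linearIndependent_Δ
  have h := D.act_s_mem_RredPos i (D.Δ_mem_RredPos j) fun h => hij (li.injective h).symm
  have h1 := coord_nonneg li h.2 i
  rw [act_s_Δ, map_sub, map_smul, coord_self, coord_of_ne li hij.symm, smul_eq_mul] at h1
  have : (D.cartan i j : ℝ) ≤ 0 := by linarith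
  exact_mod_cast this

theorem cartan_eq_zero_comm {i j : Fin (n + 1)} (h : D.cartan i j = 0) : D.cartan j i = 0 := by
  have h1 := D.inner_coroot_Δ i j
  have h2 := inner_coroot_mul (D.Δ i).2 (D.Δ j).2 (D.snd_ne_zero (D.Δ_mem_Rred i))
  rw [h1, h] at h2
  have h3 := D.inner_coroot_Δ j i
  rw [inner_coroot, real_inner_comm, show inner ℝ (D.Δ i).2 (D.Δ j).2 = 0 by
    push_cast at h2; linarith] at h3
  have : (D.cartan j i : ℝ) = 0 := by rw [← h3]; simp
  exact_mod_cast this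

/-- If `w⁻¹` makes two simple roots negative, then their Cartan integers are those of a finite root
system of rank two: otherwise the gradients of the two roots are opposite, so that the sum of the
two roots is a constant function, which `w⁻¹` fixes. -/
theorem cartan_mul_le {i j : Fin (n + 1)} (hij : i ≠ j) {w : D.W}
    (hi : D.act w⁻¹ (D.Δ i) ∈ D.RredNeg) (hj : D.act w⁻¹ (D.Δ j) ∈ D.RredNeg) :
    D.cartan i j * D.cartan j i ≤ 3 := by
  by_contra! hcon
  have li := D.linearIndependent_Δ
  have h4 : (4 : ℝ) ≤ inner ℝ (coroot (D.Δ i).2) (D.Δ j).2 *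
      inner ℝ (coroot (D.Δ j).2) (D.Δ i).2 := by
    rw [inner_coroot_Δ, inner_coroot_Δ]
    exact_mod_cast hcon
  have hi0 := D.snd_ne_zero (D.Δ_mem_Rred i)
  rcases D.isRootSystem.eq_or_eq_neg_of_four_le (D.snd_mem_R₀ (D.Δ_mem_Rred i))
    (D.snd_mem_R₀ (D.Δ_mem_Rred j)) h4 with h | h
  · have h1 := D.inner_coroot_Δ i j
    rw [h, inner_coroot_self hi0] at h1
    have h2 := D.cartan_nonpos hij
    have h3 : (2 : ℤ) = D.cartan i j := by exact_mod_cast h1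
    omega
  · have h1 : D.Δ i + D.Δ j = ((D.Δ i).1 + (D.Δ j).1, 0) := by
      ext
      · rfl
      · simp [h]
    have h2 : D.act w⁻¹ (D.Δ i + D.Δ j) = D.Δ i + D.Δ j := by
      rw [h1]; exact affAct_const _ _
    have h3 : -(D.Δ i + D.Δ j) ∈ natCone D.Δ := by
      rw [← h2, act_add, neg_add]
      exact add_mem hi.2 hj.2
    have h5 := coord_nonneg li h3 i
    rw [map_neg, map_add, coord_self, coord_of_ne li hij.symm] at h5
    linarith

/-- The pairs of Cartan integers of the finite root systems of rank two. -/
theorem cartan_cases {i j : Fin (n + 1)} (hij : i ≠ j) (h : D.cartan i j * D.cartan j i ≤ 3) :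
    (D.cartan i j = 0 ∧ D.cartan j i = 0) ∨ (D.cartan i j = -1 ∧ D.cartan j i = -1) ∨
    (D.cartan i j = -2 ∧ D.cartan j i = -1) ∨ (D.cartan i j = -1 ∧ D.cartan j i = -2) ∨
    (D.cartan i j = -3 ∧ D.cartan j i = -1) ∨ (D.cartan i j = -1 ∧ D.cartan j i = -3) := by
  have h1 := D.cartan_nonpos hij
  have h2 := D.cartan_nonpos hij.symm
  by_cases h0 : D.cartan i j = 0
  · exact Or.inl ⟨h0, D.cartan_eq_zero_comm h0⟩
  have h0' : D.cartan j i ≠ 0 := fun h => h0 (D.cartan_eq_zero_comm h)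
  have h3 : -3 ≤ D.cartan i j := by nlinarith [show D.cartan j i ≤ -1 by omega]
  have h4 : -3 ≤ D.cartan j i := by nlinarith [show D.cartan i j ≤ -1 by omega]
  generalize D.cartan i j = x at *
  generalize D.cartan j i = y at *
  interval_cases x <;> interval_cases y <;> simp_all

end InitialData

/-! ### Reduced products -/

namespace InitialData

variable {Z : Type*} [NormedAddCommGroup Z] [InnerProductSpace ℝ Z] {n : ℕ} (D : InitialData Z n)

/-- Induction along reduced expressions `s_{i₁} ⋯ s_{iₗ} ω`. -/
theorem reduced_induction {P : D.W → Prop} (h0 : ∀ ω, D.length ω = 0 → P ω)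
    (hs : ∀ i w, D.length (D.s i * w) = D.length w + 1 → P w → P (D.s i * w)) (w : D.W) : P w := by
  induction hN : D.length w generalizing w with
  | zero => exact h0 w hN
  | succ N ih =>
    obtain ⟨i, hi⟩ := D.exists_descent (w := w) (by omega)
    have h := D.length_s_mul_of_neg hi
    have h1 := hs i (D.s i * w) (by rw [s_mul_cancel_left]; exact h) (ih _ (by omega))
    rwa [s_mul_cancel_left] at h1

theorem length_mul_le (v w : D.W) : D.length (v * w) ≤ D.length v + D.length w := by
  refine D.reduced_induction (P := fun v => D.length (v * w) ≤ D.length v + D.length w) ?_ ?_ v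
  · intro ω hω; rw [D.length_omega_mul hω, hω, zero_add]
  · intro i v h ih
    have := D.length_s_mul_le i (v * w)
    rw [mul_assoc]; omega

/-- A family `T` indexed by the simple reflections and a family `Om` indexed by the elements of
length zero, subject to the relations of the extended affine braid group in their Coxeter form:
a braid relation for each pair of simple reflections that generates a finite group. -/
structure BraidFamily {M : Type*} [Monoid M] (T : Fin (n + 1) → M) (Om : D.W → M) : Prop where
  braid_two : ∀ i j, i ≠ j → D.cartan i j = 0 → D.cartan j i = 0 → T i * T j = T j * T i
  braid_three : ∀ i j, i ≠ j → D.cartan i j = -1 → D.cartan j i = -1 →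
    T i * (T j * T i) = T j * (T i * T j)
  braid_four : ∀ i j, i ≠ j → D.cartan i j = -2 → D.cartan j i = -1 →
    T i * (T j * (T i * T j)) = T j * (T i * (T j * T i))
  braid_six : ∀ i j, i ≠ j → D.cartan i j = -3 → D.cartan j i = -1 →
    T i * (T j * (T i * (T j * (T i * T j)))) = T j * (T i * (T j * (T i * (T j * T i))))
  omega_mul : ∀ ω ω', D.length ω = 0 → D.length ω' = 0 → Om (ω * ω') = Om ω * Om ω'
  omega_conj : ∀ ω i j, D.length ω = 0 → D.act ω (D.Δ i) = D.Δ j → Om ω * T i = T j * Om ω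

theorem W_ext {v w : D.W} (h : ∀ b, D.act v b = D.act w b) : v = w :=
  Subtype.ext (affineIsometry_ext_of_affAct h)

theorem inner_coroot_Δ_self (i : Fin (n + 1)) : inner ℝ (coroot (D.Δ i).2) (D.Δ i).2 = 2 :=
  inner_coroot_self (D.snd_ne_zero (D.Δ_mem_Rred i))

theorem s_braid_two {i j : Fin (n + 1)} (h1 : D.cartan i j = 0) (h2 : D.cartan j i = 0) :
    D.s i * D.s j = D.s j * D.s i := by
  refine D.W_ext fun b => ?_
  simp only [act_mul, act_s, Prod.snd_sub, Prod.smul_snd, inner_sub_right, inner_smul_right,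
    inner_coroot_Δ, h1, h2]
  push_cast; module

theorem s_braid_three {i j : Fin (n + 1)} (h1 : D.cartan i j = -1) (h2 : D.cartan j i = -1) :
    D.s i * (D.s j * D.s i) = D.s j * (D.s i * D.s j) := by
  refine D.W_ext fun b => ?_
  simp only [act_mul, act_s, Prod.snd_sub, Prod.smul_snd, inner_sub_right, inner_smul_right,
    inner_coroot_Δ_self, inner_coroot_Δ, h1, h2]
  push_cast; module

theorem s_braid_four {i j : Fin (n + 1)} (h1 : D.cartan i j = -2) (h2 : D.cartan j i = -1) :
    D.s i * (D.s j * (D.s i * D.s j)) = D.s j * (D.s i * (D.s j * D.s i)) := by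
  refine D.W_ext fun b => ?_
  simp only [act_mul, act_s, Prod.snd_sub, Prod.smul_snd, inner_sub_right, inner_smul_right,
    inner_coroot_Δ_self, inner_coroot_Δ, h1, h2]
  push_cast; module

theorem s_braid_six {i j : Fin (n + 1)} (h1 : D.cartan i j = -3) (h2 : D.cartan j i = -1) :
    D.s i * (D.s j * (D.s i * (D.s j * (D.s i * D.s j)))) =
      D.s j * (D.s i * (D.s j * (D.s i * (D.s j * D.s i)))) := by
  refine D.W_ext fun b => ?_
  have key : ∀ k (c d : ℝ), D.act (D.s k) (b + c • D.Δ i + d • D.Δ j) =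
      b + c • D.Δ i + d • D.Δ j - (inner ℝ (coroot (D.Δ k).2) b.2 + c * D.cartan k i
        + d * D.cartan k j) • D.Δ k := by
    intro k c d
    rw [act_s]
    simp only [Prod.snd_add, Prod.smul_snd, inner_add_right, inner_smul_right, inner_coroot_Δ]
  have hii : (D.cartan i i : ℝ) = 2 := by rw [← inner_coroot_Δ, inner_coroot_Δ_self]
  have hjj : (D.cartan j j : ℝ) = 2 := by rw [← inner_coroot_Δ, inner_coroot_Δ_self]
  have keyi : ∀ c d : ℝ, D.act (D.s i) (b + c • D.Δ i + d • D.Δ j) =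
      b + (-c + 3 * d - inner ℝ (coroot (D.Δ i).2) b.2) • D.Δ i + d • D.Δ j := by
    intro c d; rw [key, hii, h1]; push_cast; module
  have keyj : ∀ c d : ℝ, D.act (D.s j) (b + c • D.Δ i + d • D.Δ j) =
      b + c • D.Δ i + (-d + c - inner ℝ (coroot (D.Δ j).2) b.2) • D.Δ j := by
    intro c d; rw [key, hjj, h2]; push_cast; module
  have hb : b = b + (0 : ℝ) • D.Δ i + (0 : ℝ) • D.Δ j := by module
  rw [hb]
  simp only [act_mul, keyi, keyj]
  module

variable {M : Type*} [Monoid M]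

/-- `g` is the product `T_{i₁} ⋯ T_{iₗ} Om_ω` for some reduced expression
`w = s_{i₁} ⋯ s_{iₗ} ω`. -/
inductive IsReducedProduct (T : Fin (n + 1) → M) (Om : D.W → M) : D.W → M → Prop
  | omega {ω : D.W} (h : D.length ω = 0) : IsReducedProduct T Om ω (Om ω)
  | step {i : Fin (n + 1)} {w : D.W} {g : M} (h : D.length (D.s i * w) = D.length w + 1)
      (hw : IsReducedProduct T Om w g) : IsReducedProduct T Om (D.s i * w) (T i * g)

variable {D} {T : Fin (n + 1) → M} {Om : D.W → M}

theorem IsReducedProduct.of_descent {i : Fin (n + 1)} {w : D.W} {g : M}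
    (h : D.act w⁻¹ (D.Δ i) ∈ D.RredNeg) (hg : D.IsReducedProduct T Om (D.s i * w) g) :
    D.IsReducedProduct T Om w (T i * g) := by
  have h1 := IsReducedProduct.step (i := i)
    (by rw [s_mul_cancel_left]; exact D.length_s_mul_of_neg h) hg
  rwa [s_mul_cancel_left] at h1

theorem IsReducedProduct.cases {w : D.W} {g : M} (h : D.IsReducedProduct T Om w g) :
    (D.length w = 0 ∧ g = Om w) ∨ ∃ i g', D.act w⁻¹ (D.Δ i) ∈ D.RredNeg ∧
      D.IsReducedProduct T Om (D.s i * w) g' ∧ g = T i * g' := by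
  rcases h with h | ⟨h, hw⟩
  · exact Or.inl ⟨h, rfl⟩
  · refine Or.inr ⟨_, _, D.act_inv_mem_RredNeg_of_length (by rw [s_mul_cancel_left]; exact h), ?_,
      rfl⟩
    rwa [s_mul_cancel_left]

theorem exists_isReducedProduct (T : Fin (n + 1) → M) (Om : D.W → M) (w : D.W) :
    ∃ g, D.IsReducedProduct T Om w g := by
  refine D.reduced_induction (P := fun w => ∃ g, D.IsReducedProduct T Om w g) ?_ ?_ w
  · exact fun ω h => ⟨_, .omega h⟩
  · rintro i w h ⟨g, hg⟩; exact ⟨_, .step h hg⟩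

/-- If `w⁻¹` makes the simple roots `aᵢ`, `aⱼ` negative, then it makes negative every root that
is a natural combination of the two. -/
theorem act_inv_comb_mem_RredNeg {i j : Fin (n + 1)} {w : D.W}
    (hi : D.act w⁻¹ (D.Δ i) ∈ D.RredNeg) (hj : D.act w⁻¹ (D.Δ j) ∈ D.RredNeg) {x : ℝ × Z}
    (hx : x ∈ D.Rred) (c d : ℕ) (h : x = (c : ℝ) • D.Δ i + (d : ℝ) • D.Δ j) :
    D.act w⁻¹ x ∈ D.RredNeg := by
  refine ⟨D.neg_mem_Rred (D.act_mem_Rred _ hx), ?_⟩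
  have h1 : -D.act w⁻¹ x = c • -D.act w⁻¹ (D.Δ i) + d • -D.act w⁻¹ (D.Δ j) := by
    rw [h, act_add, act_smul, act_smul, Nat.cast_smul_eq_nsmul, Nat.cast_smul_eq_nsmul]
    simp only [smul_neg]; abel
  have h2 : -D.act w⁻¹ x ∈ natCone D.Δ := by
    rw [h1]; exact add_mem (nsmul_mem hi.2 _) (nsmul_mem hj.2 _)
  exact h2

theorem act_s_comb_left (i j : Fin (n + 1)) (c d : ℝ) :
    D.act (D.s i) (c • D.Δ i + d • D.Δ j) =
      (-c - d * D.cartan i j) • D.Δ i + d • D.Δ j := by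
  rw [act_add, act_smul, act_smul, act_s_self, act_s_Δ]; module

theorem act_s_comb_right (i j : Fin (n + 1)) (c d : ℝ) :
    D.act (D.s j) (c • D.Δ i + d • D.Δ j) =
      c • D.Δ i + (-d - c * D.cartan j i) • D.Δ j := by
  rw [act_add, act_smul, act_smul, act_s_self, act_s_Δ]; module

/-- The shape of a descent from `w` along an alternating word in `sᵢ`, `sⱼ`: a real combination
of `aᵢ`, `aⱼ` is moved through the word, and it suffices that the outcome has natural
coefficients. -/
theorem act_inv_mem_of_eq {i j : Fin (n + 1)} {w : D.W}
    (hi : D.act w⁻¹ (D.Δ i) ∈ D.RredNeg) (hj : D.act w⁻¹ (D.Δ j) ∈ D.RredNeg)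
    {u : D.W} {k : Fin (n + 1)} (c d : ℕ)
    (h : D.act u⁻¹ (D.Δ k) = (c : ℝ) • D.Δ i + (d : ℝ) • D.Δ j) :
    D.act (u * w)⁻¹ (D.Δ k) ∈ D.RredNeg := by
  rw [mul_inv_rev, act_mul]
  exact act_inv_comb_mem_RredNeg hi hj (D.act_mem_Rred _ (D.Δ_mem_Rred k)) c d h

/-- The four lemmas `chain_two`, …, `chain_six` lengthen a reduced product along the alternating word
in `sᵢ` and `sⱼ`. Here `w` has both descents `i` and `j`, so that it starts with the longest
element of the dihedral group that `sᵢ` and `sⱼ` generate; the numbers `x`, `y` are the negatives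
of the Cartan integers, and their product fixes the order of `sᵢ sⱼ`. -/
theorem chain_two {i j : Fin (n + 1)} (h1 : D.cartan i j = 0) {w : D.W}
    (hi : D.act w⁻¹ (D.Δ i) ∈ D.RredNeg) (hj : D.act w⁻¹ (D.Δ j) ∈ D.RredNeg) {g : M}
    (hg : D.IsReducedProduct T Om (D.s j * D.s i * w) g) :
    D.IsReducedProduct T Om (D.s i * w) (T j * g) := by
  simp only [mul_assoc] at hg
  refine .of_descent (act_inv_mem_of_eq hi hj 0 1 ?_) hg
  rw [s_inv, act_s_Δ, h1]; push_cast; module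

theorem chain_three {i j : Fin (n + 1)} (h1 : D.cartan i j = -1) (h2 : D.cartan j i = -1)
    {w : D.W} (hi : D.act w⁻¹ (D.Δ i) ∈ D.RredNeg) (hj : D.act w⁻¹ (D.Δ j) ∈ D.RredNeg) {g : M}
    (hg : D.IsReducedProduct T Om (D.s i * (D.s j * D.s i) * w) g) :
    D.IsReducedProduct T Om (D.s i * w) (T j * (T i * g)) := by
  have hΔi : D.Δ i = (1 : ℝ) • D.Δ i + (0 : ℝ) • D.Δ j := by module
  have hΔj : D.Δ j = (0 : ℝ) • D.Δ i + (1 : ℝ) • D.Δ j := by module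
  simp only [mul_assoc] at hg
  refine .of_descent (act_inv_mem_of_eq hi hj 1 1 ?_) (.of_descent ?_ hg)
  · rw [hΔj, s_inv, act_s_comb_left, h1]; push_cast; module
  · rw [← mul_assoc]
    refine act_inv_mem_of_eq hi hj 0 1 ?_
    rw [hΔi]; simp only [mul_inv_rev, s_inv, act_mul, act_s_comb_left, act_s_comb_right, h1, h2]
    push_cast; module

theorem chain_four {i j : Fin (n + 1)} {x y : ℕ} (h1 : D.cartan i j = -x)
    (h2 : D.cartan j i = -y) (hxy : x * y = 2)
    {w : D.W} (hi : D.act w⁻¹ (D.Δ i) ∈ D.RredNeg) (hj : D.act w⁻¹ (D.Δ j) ∈ D.RredNeg) {g : M}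
    (hg : D.IsReducedProduct T Om (D.s j * (D.s i * (D.s j * D.s i)) * w) g) :
    D.IsReducedProduct T Om (D.s i * w) (T j * (T i * (T j * g))) := by
  have hΔi : D.Δ i = (1 : ℝ) • D.Δ i + (0 : ℝ) • D.Δ j := by module
  have hΔj : D.Δ j = (0 : ℝ) • D.Δ i + (1 : ℝ) • D.Δ j := by module
  have hxy' : (x : ℝ) * y = 2 := by exact_mod_cast hxy
  simp only [mul_assoc] at hg
  refine .of_descent (act_inv_mem_of_eq hi hj x 1 ?_) (.of_descent ?_ (.of_descent ?_ hg))
  · rw [hΔj, s_inv, act_s_comb_left, h1]; push_cast; module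
  · rw [← mul_assoc]
    refine act_inv_mem_of_eq hi hj 1 y ?_
    rw [hΔi]; simp only [mul_inv_rev, s_inv, act_mul, act_s_comb_left, act_s_comb_right, h1, h2]
    push_cast
    congr 2
    · linear_combination hxy'
    · ring
  · rw [← mul_assoc, ← mul_assoc]
    refine act_inv_mem_of_eq hi hj 0 1 ?_
    rw [hΔj]; simp only [mul_inv_rev, s_inv, act_mul, act_s_comb_left, act_s_comb_right, h1, h2]
    push_cast
    congr 2
    · linear_combination (x : ℝ) * hxy'
    · linear_combination hxy'

theorem chain_six {i j : Fin (n + 1)} {x y : ℕ} (h1 : D.cartan i j = -x)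
    (h2 : D.cartan j i = -y) (hxy : x * y = 3)
    {w : D.W} (hi : D.act w⁻¹ (D.Δ i) ∈ D.RredNeg) (hj : D.act w⁻¹ (D.Δ j) ∈ D.RredNeg) {g : M}
    (hg : D.IsReducedProduct T Om
      (D.s j * (D.s i * (D.s j * (D.s i * (D.s j * D.s i)))) * w) g) :
    D.IsReducedProduct T Om (D.s i * w) (T j * (T i * (T j * (T i * (T j * g))))) := by
  have hΔi : D.Δ i = (1 : ℝ) • D.Δ i + (0 : ℝ) • D.Δ j := by module
  have hΔj : D.Δ j = (0 : ℝ) • D.Δ i + (1 : ℝ) • D.Δ j := by module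
  have hxy' : (x : ℝ) * y = 3 := by exact_mod_cast hxy
  simp only [mul_assoc] at hg
  refine .of_descent (act_inv_mem_of_eq hi hj x 1 ?_) (.of_descent ?_ (.of_descent ?_
    (.of_descent ?_ (.of_descent ?_ hg))))
  · rw [hΔj, s_inv, act_s_comb_left, h1]; push_cast; module
  · rw [← mul_assoc]
    refine act_inv_mem_of_eq hi hj 2 y ?_
    rw [hΔi]; simp only [mul_inv_rev, s_inv, act_mul, act_s_comb_left, act_s_comb_right, h1, h2]
    push_cast
    congr 2
    · linear_combination hxy'
    · ring
  · rw [← mul_assoc, ← mul_assoc]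
    refine act_inv_mem_of_eq hi hj x 2 ?_
    rw [hΔj]; simp only [mul_inv_rev, s_inv, act_mul, act_s_comb_left, act_s_comb_right, h1, h2]
    push_cast
    congr 2
    · linear_combination (x : ℝ) * hxy'
    · linear_combination hxy'
  · rw [← mul_assoc, ← mul_assoc, ← mul_assoc]
    refine act_inv_mem_of_eq hi hj 1 y ?_
    rw [hΔi]; simp only [mul_inv_rev, s_inv, act_mul, act_s_comb_left, act_s_comb_right, h1, h2]
    push_cast
    congr 2
    · linear_combination ((x : ℝ) * y) * hxy'
    · linear_combination (y : ℝ) * hxy'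
  · rw [← mul_assoc, ← mul_assoc, ← mul_assoc, ← mul_assoc]
    refine act_inv_mem_of_eq hi hj 0 1 ?_
    rw [hΔj]; simp only [mul_inv_rev, s_inv, act_mul, act_s_comb_left, act_s_comb_right, h1, h2]
    push_cast
    congr 2
    · linear_combination (x * ((x : ℝ) * y) - x) * hxy'
    · linear_combination ((x : ℝ) * y) * hxy'

/-- The reduced product does not depend on the reduced expression.  If the expressions begin with
different letters `i`, `j`, then the element has the longest element of the finite dihedral group
`⟨sᵢ, sⱼ⟩` as a left factor, and the two products can be compared through the two alternating
expressions of that factor. -/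
theorem IsReducedProduct.unique (hT : D.BraidFamily T Om) {w : D.W} {g g' : M}
    (h : D.IsReducedProduct T Om w g) (h' : D.IsReducedProduct T Om w g') : g = g' := by
  induction hN : D.length w using Nat.strong_induction_on generalizing w g g' with
  | _ N ih =>
    rcases h.cases with ⟨h0, rfl⟩ | ⟨i, g₁, hi, h₁, rfl⟩
    · rcases h'.cases with ⟨-, rfl⟩ | ⟨i, g₁, hi, h₁, rfl⟩
      · rfl
      · have := D.length_s_mul_of_neg hi; omega
    rcases h'.cases with ⟨h0, rfl⟩ | ⟨j, g₂, hj, h₂, rfl⟩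
    · have := D.length_s_mul_of_neg hi; omega
    have hli := D.length_s_mul_of_neg hi
    have hlj := D.length_s_mul_of_neg hj
    by_cases hij : i = j
    · subst hij
      rw [ih _ (by omega) h₁ h₂ rfl]
    have ihi := fun a (ha : D.IsReducedProduct T Om (D.s i * w) a) => ih _ (by omega) h₁ ha rfl
    have ihj := fun a (ha : D.IsReducedProduct T Om (D.s j * w) a) => ih _ (by omega) h₂ ha rfl
    rcases D.cartan_cases hij (D.cartan_mul_le hij hi hj) with ⟨c, c'⟩ | ⟨c, c'⟩ | ⟨c, c'⟩ |
      ⟨c, c'⟩ | ⟨c, c'⟩ | ⟨c, c'⟩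
    · obtain ⟨e, he⟩ := exists_isReducedProduct T Om (D.s j * D.s i * w)
      rw [ihi _ (chain_two c hi hj he),
        ihj _ (chain_two c' hj hi (by rwa [D.s_braid_two c c']))]
      simp only [← mul_assoc]
      rw [hT.braid_two i j hij c c']
    · obtain ⟨e, he⟩ := exists_isReducedProduct T Om (D.s i * (D.s j * D.s i) * w)
      rw [ihi _ (chain_three c c' hi hj he),
        ihj _ (chain_three c' c hj hi (by rwa [← D.s_braid_three c c']))]
      have := hT.braid_three i j hij c c'
      simp only [← mul_assoc] at this ⊢
      rw [this]
    · obtain ⟨e, he⟩ := exists_isReducedProduct T Om (D.s j * (D.s i * (D.s j * D.s i)) * w)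
      rw [ihi _ (chain_four (x := 2) (y := 1) c c' rfl hi hj he),
        ihj _ (chain_four (x := 1) (y := 2) c' c rfl hj hi (by rwa [D.s_braid_four c c']))]
      have := hT.braid_four i j hij c c'
      simp only [← mul_assoc] at this ⊢
      rw [this]
    · obtain ⟨e, he⟩ := exists_isReducedProduct T Om (D.s j * (D.s i * (D.s j * D.s i)) * w)
      rw [ihi _ (chain_four (x := 1) (y := 2) c c' rfl hi hj he),
        ihj _ (chain_four (x := 2) (y := 1) c' c rfl hj hi (by rwa [← D.s_braid_four c' c]))]
      have := hT.braid_four j i (Ne.symm hij) c' c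
      simp only [← mul_assoc] at this ⊢
      rw [this]
    · obtain ⟨e, he⟩ := exists_isReducedProduct T Om
        (D.s j * (D.s i * (D.s j * (D.s i * (D.s j * D.s i)))) * w)
      rw [ihi _ (chain_six (x := 3) (y := 1) c c' rfl hi hj he),
        ihj _ (chain_six (x := 1) (y := 3) c' c rfl hj hi (by rwa [D.s_braid_six c c']))]
      have := hT.braid_six i j hij c c'
      simp only [← mul_assoc] at this ⊢
      rw [this]
    · obtain ⟨e, he⟩ := exists_isReducedProduct T Om
        (D.s j * (D.s i * (D.s j * (D.s i * (D.s j * D.s i)))) * w)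
      rw [ihi _ (chain_six (x := 1) (y := 3) c c' rfl hi hj he),
        ihj _ (chain_six (x := 3) (y := 1) c' c rfl hj hi (by rwa [← D.s_braid_six c' c]))]
      have := hT.braid_six j i (Ne.symm hij) c' c
      simp only [← mul_assoc] at this ⊢
      rw [this]

/-- A braid family extends to a map on the extended affine Weyl group that is multiplicative
wherever lengths add. -/
theorem BraidFamily.exists_extension (hT : D.BraidFamily T Om) :
    ∃ F : D.W → M, (∀ i, F (D.s i) = T i * Om 1) ∧ (∀ ω, D.length ω = 0 → F ω = Om ω) ∧
      (∀ v w, D.length (v * w) = D.length v + D.length w → F (v * w) = F v * F w) := by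
  choose F hF using exists_isReducedProduct (D := D) T Om
  have hω : ∀ ω, D.length ω = 0 → F ω = Om ω := fun ω h =>
    (hF ω).unique hT (.omega h)
  have hs : ∀ i w, D.length (D.s i * w) = D.length w + 1 → F (D.s i * w) = T i * F w :=
    fun i w h => (hF _).unique hT (.step h (hF w))
  have homega : ∀ ω, D.length ω = 0 → ∀ w, F (ω * w) = Om ω * F w := by
    intro ω h0
    refine D.reduced_induction ?_ ?_
    · intro ω' h0'
      rw [hω _ (by rw [D.length_omega_mul h0, h0']), hω _ h0', hT.omega_mul _ _ h0 h0']
    · intro i w hl ih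
      obtain ⟨j, hj⟩ := D.exists_act_omega_eq h0 i
      have h1 : ω * (D.s i * w) = D.s j * (ω * w) := by
        rw [← mul_assoc, D.omega_mul_s hj, mul_assoc]
      have h2 : D.length (D.s j * (ω * w)) = D.length (ω * w) + 1 := by
        rw [← h1, D.length_omega_mul h0, D.length_omega_mul h0, hl]
      rw [h1, hs j _ h2, ih, hs i _ hl, ← mul_assoc, ← mul_assoc, hT.omega_conj _ _ _ h0 hj]
  refine ⟨F, fun i => ?_, hω, fun v w => ?_⟩
  · have h := hs i 1 (by rw [mul_one, length_s, length_one])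
    rwa [mul_one, hω 1 D.length_one] at h
  · refine D.reduced_induction
      (P := fun v => D.length (v * w) = D.length v + D.length w → F (v * w) = F v * F w) ?_ ?_ v
    · intro ω h0 _
      rw [homega ω h0, hω ω h0]
    · intro i v hl ih h
      rw [mul_assoc] at h ⊢
      have h1 := D.length_mul_le v w
      have h2 := D.length_s_mul_le i (v * w)
      have h3 : D.length (v * w) = D.length v + D.length w := by omega
      rw [hs i _ (by omega), ih h3, hs i _ hl, mul_assoc]

end InitialData

/-! ### The `q`-action on the torus -/

namespace InitialData

variable {Z : Type*} [NormedAddCommGroup Z] [InnerProductSpace ℝ Z] {n : ℕ} (D : InitialData Z n)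

theorem affAct_inv_eq (g : Z ≃ᵃⁱ[ℝ] Z) (a : ℝ × Z) :
    affAct g⁻¹ a = (a.1 + inner ℝ a.2 (g 0), g.linearIsometryEquiv⁻¹ a.2) := by
  have h : a = affAct g (a.1 + inner ℝ a.2 (g 0), g.linearIsometryEquiv⁻¹ a.2) := by
    have h1 : g.linearIsometryEquiv (g.linearIsometryEquiv⁻¹ a.2) = a.2 :=
      g.linearIsometryEquiv.apply_symm_apply a.2
    simp only [affAct, h1, add_sub_cancel_right]
  conv_lhs => rw [h]
  rw [affAct_inv_self]

theorem act_snd_mem_Λ (w : D.W) {a : ℝ × Z} (h : a.2 ∈ D.Λ) : (D.act w a).2 ∈ D.Λ :=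
  D.W₀_mem_Λ w.2.1 _ h

/-- The function `t ↦ t_q^a = q^r t^v` on the torus, for `a = r c + v` with `v ∈ Λ`. -/
def evalAff {q : ℝ} (hq : 0 < q) (a : ℝ × Z) (ha : a.2 ∈ D.Λ) (t : D.Torus) : ℂˣ :=
  qpow hq a.1 * t ⟨a.2, ha⟩

variable {q : ℝ} (hq : 0 < q)

theorem qpow_zero : qpow hq 0 = 1 := by ext; simp [qpow]

theorem qpow_zsmul (m : ℤ) (r : ℝ) : qpow hq (m * r) = qpow hq r ^ m := by
  ext; simp [qpow, mul_comm (m : ℝ), Real.rpow_mul hq.le, Real.rpow_intCast]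

theorem evalAff_congr {a b : ℝ × Z} (h : a = b) (ha : a.2 ∈ D.Λ) (t : D.Torus) :
    D.evalAff hq a ha t = D.evalAff hq b (h ▸ ha) t := by
  subst h; rfl

theorem torusAct_apply (w : D.W) (t : D.Torus) (v : D.Λ) :
    D.torusAct hq w t v = D.evalAff hq (D.act w⁻¹ (0, v)) (D.act_snd_mem_Λ _ v.2) t := by
  have h : D.act w⁻¹ (0, (v : Z)) = (inner ℝ (v : Z) ((w : Z ≃ᵃⁱ[ℝ] Z) 0),
      (w : Z ≃ᵃⁱ[ℝ] Z).linearIsometryEquiv⁻¹ (v : Z)) := by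
    have := affAct_inv_eq (w : Z ≃ᵃⁱ[ℝ] Z) (0, (v : Z))
    rwa [zero_add] at this
  rw [D.evalAff_congr hq h]; rfl

theorem evalAff_torusAct (w : D.W) (t : D.Torus) (a : ℝ × Z) (ha : a.2 ∈ D.Λ) :
    D.evalAff hq a ha (D.torusAct hq w t) =
      D.evalAff hq (D.act w⁻¹ a) (D.act_snd_mem_Λ _ ha) t := by
  have h : D.act w⁻¹ a = (a.1 + (D.act w⁻¹ (0, a.2)).1, (D.act w⁻¹ (0, a.2)).2) := by
    have h1 : a = (a.1, (0 : Z)) + (0, a.2) := by simp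
    conv_lhs => rw [h1, act_add]
    have h2 : D.act w⁻¹ (a.1, 0) = (a.1, 0) := affAct_const _ _
    rw [h2]; ext <;> simp
  rw [D.evalAff_congr hq h]
  simp only [evalAff, torusAct_apply, qpow_add, mul_assoc]

theorem torusAct_mul (v w : D.W) (t : D.Torus) :
    D.torusAct hq (v * w) t = D.torusAct hq v (D.torusAct hq w t) := by
  refine DFunLike.ext _ _ fun l => ?_
  rw [torusAct_apply, torusAct_apply, evalAff_torusAct]
  exact D.evalAff_congr hq (by rw [← act_mul, mul_inv_rev]) _ t

theorem torusAct_one (t : D.Torus) : D.torusAct hq 1 t = t := by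
  refine DFunLike.ext _ _ fun l => ?_
  rw [torusAct_apply, D.evalAff_congr hq (by rw [inv_one, act_one])]
  simp [evalAff, qpow_zero]

theorem torus_zsmul (t : D.Torus) (m : ℤ) (v : D.Λ) : t (m • v) = t v ^ m :=
  AddChar.map_zsmul_eq_zpow t m v

theorem evalAff_sub_zsmul (a b : ℝ × Z) (m : ℤ) (h : (a - (m : ℝ) • b).2 ∈ D.Λ)
    (ha : a.2 ∈ D.Λ) (hb : b.2 ∈ D.Λ) (t : D.Torus) :
    D.evalAff hq (a - (m : ℝ) • b) h t =
      D.evalAff hq a ha t * D.evalAff hq b hb t ^ (-m) := by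
  have h1 : (⟨(a - (m : ℝ) • b).2, h⟩ : D.Λ) = ⟨a.2, ha⟩ + (-m) • ⟨b.2, hb⟩ := by
    ext
    simp only [Prod.snd_sub, Prod.smul_snd, Submodule.coe_add, Submodule.coe_smul,
      ← Int.cast_smul_eq_zsmul ℝ]
    push_cast; module
  have h2 : (a - (m : ℝ) • b).1 = a.1 + (-m : ℤ) * b.1 := by
    simp only [Prod.fst_sub, Prod.smul_fst, smul_eq_mul]; push_cast; ring
  simp only [evalAff, h1, h2, qpow_add, qpow_zsmul, AddChar.map_add_eq_mul, torus_zsmul, mul_zpow]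
  exact mul_mul_mul_comm _ _ _ _

/-- The coordinate `t ↦ t_q^{aᵢ}` as a unit. -/
def simpleEval (i : Fin (n + 1)) (t : D.Torus) : ℂˣ :=
  D.evalAff hq (D.Δ i) (D.Rred_snd_mem_Λ (D.Δ_mem_Rred i)) t

theorem evalSimple_eq (i : Fin (n + 1)) (t : D.Torus) :
    D.evalSimple hq i t = D.simpleEval hq i t := rfl

theorem simpleEval_s (i j : Fin (n + 1)) (t : D.Torus) :
    D.simpleEval hq j (D.torusAct hq (D.s i) t) =
      D.simpleEval hq j t * D.simpleEval hq i t ^ (-D.cartan i j) := by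
  rw [simpleEval, evalAff_torusAct,
    D.evalAff_congr hq (show D.act (D.s i)⁻¹ (D.Δ j) = D.Δ j - (D.cartan i j : ℝ) • D.Δ i by
      rw [s_inv, act_s_Δ])]
  exact D.evalAff_sub_zsmul hq _ _ _ _ _ _ t

theorem simpleEval_omega {ω : D.W} {i j : Fin (n + 1)} (h : D.act ω (D.Δ i) = D.Δ j)
    (t : D.Torus) : D.simpleEval hq j (D.torusAct hq ω t) = D.simpleEval hq i t := by
  rw [simpleEval, evalAff_torusAct]
  exact D.evalAff_congr hq (by rw [← h, act_inv_act]) _ t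

theorem exists_cartan_Λ (i : Fin (n + 1)) (v : D.Λ) :
    ∃ m : ℤ, inner ℝ (coroot (D.Δ i).2) (v : Z) = m := by
  obtain ⟨m, hm⟩ := D.Λ_integral v v.2 _ (D.snd_mem_R₀ (D.Δ_mem_Rred i))
  exact ⟨m, by rw [real_inner_comm, hm]⟩

theorem torusAct_s_apply (i : Fin (n + 1)) (t : D.Torus) (v : D.Λ) {m : ℤ}
    (hm : inner ℝ (coroot (D.Δ i).2) (v : Z) = m) :
    D.torusAct hq (D.s i) t v = t v * D.simpleEval hq i t ^ (-m) := by
  have h : D.act (D.s i)⁻¹ (0, (v : Z)) = (0, (v : Z)) - (m : ℝ) • D.Δ i := by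
    rw [s_inv, act_s, hm]
  rw [torusAct_apply, D.evalAff_congr hq h,
    D.evalAff_sub_zsmul hq _ _ _ _ v.2 (D.Rred_snd_mem_Λ (D.Δ_mem_Rred i))]
  congr 1
  simp [evalAff, qpow_zero]

/-! ### Regular functions -/

/-- The function `t ↦ t^v` on the torus. -/
def chi (v : D.Λ) (t : D.Torus) : ℂ := (t v : ℂˣ)

theorem chi_mem (v : D.Λ) : D.chi v ∈ D.regular := Algebra.subset_adjoin ⟨v, rfl⟩

theorem chi_add (v w : D.Λ) : D.chi (v + w) = D.chi v * D.chi w := by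
  ext t; simp [chi, AddChar.map_add_eq_mul]

theorem chi_zero : D.chi 0 = 1 := by ext t; simp [chi]

theorem regular_eq_span : (D.regular.toSubmodule : Submodule ℂ (D.Torus → ℂ)) =
    Submodule.span ℂ (Set.range D.chi) := by
  let S : Submonoid (D.Torus → ℂ) :=
    { carrier := Set.range D.chi
      one_mem' := ⟨0, D.chi_zero⟩
      mul_mem' := by rintro _ _ ⟨v, rfl⟩ ⟨w, rfl⟩; exact ⟨v + w, D.chi_add v w⟩ }
  have h : Submonoid.closure (Set.range D.chi) = S :=
    Submonoid.closure_eq_of_le subset_rfl Submonoid.subset_closure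
  have h1 := Algebra.adjoin_eq_span ℂ (Set.range D.chi)
  rw [h] at h1
  exact h1

theorem regular_induction {P : (D.Torus → ℂ) → Prop} (hchi : ∀ v, P (D.chi v)) (h0 : P 0)
    (hadd : ∀ p p', P p → P p' → P (p + p')) (hsmul : ∀ (c : ℂ) p, P p → P (c • p))
    {p : D.Torus → ℂ} (hp : p ∈ D.regular) : P p := by
  have hp' : p ∈ Submodule.span ℂ (Set.range D.chi) := D.regular_eq_span ▸ hp
  refine Submodule.span_induction (p := fun p _ => P p) ?_ h0 (fun x y _ _ => hadd x y)
    (fun c x _ => hsmul c x) hp'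
  rintro _ ⟨v, rfl⟩; exact hchi v

theorem exists_finsupp {p : D.Torus → ℂ} (hp : p ∈ D.regular) :
    ∃ c : D.Λ →₀ ℂ, ∀ t, p t = c.sum fun v a => a * D.chi v t := by
  have hp' : p ∈ Submodule.span ℂ (Set.range D.chi) := D.regular_eq_span ▸ hp
  obtain ⟨c, hc⟩ := (Finsupp.mem_span_range_iff_exists_finsupp).mp hp'
  refine ⟨c, fun t => ?_⟩
  rw [← hc, Finsupp.sum, Finsupp.sum, Finset.sum_apply]
  rfl

/-- The point `v ↦ exp(x (v, z))` of the torus. -/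
def expPoint (z : Z) (x : ℝ) : D.Torus where
  toFun v := Units.mk0 (Real.exp (x * inner ℝ (v : Z) z) : ℂ)
    (by exact_mod_cast (Real.exp_pos _).ne')
  map_zero_eq_one' := by ext; simp
  map_add_eq_mul' v w := by
    ext; simp [inner_add_left, mul_add, Complex.exp_add]

theorem chi_expPoint (z : Z) (x : ℝ) (v : D.Λ) :
    D.chi v (D.expPoint z x) = (Real.exp (x * inner ℝ (v : Z) z) : ℂ) := rfl

theorem exists_separating [FiniteDimensional ℝ Z] :
    ∃ z : Z, ∀ v : D.Λ, v ≠ 0 → inner ℝ (v : Z) z ≠ 0 := by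
  let _ : MeasurableSpace Z := borel Z
  have : BorelSpace Z := ⟨rfl⟩
  have := D.discrete_Λ
  have : IsZLattice ℝ D.Λ := ⟨D.span_Λ⟩
  have : Countable D.Λ := inferInstance
  let μ : MeasureTheory.Measure Z := MeasureTheory.Measure.addHaar
  have hnull : μ (⋃ v : {v : D.Λ // v ≠ 0}, ((ℝ ∙ ((v : D.Λ) : Z))ᗮ : Set Z)) = 0 := by
    refine MeasureTheory.measure_iUnion_null fun v => ?_
    refine MeasureTheory.Measure.addHaar_submodule μ _ fun h => v.2 ?_
    rw [Submodule.orthogonal_eq_top_iff, Submodule.span_singleton_eq_bot] at h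
    exact Subtype.ext h
  have hne : (⋃ v : {v : D.Λ // v ≠ 0}, ((ℝ ∙ ((v : D.Λ) : Z))ᗮ : Set Z)) ≠ Set.univ := by
    intro h
    rw [h] at hnull
    exact (NeZero.ne (μ Set.univ)) hnull
  obtain ⟨z, hz⟩ := (Set.ne_univ_iff_exists_notMem _).mp hne
  refine ⟨z, fun v hv h => hz ?_⟩
  exact Set.mem_iUnion.mpr ⟨⟨v, hv⟩, Submodule.mem_orthogonal_singleton_iff_inner_right.mpr h⟩

/-- Along a curve `x ↦ expPoint z x` that separates the characters, a nonzero regular function is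
dominated by one of its terms. -/
theorem eventually_ne_zero {z : Z} (hz : ∀ v : D.Λ, v ≠ 0 → inner ℝ (v : Z) z ≠ 0)
    {p : D.Torus → ℂ} (hp : p ∈ D.regular) (hp0 : p ≠ 0) :
    ∀ᶠ x in Filter.atTop, p (D.expPoint z x) ≠ 0 := by
  classical
  obtain ⟨c, hc⟩ := D.exists_finsupp hp
  have hne : c.support.Nonempty := by
    rw [Finset.nonempty_iff_ne_empty]
    intro h
    refine hp0 (funext fun t => ?_)
    rw [hc, Finsupp.sum, h, Finset.sum_empty]; rfl
  obtain ⟨v₀, hv₀, hmax⟩ := c.support.exists_max_image (fun v => inner ℝ (v : Z) z) hne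
  have hlim : Filter.Tendsto (fun x : ℝ => ∑ v ∈ c.support,
      c v * (Real.exp (x * (inner ℝ (v : Z) z - inner ℝ (v₀ : Z) z)) : ℂ)) Filter.atTop
      (nhds (∑ v ∈ c.support, if v = v₀ then c v else 0)) := by
    refine tendsto_finsetSum _ fun v hv => ?_
    by_cases h : v = v₀
    · subst h; simp
    · have hlt : inner ℝ (v : Z) z - inner ℝ (v₀ : Z) z < 0 := by
        refine lt_of_le_of_ne (by linarith [hmax v hv]) fun h0 => ?_
        refine hz (v - v₀) (sub_ne_zero.mpr h) ?_
        rw [Submodule.coe_sub, inner_sub_left, h0]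
      have h1 : Filter.Tendsto
          (fun x : ℝ => Real.exp (x * (inner ℝ (v : Z) z - inner ℝ (v₀ : Z) z)))
          Filter.atTop (nhds 0) :=
        Real.tendsto_exp_atBot.comp (Filter.tendsto_id.atTop_mul_const_of_neg hlt)
      have h2 := ((Complex.continuous_ofReal.tendsto 0).comp h1).const_mul (c v)
      simpa [h] using h2
  rw [Finset.sum_ite_eq' c.support v₀ c, if_pos hv₀] at hlim
  filter_upwards [hlim.eventually_ne (Finsupp.mem_support_iff.mp hv₀)] with x hx h0
  refine hx ?_
  rw [hc, Finsupp.sum] at h0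
  have h3 : ∀ v ∈ c.support,
      c v * (Real.exp (x * (inner ℝ (v : Z) z - inner ℝ (v₀ : Z) z)) : ℂ) =
      c v * D.chi v (D.expPoint z x) * (Real.exp (-(x * inner ℝ (v₀ : Z) z)) : ℂ) := by
    intro v _
    rw [chi_expPoint, mul_assoc, ← Complex.ofReal_mul, ← Real.exp_add]
    congr 3; ring
  rw [Finset.sum_congr rfl h3, ← Finset.sum_mul, h0, zero_mul]

/-- A nonzero regular function does not vanish at all points of the torus that avoid countably
many proper closed subsets `t^v = c`. -/
theorem exists_point [FiniteDimensional ℝ Z] {S : Set (D.Λ × ℂ)} (hS : S.Countable)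
    (hS0 : ∀ a ∈ S, a.1 ≠ 0) {p : D.Torus → ℂ} (hp : p ∈ D.regular) (hp0 : p ≠ 0) :
    ∃ t : D.Torus, p t ≠ 0 ∧ ∀ a ∈ S, D.chi a.1 t ≠ a.2 := by
  obtain ⟨z, hz⟩ := D.exists_separating
  obtain ⟨x₀, hx₀⟩ := Filter.eventually_atTop.mp (D.eventually_ne_zero hz hp hp0)
  have hbad : (⋃ a ∈ S, {x : ℝ | D.chi a.1 (D.expPoint z x) = a.2}).Countable := by
    refine hS.biUnion fun a ha => Set.Subsingleton.countable ?_
    intro x hx y hy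
    simp only [Set.mem_ofPred_eq, chi_expPoint] at hx hy
    have h1 := Real.exp_injective (Complex.ofReal_injective (hx.trans hy.symm))
    exact mul_right_cancel₀ (hz _ (hS0 a ha)) h1
  obtain ⟨x, hx, hx'⟩ := (hbad.dense_compl ℝ).exists_mem_open isOpen_Ioi ⟨x₀ + 1,
    show x₀ < x₀ + 1 by linarith⟩
  refine ⟨D.expPoint z x, hx₀ x (le_of_lt hx'), fun a ha h => hx ?_⟩
  exact Set.mem_biUnion ha h

theorem countable_W [FiniteDimensional ℝ Z] : Countable D.W := by
  have := D.discrete_Λd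
  have : IsZLattice ℝ D.Λd := ⟨D.span_Λd⟩
  have : Countable D.Λd := inferInstance
  have : Countable (linRefl '' D.R₀) := (D.isRootSystem.finite.image _).countable
  have : Countable D.W₀ := by
    rw [W₀, FreeGroup.closure_eq_range]
    exact Set.countable_range _
  refine Function.Injective.countable (β := D.W₀ × D.Λd)
    (f := fun w => (⟨_, w.2.1⟩, ⟨_, w.2.2⟩)) fun v w h => ?_
  simp only [Prod.mk.injEq, Subtype.mk.injEq] at h
  refine Subtype.ext (AffineIsometryEquiv.ext fun z => ?_)
  rw [affineIsometry_apply, affineIsometry_apply (w : Z ≃ᵃⁱ[ℝ] Z), h.1, h.2]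

/-- A point of the torus is generic with respect to the sets `B i` of exceptional values if its
orbit under the extended affine Weyl group is free, and if the coordinates `t_q^{aᵢ}` of no point
of the orbit are exceptional. -/
def IsGeneric (B : Fin (n + 1) → Set ℂ) (t : D.Torus) : Prop :=
  (∀ (w : D.W) i, (D.simpleEval hq i (D.torusAct hq w t) : ℂ) ∉ B i) ∧
    ∀ v w : D.W, D.torusAct hq v t = D.torusAct hq w t → v = w

theorem IsGeneric.torusAct {B : Fin (n + 1) → Set ℂ} {t : D.Torus} (h : D.IsGeneric hq B t)
    (u : D.W) : D.IsGeneric hq B (D.torusAct hq u t) := by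
  refine ⟨fun w i => ?_, fun v w hvw => ?_⟩
  · rw [← torusAct_mul]; exact h.1 _ i
  · rw [← torusAct_mul, ← torusAct_mul] at hvw
    exact mul_right_cancel (h.2 _ _ hvw)

theorem exists_mem_Λ_ne {g : Z →ₗ[ℝ] Z} {g' : Z →ₗ[ℝ] Z} (h : g ≠ g') :
    ∃ v : D.Λ, g v ≠ g' v := by
  by_contra! hcon
  refine h (LinearMap.ext_on D.span_Λ fun v hv => hcon ⟨v, hv⟩)

/-- For `w ≠ 1` the equality `w_q t = t` forces an equality `t^v = c` with `v ≠ 0`. -/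
theorem exists_of_torusAct_eq (hq1 : q ≠ 1) {w : D.W} (hw : w ≠ 1) :
    ∃ a : D.Λ × ℂ, a.1 ≠ 0 ∧ ∀ t, D.torusAct hq w t = t → D.chi a.1 t = a.2 := by
  set g := (w : Z ≃ᵃⁱ[ℝ] Z).linearIsometryEquiv with hg
  by_cases h1 : ∃ v : D.Λ, g⁻¹ (v : Z) ≠ v
  · obtain ⟨v, hv⟩ := h1
    let v' : D.Λ := ⟨g⁻¹ (v : Z), D.W₀_mem_Λ (D.W₀.inv_mem w.2.1) _ v.2⟩
    refine ⟨(v' - v, ((qpow hq (inner ℝ (v : Z) ((w : Z ≃ᵃⁱ[ℝ] Z) 0)))⁻¹ : ℂˣ)), ?_, ?_⟩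
    · intro h
      exact hv (congrArg Subtype.val (sub_eq_zero.mp h))
    · intro t ht
      have h2 : D.torusAct hq w t v = t v := by rw [ht]
      change qpow hq _ * t v' = t v at h2
      simp only [chi]
      rw [Units.val_inj, sub_eq_add_neg, AddChar.map_add_eq_mul, AddChar.map_neg_eq_inv, ← h2,
        mul_inv_rev, mul_inv_cancel_left]
  · push Not at h1
    have hlin : g = 1 := by
      have h2 : (g⁻¹).toLinearEquiv.toLinearMap = LinearMap.id := by
        by_contra hne
        obtain ⟨v, hv⟩ := D.exists_mem_Λ_ne hne
        exact hv (h1 v)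
      have h3 : g⁻¹ = 1 := LinearIsometryEquiv.ext fun z => LinearMap.congr_fun h2 z
      exact inv_eq_one.mp h3
    have hξ : (w : Z ≃ᵃⁱ[ℝ] Z) 0 ≠ 0 := by
      intro h0
      refine hw (Subtype.ext (AffineIsometryEquiv.ext fun z => ?_))
      rw [affineIsometry_apply, h0, ← hg, hlin, add_zero]; rfl
    set ξ := (w : Z ≃ᵃⁱ[ℝ] Z) 0
    have h4 : ∃ v : D.Λ, inner ℝ (v : Z) ξ ≠ 0 := by
      by_contra! hcon
      refine hξ (inner_self_eq_zero (𝕜 := ℝ).mp ?_)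
      have : ξ ∈ Submodule.span ℝ (D.Λ : Set Z) := by rw [D.span_Λ]; trivial
      refine Submodule.span_induction (p := fun x _ => inner ℝ x ξ = 0) (fun x hx => hcon ⟨x, hx⟩)
        (by simp) (fun x y _ _ hx hy => by rw [inner_add_left, hx, hy, add_zero])
        (fun c x _ hx => by rw [inner_smul_left, hx, mul_zero]) this
    obtain ⟨v, hv⟩ := h4
    refine ⟨(v, 0), fun h => hv (by rw [show v = 0 from h]; simp), fun t ht => ?_⟩
    exfalso
    have h2 : D.torusAct hq w t v = t v := by rw [ht]
    have h3 : (⟨g⁻¹ (v : Z), D.W₀_mem_Λ (D.W₀.inv_mem w.2.1) _ v.2⟩ : D.Λ) = v :=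
      Subtype.ext (h1 v)
    change qpow hq (inner ℝ (v : Z) ξ) * t ⟨g⁻¹ (v : Z), _⟩ = t v at h2
    rw [h3, mul_eq_right] at h2
    have h5 : ((q ^ (inner ℝ (v : Z) ξ) : ℝ) : ℂ) = 1 := congrArg Units.val h2
    have h6 : q ^ (inner ℝ (v : Z) ξ) = 1 := by exact_mod_cast h5
    have h7 := congrArg Real.log h6
    rw [Real.log_rpow hq, Real.log_one] at h7
    exact hv ((mul_eq_zero.mp h7).resolve_right (Real.log_ne_zero_of_pos_of_ne_one hq hq1))

/-- A nonzero regular function does not vanish at all generic points. -/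
theorem exists_isGeneric [FiniteDimensional ℝ Z] (hq1 : q ≠ 1) {B : Fin (n + 1) → Set ℂ}
    (hB : ∀ i, (B i).Countable) {p : D.Torus → ℂ} (hp : p ∈ D.regular) (hp0 : p ≠ 0) :
    ∃ t, p t ≠ 0 ∧ D.IsGeneric hq B t := by
  have := D.countable_W
  choose! f hf0 hf using fun (w : D.W) (hw : w ≠ 1) => D.exists_of_torusAct_eq hq hq1 hw
  let a : D.W → Fin (n + 1) → ℝ × Z := fun w i => D.act w⁻¹ (D.Δ i)
  have haR : ∀ w i, a w i ∈ D.Rred := fun w i => D.act_mem_Rred _ (D.Δ_mem_Rred i)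
  let e : D.W → Fin (n + 1) → ℂ → D.Λ × ℂ := fun w i b =>
    (⟨(a w i).2, D.Rred_snd_mem_Λ (haR w i)⟩, ((qpow hq (a w i).1)⁻¹ : ℂˣ) * b)
  let S₁ : Set (D.Λ × ℂ) := f '' {w | w ≠ 1}
  let S₂ : Set (D.Λ × ℂ) := ⋃ w : D.W, ⋃ i : Fin (n + 1), (e w i) '' B i
  have hS : (S₁ ∪ S₂).Countable := (Set.to_countable _ |>.image _).union
    (Set.countable_iUnion fun w => Set.countable_iUnion fun i => (hB i).image _)
  have hS0 : ∀ x ∈ S₁ ∪ S₂, x.1 ≠ 0 := by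
    rintro x (⟨w, hw, rfl⟩ | hx)
    · exact hf0 w hw
    · obtain ⟨w, hx⟩ := Set.mem_iUnion.mp hx
      obtain ⟨i, b, -, rfl⟩ := Set.mem_iUnion.mp hx
      exact fun h => D.snd_ne_zero (haR w i) (congrArg Subtype.val h)
  obtain ⟨t, ht, hSt⟩ := D.exists_point hS hS0 hp hp0
  refine ⟨t, ht, fun w i hb => ?_, fun v w h => ?_⟩
  · refine hSt (e w i _) (Or.inr (Set.mem_iUnion.mpr ⟨w, Set.mem_iUnion.mpr ⟨i, _, hb, rfl⟩⟩)) ?_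
    rw [simpleEval, evalAff_torusAct]
    simp only [e, chi, evalAff]
    rw [← Units.val_mul]
    exact congrArg Units.val (inv_mul_cancel_left (qpow hq (a w i).1) _).symm
  · by_contra hne
    have h1 : w⁻¹ * v ≠ 1 := fun h2 => hne (inv_mul_eq_one.mp h2).symm
    refine hSt (f (w⁻¹ * v)) (Or.inl ⟨_, h1, rfl⟩) (hf _ h1 t ?_)
    rw [torusAct_mul, h, ← torusAct_mul, inv_mul_cancel, torusAct_one]

/-- Endomorphisms of the space of regular functions can be compared at generic points. -/
theorem end_ext_of_isGeneric [FiniteDimensional ℝ Z] (hq1 : q ≠ 1) {B : Fin (n + 1) → Set ℂ}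
    (hB : ∀ i, (B i).Countable) {F G : Module.End ℂ D.regular}
    (h : ∀ p t, D.IsGeneric hq B t → (F p : D.Torus → ℂ) t = (G p : D.Torus → ℂ) t) : F = G := by
  refine LinearMap.ext fun p => Subtype.ext ?_
  by_contra hne
  obtain ⟨t, ht, hg⟩ := D.exists_isGeneric hq hq1 hB (p := (F p : D.Torus → ℂ) - G p)
    (sub_mem (F p).2 (G p).2) (sub_ne_zero.mpr hne)
  exact ht (by rw [Pi.sub_apply, h p t hg, sub_self])

end InitialData

/-! ### Braid relations for Demazure–Lusztig operators -/

section Braid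

variable {X : Type*}

/-- The Demazure–Lusztig operator `f ↦ b f + (κ - b) (f ∘ s)` on functions on a set `X`. -/
def lusztigOp (κ : ℂ) (b : X → ℂ) (s : X → X) (f : X → ℂ) (t : X) : ℂ :=
  b t * f t + (κ - b t) * f (s t)

/-- The functional equation of `x ↦ 1 / (1 - x)`. -/
theorem mul_eq_of_mul_one_sub_eq_one {x y a b c : ℂ} (ha : a * (1 - x) = 1) (hb : b * (1 - y) = 1)
    (hc : c * (1 - x * y) = 1) : a * b = c * (a + b - 1) := by
  have h : a * b * (1 - x * y) = a + b - 1 := by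
    linear_combination (b * y) * ha + (a - 1) * hb
  rw [← h]; linear_combination (-(a * b)) * hc

/-- The values `1 / (1 - t^α)` at the positive roots `α` of the root system `G₂`: if `u = t^α`
and `v = t^β` for the short simple root `α` and the long simple root `β`, then `a₁, a₂, a₃` belong
to the short roots `α, 2α + β, α + β`, and `d₁, d₂, d₃` to the long roots
`β, 3α + β, 3α + 2β`. -/
structure IsG2Family (u v a₁ a₂ a₃ d₁ d₂ d₃ : ℂ) : Prop where
  a₁ : a₁ * (1 - u) = 1
  a₂ : a₂ * (1 - u ^ 2 * v) = 1
  a₃ : a₃ * (1 - u * v) = 1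
  d₁ : d₁ * (1 - v) = 1
  d₂ : d₂ * (1 - u ^ 3 * v) = 1
  d₃ : d₃ * (1 - u ^ 3 * v ^ 2) = 1

namespace IsG2Family

variable {u v a₁ a₂ a₃ d₁ d₂ d₃ : ℂ}

theorem short (h : IsG2Family u v a₁ a₂ a₃ d₁ d₂ d₃) :
    a₁ * a₃ = a₂ * (a₁ + a₃ - 1) :=
  mul_eq_of_mul_one_sub_eq_one h.a₁ h.a₃ (by linear_combination h.a₂)

theorem long (h : IsG2Family u v a₁ a₂ a₃ d₁ d₂ d₃) :
    d₁ * d₂ = d₃ * (d₁ + d₂ - 1) :=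
  mul_eq_of_mul_one_sub_eq_one h.d₁ h.d₂ (by linear_combination h.d₃)

theorem mixed (h : IsG2Family u v a₁ a₂ a₃ d₁ d₂ d₃) :
    -a₁ * d₁ + a₁ * d₂ + a₂ * d₂ + a₂ * d₃ - a₂ + a₃ * d₁ + a₃ * d₃ - a₃ - d₂ - d₃ = 0 := by
  obtain ⟨h1, h2, h3, g1, g2, g3⟩ := h
  have h1' := right_ne_zero_of_mul_eq_one h1
  have h2' := right_ne_zero_of_mul_eq_one h2
  have h3' := right_ne_zero_of_mul_eq_one h3
  have g1' := right_ne_zero_of_mul_eq_one g1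
  have g2' := right_ne_zero_of_mul_eq_one g2
  have g3' := right_ne_zero_of_mul_eq_one g3
  rw [eq_inv_of_mul_eq_one_left h1, eq_inv_of_mul_eq_one_left h2, eq_inv_of_mul_eq_one_left h3,
    eq_inv_of_mul_eq_one_left g1, eq_inv_of_mul_eq_one_left g2, eq_inv_of_mul_eq_one_left g3]
  field_simp
  ring

/-- This relation and the five that follow compare the two sides of the braid relation of length
six, at the evaluations of `f` at points reached by at most two reflections. Each polynomial below
is a factor of a term in the difference of the two coefficients of such an evaluation; the remaining
terms are multiples of `short` and `long`. The polynomials vanish because the `aᵢ` and `dᵢ` are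
explicit rational functions of `u` and `v`. -/
theorem coeff_s₁s₂ (h : IsG2Family u v a₁ a₂ a₃ d₁ d₂ d₃) :
    a₁ ^ 2 * d₁ ^ 2 - 2 * a₁ ^ 2 * d₁ * d₂ + a₁ ^ 2 * d₂ ^ 2 - a₁ * a₂ * d₁ ^ 2 + a₁ * a₂ * d₁ +
    2 * a₁ * a₂ * d₂ ^ 2 - 2 * a₁ * a₂ * d₂ - a₁ * a₃ * d₁ ^ 2 + a₁ * a₃ * d₁ + 2 * a₁ * d₁ * d₂ -
    2 * a₁ * d₂ ^ 2 + a₂ ^ 2 * d₁ * d₂ + a₂ ^ 2 * d₁ * d₃ - a₂ ^ 2 * d₁ + a₂ ^ 2 * d₂ ^ 2 +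
    a₂ ^ 2 * d₂ * d₃ - 2 * a₂ ^ 2 * d₂ - a₂ ^ 2 * d₃ + a₂ ^ 2 + a₂ * a₃ * d₁ ^ 2 - a₂ * a₃ * d₁ -
    a₂ * d₁ * d₂ - a₂ * d₁ * d₃ - 2 * a₂ * d₂ ^ 2 - a₂ * d₂ * d₃ + 2 * a₂ * d₂ + a₂ * d₃ +
    d₂ ^ 2 = 0 := by
  obtain ⟨h1, h2, h3, g1, g2, g3⟩ := h
  have h1' := right_ne_zero_of_mul_eq_one h1
  have h2' := right_ne_zero_of_mul_eq_one h2
  have h3' := right_ne_zero_of_mul_eq_one h3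
  have g1' := right_ne_zero_of_mul_eq_one g1
  have g2' := right_ne_zero_of_mul_eq_one g2
  have g3' := right_ne_zero_of_mul_eq_one g3
  rw [eq_inv_of_mul_eq_one_left h1, eq_inv_of_mul_eq_one_left h2, eq_inv_of_mul_eq_one_left h3,
    eq_inv_of_mul_eq_one_left g1, eq_inv_of_mul_eq_one_left g2, eq_inv_of_mul_eq_one_left g3]
  field_simp
  ring

theorem coeff_s₂s₁ (h : IsG2Family u v a₁ a₂ a₃ d₁ d₂ d₃) :
    -a₁ ^ 2 * d₁ ^ 2 + a₁ ^ 2 * d₁ * d₂ + a₁ ^ 2 * d₁ * d₃ - a₁ ^ 2 * d₂ * d₃ - a₁ * a₂ * d₃ ^ 2 +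
    a₁ * a₂ * d₃ + 2 * a₁ * a₃ * d₁ ^ 2 - 2 * a₁ * a₃ * d₁ - a₁ * a₃ * d₃ ^ 2 + a₁ * a₃ * d₃ -
    a₁ * d₁ * d₂ - a₁ * d₁ * d₃ + a₁ * d₂ * d₃ + a₁ * d₃ ^ 2 - a₂ * a₃ * d₃ ^ 2 + a₂ * a₃ * d₃ +
    a₂ * d₃ ^ 2 - a₂ * d₃ - a₃ ^ 2 * d₁ ^ 2 - 2 * a₃ ^ 2 * d₁ * d₃ + 2 * a₃ ^ 2 * d₁ -
    a₃ ^ 2 * d₃ ^ 2 + 2 * a₃ ^ 2 * d₃ - a₃ ^ 2 + 2 * a₃ * d₁ * d₃ + 2 * a₃ * d₃ ^ 2 -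
    2 * a₃ * d₃ - d₃ ^ 2 = 0 := by
  obtain ⟨h1, h2, h3, g1, g2, g3⟩ := h
  have h1' := right_ne_zero_of_mul_eq_one h1
  have h2' := right_ne_zero_of_mul_eq_one h2
  have h3' := right_ne_zero_of_mul_eq_one h3
  have g1' := right_ne_zero_of_mul_eq_one g1
  have g2' := right_ne_zero_of_mul_eq_one g2
  have g3' := right_ne_zero_of_mul_eq_one g3
  rw [eq_inv_of_mul_eq_one_left h1, eq_inv_of_mul_eq_one_left h2, eq_inv_of_mul_eq_one_left h3,
    eq_inv_of_mul_eq_one_left g1, eq_inv_of_mul_eq_one_left g2, eq_inv_of_mul_eq_one_left g3]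
  field_simp
  ring

theorem coeff_s₁ (h : IsG2Family u v a₁ a₂ a₃ d₁ d₂ d₃) :
    2 * a₁ * a₂ * d₁ - 2 * a₁ * a₂ * d₂ - 2 * a₁ * a₃ * d₁ + 2 * a₁ * a₃ * d₂ - a₂ ^ 2 * d₂ -
    a₂ ^ 2 * d₃ + a₂ ^ 2 - a₂ * d₁ + 2 * a₂ * d₂ + a₂ * d₃ + a₃ ^ 2 * d₁ + a₃ ^ 2 * d₃ - a₃ ^ 2 -
    a₃ * d₂ - a₃ * d₃ = 0 := by
  obtain ⟨h1, h2, h3, g1, g2, g3⟩ := h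
  have h1' := right_ne_zero_of_mul_eq_one h1
  have h2' := right_ne_zero_of_mul_eq_one h2
  have h3' := right_ne_zero_of_mul_eq_one h3
  have g1' := right_ne_zero_of_mul_eq_one g1
  have g2' := right_ne_zero_of_mul_eq_one g2
  have g3' := right_ne_zero_of_mul_eq_one g3
  rw [eq_inv_of_mul_eq_one_left h1, eq_inv_of_mul_eq_one_left h2, eq_inv_of_mul_eq_one_left h3,
    eq_inv_of_mul_eq_one_left g1, eq_inv_of_mul_eq_one_left g2, eq_inv_of_mul_eq_one_left g3]
  field_simp
  ring

theorem coeff_s₁_low (h : IsG2Family u v a₁ a₂ a₃ d₁ d₂ d₃) :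
    -a₁ ^ 2 * d₁ ^ 3 + 3 * a₁ ^ 2 * d₁ ^ 2 * d₂ - 3 * a₁ ^ 2 * d₁ * d₂ ^ 2 + a₁ ^ 2 * d₂ ^ 3 -
    2 * a₁ * a₂ * d₁ * d₂ ^ 2 + 2 * a₁ * a₂ * d₁ * d₂ + 2 * a₁ * a₂ * d₂ ^ 3 -
    2 * a₁ * a₂ * d₂ ^ 2 + 2 * a₁ * a₃ * d₁ ^ 3 - 2 * a₁ * a₃ * d₁ ^ 2 * d₂ -
    2 * a₁ * a₃ * d₁ ^ 2 + 2 * a₁ * a₃ * d₁ * d₂ - 2 * a₁ * d₁ ^ 2 * d₂ + 4 * a₁ * d₁ * d₂ ^ 2 -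
    2 * a₁ * d₂ ^ 3 + a₂ ^ 2 * d₂ ^ 3 + a₂ ^ 2 * d₂ ^ 2 * d₃ - 2 * a₂ ^ 2 * d₂ ^ 2 -
    a₂ ^ 2 * d₂ * d₃ + a₂ ^ 2 * d₂ + a₂ * d₁ * d₂ ^ 2 - a₂ * d₁ * d₂ - 2 * a₂ * d₂ ^ 3 -
    a₂ * d₂ ^ 2 * d₃ + 2 * a₂ * d₂ ^ 2 + a₂ * d₂ * d₃ - a₃ ^ 2 * d₁ ^ 3 - a₃ ^ 2 * d₁ ^ 2 * d₃ +
    2 * a₃ ^ 2 * d₁ ^ 2 + a₃ ^ 2 * d₁ * d₃ - a₃ ^ 2 * d₁ + a₃ * d₁ ^ 2 * d₂ + a₃ * d₁ ^ 2 * d₃ -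
    a₃ * d₁ * d₂ - a₃ * d₁ * d₃ - d₁ * d₂ ^ 2 + d₂ ^ 3 = 0 := by
  obtain ⟨h1, h2, h3, g1, g2, g3⟩ := h
  have h1' := right_ne_zero_of_mul_eq_one h1
  have h2' := right_ne_zero_of_mul_eq_one h2
  have h3' := right_ne_zero_of_mul_eq_one h3
  have g1' := right_ne_zero_of_mul_eq_one g1
  have g2' := right_ne_zero_of_mul_eq_one g2
  have g3' := right_ne_zero_of_mul_eq_one g3
  rw [eq_inv_of_mul_eq_one_left h1, eq_inv_of_mul_eq_one_left h2, eq_inv_of_mul_eq_one_left h3,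
    eq_inv_of_mul_eq_one_left g1, eq_inv_of_mul_eq_one_left g2, eq_inv_of_mul_eq_one_left g3]
  field_simp
  ring

theorem coeff_s₂ (h : IsG2Family u v a₁ a₂ a₃ d₁ d₂ d₃) :
    2 * a₁ * d₁ * d₂ - 2 * a₁ * d₁ * d₃ - a₁ * d₂ ^ 2 + a₁ * d₃ - a₂ * d₂ ^ 2 + a₂ * d₂ +
    a₂ * d₃ ^ 2 - a₂ * d₃ - 2 * a₃ * d₁ * d₂ + 2 * a₃ * d₁ * d₃ + a₃ * d₂ + a₃ * d₃ ^ 2 -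
    2 * a₃ * d₃ + d₂ ^ 2 - d₃ ^ 2 = 0 := by
  obtain ⟨h1, h2, h3, g1, g2, g3⟩ := h
  have h1' := right_ne_zero_of_mul_eq_one h1
  have h2' := right_ne_zero_of_mul_eq_one h2
  have h3' := right_ne_zero_of_mul_eq_one h3
  have g1' := right_ne_zero_of_mul_eq_one g1
  have g2' := right_ne_zero_of_mul_eq_one g2
  have g3' := right_ne_zero_of_mul_eq_one g3
  rw [eq_inv_of_mul_eq_one_left h1, eq_inv_of_mul_eq_one_left h2, eq_inv_of_mul_eq_one_left h3,
    eq_inv_of_mul_eq_one_left g1, eq_inv_of_mul_eq_one_left g2, eq_inv_of_mul_eq_one_left g3]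
  field_simp
  ring

theorem coeff_s₂_low (h : IsG2Family u v a₁ a₂ a₃ d₁ d₂ d₃) :
    a₁ ^ 3 * d₁ ^ 2 - 2 * a₁ ^ 3 * d₁ * d₂ + a₁ ^ 3 * d₂ ^ 2 + a₁ ^ 2 * a₂ * d₂ ^ 2 -
    a₁ ^ 2 * a₂ * d₂ - 3 * a₁ ^ 2 * a₃ * d₁ ^ 2 + 2 * a₁ ^ 2 * a₃ * d₁ * d₂ +
    2 * a₁ ^ 2 * a₃ * d₁ - a₁ ^ 2 * a₃ * d₂ + 2 * a₁ ^ 2 * d₁ * d₂ - 2 * a₁ ^ 2 * d₂ ^ 2 -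
    a₁ * a₂ * d₂ ^ 2 + a₁ * a₂ * d₂ + 3 * a₁ * a₃ ^ 2 * d₁ ^ 2 + 2 * a₁ * a₃ ^ 2 * d₁ * d₃ -
    4 * a₁ * a₃ ^ 2 * d₁ - a₁ * a₃ ^ 2 * d₃ + a₁ * a₃ ^ 2 - 2 * a₁ * a₃ * d₁ * d₂ -
    2 * a₁ * a₃ * d₁ * d₃ + a₁ * a₃ * d₂ + a₁ * a₃ * d₃ + a₁ * d₂ ^ 2 - a₂ * a₃ ^ 2 * d₃ ^ 2 +
    a₂ * a₃ ^ 2 * d₃ + a₂ * a₃ * d₃ ^ 2 - a₂ * a₃ * d₃ - a₃ ^ 3 * d₁ ^ 2 - 2 * a₃ ^ 3 * d₁ * d₃ +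
    2 * a₃ ^ 3 * d₁ - a₃ ^ 3 * d₃ ^ 2 + 2 * a₃ ^ 3 * d₃ - a₃ ^ 3 + 2 * a₃ ^ 2 * d₁ * d₃ +
    2 * a₃ ^ 2 * d₃ ^ 2 - 2 * a₃ ^ 2 * d₃ - a₃ * d₃ ^ 2 = 0 := by
  obtain ⟨h1, h2, h3, g1, g2, g3⟩ := h
  have h1' := right_ne_zero_of_mul_eq_one h1
  have h2' := right_ne_zero_of_mul_eq_one h2
  have h3' := right_ne_zero_of_mul_eq_one h3
  have g1' := right_ne_zero_of_mul_eq_one g1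
  have g2' := right_ne_zero_of_mul_eq_one g2
  have g3' := right_ne_zero_of_mul_eq_one g3
  rw [eq_inv_of_mul_eq_one_left h1, eq_inv_of_mul_eq_one_left h2, eq_inv_of_mul_eq_one_left h3,
    eq_inv_of_mul_eq_one_left g1, eq_inv_of_mul_eq_one_left g2, eq_inv_of_mul_eq_one_left g3]
  field_simp
  ring

end IsG2Family

variable {K L : ℂ} {b₁ b₂ : X → ℂ} {s₁ s₂ : X → X}

theorem lusztigOp_braid_two (h12 : ∀ t, s₁ (s₂ t) = s₂ (s₁ t)) (hb₁ : ∀ t, b₁ (s₂ t) = b₁ t)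
    (hb₂ : ∀ t, b₂ (s₁ t) = b₂ t) (f : X → ℂ) :
    lusztigOp K b₁ s₁ (lusztigOp L b₂ s₂ f) = lusztigOp L b₂ s₂ (lusztigOp K b₁ s₁ f) := by
  ext t
  simp only [lusztigOp, hb₁, hb₂, h12]
  ring

variable {x y : X → ℂ}

/-- The functional equation of `x ↦ 1 / (1 - x)` under `x ↦ x⁻¹`. -/
theorem inv_one_sub_inv {z : ℂ} (hz : z ≠ 0) (h : 1 - z ≠ 0) :
    (1 - z⁻¹)⁻¹ = 1 - (1 - z)⁻¹ := by
  have : z - 1 ≠ 0 := fun h' => h (by linear_combination -h')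
  field_simp
  ring

/-- The braid relation of length `3`.  The roots `α`, `β`, `α + β` contribute `b₁ t`, `b₂ t` and
`b₁ (s₂ t)`, and the relation is the functional equation of `x ↦ 1 / (1 - x)`. -/
theorem lusztigOp_braid_three {k : ℂ} (h1 : ∀ t, s₁ (s₁ t) = t) (h2 : ∀ t, s₂ (s₂ t) = t)
    (h12 : ∀ t, s₁ (s₂ (s₁ t)) = s₂ (s₁ (s₂ t)))
    (hx0 : ∀ t, x t ≠ 0) (hx : ∀ t, 1 - x t ≠ 0) (hy0 : ∀ t, y t ≠ 0) (hy : ∀ t, 1 - y t ≠ 0)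
    (hx1 : ∀ t, x (s₁ t) = (x t)⁻¹) (hx2 : ∀ t, x (s₂ t) = x t * y t)
    (hy1 : ∀ t, y (s₁ t) = y t * x t) (hy2 : ∀ t, y (s₂ t) = (y t)⁻¹)
    (hb₁ : ∀ t, b₁ t = k * (1 - x t)⁻¹) (hb₂ : ∀ t, b₂ t = k * (1 - y t)⁻¹) (f : X → ℂ) :
    lusztigOp K b₁ s₁ (lusztigOp K b₂ s₂ (lusztigOp K b₁ s₁ f)) =
      lusztigOp K b₂ s₂ (lusztigOp K b₁ s₁ (lusztigOp K b₂ s₂ f)) := by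
  have hb₁' : ∀ t, b₁ (s₁ t) = k - b₁ t := fun t => by
    rw [hb₁, hb₁, hx1, inv_one_sub_inv (hx0 t) (hx t)]; ring
  have hb₂' : ∀ t, b₂ (s₂ t) = k - b₂ t := fun t => by
    rw [hb₂, hb₂, hy2, inv_one_sub_inv (hy0 t) (hy t)]; ring
  ext t
  have hxy : 1 - x t * y t ≠ 0 := by rw [← hx2]; exact hx _
  have e1 : b₂ (s₁ t) = b₁ (s₂ t) := by rw [hb₁, hb₂, hx2, hy1, mul_comm (y t)]
  have e2 : b₁ (s₂ (s₁ t)) = b₂ t := by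
    rw [hb₁, hb₂, hx2, hx1, hy1, mul_comm (y t), inv_mul_cancel_left₀ (hx0 t)]
  have e3 : b₂ (s₁ (s₂ t)) = b₁ t := by
    rw [hb₁, hb₂, hy1, hy2, hx2, mul_comm (x t), inv_mul_cancel_left₀ (hy0 t)]
  have hrel : b₁ t * b₂ t = b₁ (s₂ t) * (b₁ t + b₂ t - k) := by
    have := mul_eq_of_mul_one_sub_eq_one (inv_mul_cancel₀ (hx t)) (inv_mul_cancel₀ (hy t))
      (inv_mul_cancel₀ hxy)
    rw [hb₁, hb₁, hb₂, hx2]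
    linear_combination k ^ 2 * this
  simp only [lusztigOp, h1, h2, hb₁', hb₂', e1, e2, e3, h12]
  linear_combination ((K - b₁ t) * f (s₁ t) - (K - b₂ t) * f (s₂ t) + (b₁ t - b₂ t) * f t) * hrel

/-- The braid relation of length `4`.  The roots `α`, `α + β` contribute `b₁ t`, `b₁ (s₂ t)`, the
roots `β`, `2α + β` contribute `b₂ t`, `b₂ (s₁ t)`, and all coefficients of the difference of the
two sides are multiples of a single expression `E` in these four quantities, which vanishes. -/
theorem lusztigOp_braid_four {k k' l : ℂ} (h1 : ∀ t, s₁ (s₁ t) = t) (h2 : ∀ t, s₂ (s₂ t) = t)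
    (h12 : ∀ t, s₁ (s₂ (s₁ (s₂ t))) = s₂ (s₁ (s₂ (s₁ t))))
    (hx0 : ∀ t, x t ≠ 0) (hx : ∀ t, 1 - x t ^ 2 ≠ 0)
    (hy0 : ∀ t, y t ≠ 0) (hy : ∀ t, 1 - y t ≠ 0)
    (hx1 : ∀ t, x (s₁ t) = (x t)⁻¹) (hx2 : ∀ t, x (s₂ t) = x t * y t)
    (hy1 : ∀ t, y (s₁ t) = y t * x t ^ 2) (hy2 : ∀ t, y (s₂ t) = (y t)⁻¹)
    (hb₁ : ∀ t, b₁ t = (k + k' * x t) / (1 - x t ^ 2)) (hb₂ : ∀ t, b₂ t = l * (1 - y t)⁻¹)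
    (f : X → ℂ) :
    lusztigOp K b₁ s₁ (lusztigOp L b₂ s₂ (lusztigOp K b₁ s₁ (lusztigOp L b₂ s₂ f))) =
      lusztigOp L b₂ s₂ (lusztigOp K b₁ s₁ (lusztigOp L b₂ s₂ (lusztigOp K b₁ s₁ f))) := by
  have hb₁' : ∀ t, b₁ (s₁ t) = k - b₁ t := fun t => by
    have h := hx t
    have h' : x t ^ 2 - 1 ≠ 0 := fun h' => h (by linear_combination -h')
    have h0 := hx0 t
    rw [hb₁, hb₁, hx1]
    field_simp
    ring
  have hb₂' : ∀ t, b₂ (s₂ t) = l - b₂ t := fun t => by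
    rw [hb₂, hb₂, hy2, inv_one_sub_inv (hy0 t) (hy t)]; ring
  ext t
  have hx0' := hx0 t
  have hy0' := hy0 t
  have e1 : b₁ (s₂ (s₁ t)) = b₁ (s₂ t) := by
    have : x (s₂ (s₁ t)) = x (s₂ t) := by
      simp only [hx1, hx2, hy1]; field_simp
    rw [hb₁, hb₁, this]
  have e2 : b₁ (s₂ (s₁ (s₂ t))) = b₁ t := by
    have : x (s₂ (s₁ (s₂ t))) = x t := by
      simp only [hx1, hx2, hy1, hy2]; field_simp
    rw [hb₁, hb₁, this]
  have e3 : b₂ (s₁ (s₂ t)) = b₂ (s₁ t) := by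
    have : y (s₁ (s₂ t)) = y (s₁ t) := by
      simp only [hx2, hy1, hy2]; field_simp
    rw [hb₂, hb₂, this]
  have e4 : b₂ (s₁ (s₂ (s₁ t))) = b₂ t := by
    have : y (s₁ (s₂ (s₁ t))) = y t := by
      simp only [hx1, hx2, hy1, hy2]; field_simp
    rw [hb₂, hb₂, this]
  have hE : b₁ t * b₂ t - b₁ t * b₂ (s₁ t) - b₁ (s₂ t) * b₂ t - b₁ (s₂ t) * b₂ (s₁ t)
      + b₁ (s₂ t) * l + b₂ (s₁ t) * k = 0 := by
    have g1 := hx t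
    have g2 := hx (s₂ t)
    have g3 := hy t
    have g4 := hy (s₁ t)
    rw [hb₁, hb₁, hb₂, hb₂]
    rw [hx2, mul_pow] at g2
    rw [hy1, mul_comm] at g4
    rw [hx2, hy1, mul_comm (y t)]
    field_simp
    ring
  simp only [lusztigOp, h1, h2, hb₁', hb₂', e1, e2, e3, e4, h12]
  linear_combination ((K - b₁ t) * (L - b₂ (s₁ t)) * f (s₂ (s₁ t))
    - (K - b₁ (s₂ t)) * (L - b₂ t) * f (s₁ (s₂ t))
    + (b₁ t - b₁ (s₂ t)) * (L - b₂ t) * f (s₂ t)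
    + (K - b₁ t) * (b₂ (s₁ t) - b₂ t) * f (s₁ t)) * hE

/-- The braid relation of length `6`: the coefficients of the difference of the two sides are
combinations of the expressions that vanish on every `IsG2Family`. -/
theorem lusztigOp_braid_six {k l : ℂ} (h1 : ∀ t, s₁ (s₁ t) = t) (h2 : ∀ t, s₂ (s₂ t) = t)
    (h12 : ∀ t, s₁ (s₂ (s₁ (s₂ (s₁ (s₂ t))))) = s₂ (s₁ (s₂ (s₁ (s₂ (s₁ t))))))
    (hx0 : ∀ t, x t ≠ 0) (hx : ∀ t, 1 - x t ≠ 0) (hy0 : ∀ t, y t ≠ 0) (hy : ∀ t, 1 - y t ≠ 0)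
    (hx1 : ∀ t, x (s₁ t) = (x t)⁻¹) (hx2 : ∀ t, x (s₂ t) = x t * y t)
    (hy1 : ∀ t, y (s₁ t) = y t * x t ^ 3) (hy2 : ∀ t, y (s₂ t) = (y t)⁻¹)
    (hb₁ : ∀ t, b₁ t = k * (1 - x t)⁻¹) (hb₂ : ∀ t, b₂ t = l * (1 - y t)⁻¹) (f : X → ℂ) :
    lusztigOp K b₁ s₁ (lusztigOp L b₂ s₂ (lusztigOp K b₁ s₁
        (lusztigOp L b₂ s₂ (lusztigOp K b₁ s₁ (lusztigOp L b₂ s₂ f))))) =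
      lusztigOp L b₂ s₂ (lusztigOp K b₁ s₁ (lusztigOp L b₂ s₂
        (lusztigOp K b₁ s₁ (lusztigOp L b₂ s₂ (lusztigOp K b₁ s₁ f))))) := by
  have hb₁' : ∀ t, b₁ (s₁ t) = k - b₁ t := fun t => by
    rw [hb₁, hb₁, hx1, inv_one_sub_inv (hx0 t) (hx t)]; ring
  have hb₂' : ∀ t, b₂ (s₂ t) = l - b₂ t := fun t => by
    rw [hb₂, hb₂, hy2, inv_one_sub_inv (hy0 t) (hy t)]; ring
  ext t
  have hx0' := hx0 t
  have hy0' := hy0 t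
  have x1 : x (s₂ (s₁ t)) = x t ^ 2 * y t := by
    simp only [hx1, hx2, hy1]; field_simp
  have x2 : x (s₂ t) = x t * y t := hx2 t
  have x3 : x (s₂ (s₁ (s₂ (s₁ t)))) = x t * y t := by
    simp only [hx1, hx2, hy1, hy2]; field_simp
  have x4 : x (s₂ (s₁ (s₂ t))) = x t ^ 2 * y t := by
    simp only [hx1, hx2, hy1, hy2]; field_simp
  have x5 : x (s₂ (s₁ (s₂ (s₁ (s₂ t))))) = x t := by
    simp only [hx1, hx2, hy1, hy2]; field_simp
  have y1 : y (s₁ t) = x t ^ 3 * y t := by rw [hy1, mul_comm]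
  have y2 : y (s₁ (s₂ t)) = x t ^ 3 * y t ^ 2 := by
    simp only [hx2, hy1, hy2]; field_simp
  have y3 : y (s₁ (s₂ (s₁ t))) = x t ^ 3 * y t ^ 2 := by
    simp only [hx1, hx2, hy1, hy2]; field_simp
  have y4 : y (s₁ (s₂ (s₁ (s₂ t)))) = x t ^ 3 * y t := by
    simp only [hx1, hx2, hy1, hy2]; field_simp
  have y5 : y (s₁ (s₂ (s₁ (s₂ (s₁ t))))) = y t := by
    simp only [hx1, hx2, hy1, hy2]; field_simp
  have hG : IsG2Family (x t) (y t) (1 - x t)⁻¹ (1 - x t ^ 2 * y t)⁻¹ (1 - x t * y t)⁻¹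
      (1 - y t)⁻¹ (1 - x t ^ 3 * y t)⁻¹ (1 - x t ^ 3 * y t ^ 2)⁻¹ :=
    ⟨inv_mul_cancel₀ (hx t), inv_mul_cancel₀ (x1 ▸ hx _), inv_mul_cancel₀ (x2 ▸ hx _),
      inv_mul_cancel₀ (hy t), inv_mul_cancel₀ (y1 ▸ hy _), inv_mul_cancel₀ (y2 ▸ hy _)⟩
  have e1 := hb₁ t
  have e2 := hb₁ (s₂ (s₁ t))
  have e3 := hb₁ (s₂ t)
  have e4 := hb₁ (s₂ (s₁ (s₂ (s₁ t))))
  have e5 := hb₁ (s₂ (s₁ (s₂ t)))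
  have e6 := hb₁ (s₂ (s₁ (s₂ (s₁ (s₂ t)))))
  have g1 := hb₂ t
  have g2 := hb₂ (s₁ t)
  have g3 := hb₂ (s₁ (s₂ t))
  have g4 := hb₂ (s₁ (s₂ (s₁ t)))
  have g5 := hb₂ (s₁ (s₂ (s₁ (s₂ t))))
  have g6 := hb₂ (s₁ (s₂ (s₁ (s₂ (s₁ t)))))
  rw [x1] at e2
  rw [x2] at e3
  rw [x3] at e4
  rw [x4] at e5
  rw [x5] at e6
  rw [y1] at g2
  rw [y2] at g3
  rw [y3] at g4
  rw [y4] at g5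
  rw [y5] at g6
  simp only [lusztigOp, h1, h2, hb₁', hb₂', e1, e2, e3, e4, e5, e6, g1, g2, g3, g4, g5, g6, h12]
  generalize (1 - x t)⁻¹ = a₁ at hG ⊢
  generalize (1 - x t ^ 2 * y t)⁻¹ = a₂ at hG ⊢
  generalize (1 - x t * y t)⁻¹ = a₃ at hG ⊢
  generalize (1 - y t)⁻¹ = d₁ at hG ⊢
  generalize (1 - x t ^ 3 * y t)⁻¹ = d₂ at hG ⊢
  generalize (1 - x t ^ 3 * y t ^ 2)⁻¹ = d₃ at hG ⊢
  linear_combination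
    (k * l * ((K - k * a₂) * (K - k * a₃) * (L - l * d₁) * (L - l * d₃)
          * f (s₁ (s₂ (s₁ (s₂ t))))
        - (K - k * a₁) * (K - k * a₂) * (L - l * d₂) * (L - l * d₃) * f (s₂ (s₁ (s₂ (s₁ t))))
        + (K - k * a₁) * (K - k * a₂) * (L - l * d₂) * l * (d₁ - d₃) * f (s₁ (s₂ (s₁ t)))
        - (K - k * a₃) * (L - l * d₁) * (L - l * d₃) * k * (a₁ - a₂)
          * f (s₂ (s₁ (s₂ t))))) * hG.mixed
    + (K - k * a₁) * (L - l * d₂) * f (s₂ (s₁ t)) *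
      ((K ^ 2 - K * k) * l ^ 2 * hG.long + (L ^ 2 - L * l) * k ^ 2 * hG.short
        + k ^ 2 * l ^ 2 * hG.coeff_s₁s₂)
    + (K - k * a₃) * (L - l * d₁) * f (s₁ (s₂ t)) *
      (-(K ^ 2 - K * k) * l ^ 2 * hG.long - (L ^ 2 - L * l) * k ^ 2 * hG.short
        + k ^ 2 * l ^ 2 * hG.coeff_s₂s₁)
    + (K - k * a₁) * f (s₁ t) *
      (-(K ^ 2 - K * k) * l ^ 3 * (d₁ - d₂) * hG.long + (L ^ 2 - L * l) * k ^ 2 * l * hG.coeff_s₁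
        + k ^ 2 * l ^ 3 * hG.coeff_s₁_low)
    + (L - l * d₁) * f (s₂ t) *
      ((L ^ 2 - L * l) * k ^ 3 * (a₁ - a₃) * hG.short + (K ^ 2 - K * k) * k * l ^ 2 * hG.coeff_s₂
        + k ^ 3 * l ^ 2 * hG.coeff_s₂_low)

end Braid

/-! ### Multiplicity functions on simple affine roots -/

namespace InitialData

variable {Z : Type*} [NormedAddCommGroup Z] [InnerProductSpace ℝ Z] {n : ℕ} {D : InitialData Z n}

theorem mem_S_iff {i : Fin (n + 1)} :
    i ∈ D.S ↔ ∀ v ∈ D.Λ, ∃ m : ℤ, inner ℝ v (coroot (D.Δ i).2) = 2 * (m : ℝ) := by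
  constructor
  · intro h v hv
    have h1 : inner ℝ v (coroot (D.Δ i).2) ∈ Set.range (fun m : ℤ => 2 * (m : ℝ)) :=
      (show _ = _ from h) ▸ Set.mem_image_of_mem _ hv
    obtain ⟨m, hm⟩ := h1
    exact ⟨m, hm.symm⟩
  · intro h
    refine Set.Subset.antisymm ?_ ?_
    · rintro _ ⟨v, hv, rfl⟩
      obtain ⟨m, hm⟩ := h v hv
      exact ⟨m, hm.symm⟩
    · rintro _ ⟨m, rfl⟩
      refine ⟨m • (D.Δ i).2, D.Λ.smul_mem m (D.Rred_snd_mem_Λ (D.Δ_mem_Rred i)), ?_⟩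
      simp only [← Int.cast_smul_eq_zsmul ℝ, inner_smul_left, conj_trivial]
      rw [real_inner_comm, D.inner_coroot_Δ_self, mul_comm]

theorem mem_S_of_act {w : D.W} {i j : Fin (n + 1)} (h : D.act w (D.Δ j) = D.Δ i) (hj : j ∈ D.S) :
    i ∈ D.S := by
  refine mem_S_iff.mpr fun v hv => ?_
  set g := (w : Z ≃ᵃⁱ[ℝ] Z).linearIsometryEquiv with hg
  have hg' : D.W₀.carrier g := w.2.1
  obtain ⟨m, hm⟩ := mem_S_iff.mp hj (g⁻¹ v) (D.W₀_mem_Λ (D.W₀.inv_mem hg') v hv)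
  refine ⟨m, ?_⟩
  have h1 : (D.Δ i).2 = g (D.Δ j).2 := by rw [← h]; rfl
  have h2 : g (g⁻¹ v) = v := g.apply_symm_apply v
  rw [← hm, h1, coroot_map, ← g.inner_map_map (g⁻¹ v), h2]

theorem Wred_le_W (D : InitialData Z n) : D.Wred ≤ D.W := by
  refine (Subgroup.closure_le _).mpr ?_
  rintro _ ⟨a, ha, rfl⟩
  exact D.affRefl_mem_W ha

theorem two_smul_Δ_mem_R_iff {i : Fin (n + 1)} : (2 : ℝ) • D.Δ i ∈ D.R ↔ i ∈ D.S := by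
  constructor
  · rintro (h | ⟨j, hj, w, hw, h⟩)
    · have h1 := D.snd_mem_R₀ h
      rcases D.isRootSystem.reduced _ (D.snd_mem_R₀ (D.Δ_mem_Rred i)) 2 h1 with h2 | h2 <;>
        norm_num at h2
    · rw [affAct_smul] at h
      have h1 := smul_right_injective (ℝ × Z) (two_ne_zero (α := ℝ)) h
      exact mem_S_of_act (w := ⟨w, D.Wred_le_W hw⟩) h1.symm hj
  · intro h
    exact Or.inr ⟨i, h, 1, D.Wred.one_mem, (affAct_one _).symm⟩

theorem notMem_S_of_odd {i j : Fin (n + 1)} (h : Odd (D.cartan i j)) : i ∉ D.S := by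
  intro hi
  obtain ⟨m, hm⟩ := mem_S_iff.mp hi _ (D.Rred_snd_mem_Λ (D.Δ_mem_Rred j))
  rw [real_inner_comm, inner_coroot_Δ] at hm
  have h1 : D.cartan i j = 2 * m := by exact_mod_cast hm
  exact (Int.not_even_iff_odd.mpr h) ⟨m, by rw [h1]; ring⟩

namespace Multiplicity

variable (κ : D.Multiplicity)

/-- The value `κ_{aᵢ}` as a complex number. -/
def val (i : Fin (n + 1)) : ℂ := κ.toFun (D.simpleRoot i)

/-- The value `κ_{2aᵢ}`, which is `κ_{aᵢ}` if `2aᵢ ∉ R`. -/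
def val₂ (i : Fin (n + 1)) : ℂ := κ.double (D.simpleRoot i)

theorem val_ne_zero (i : Fin (n + 1)) : κ.val i ≠ 0 := Units.ne_zero _

theorem val_eq_of_act {w : D.W} {i j : Fin (n + 1)} (h : D.act w (D.Δ i) = D.Δ j) :
    κ.val j = κ.val i :=
  congrArg Units.val (κ.invariant w w.2 (D.simpleRoot i) (D.simpleRoot j) h.symm)

theorem val₂_eq_of_notMem {i : Fin (n + 1)} (h : i ∉ D.S) : κ.val₂ i = κ.val i :=
  dif_neg (fun h' => h (two_smul_Δ_mem_R_iff.mp h'))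

theorem val₂_eq_of_act {w : D.W} {i j : Fin (n + 1)} (h : D.act w (D.Δ i) = D.Δ j) :
    κ.val₂ j = κ.val₂ i := by
  by_cases hi : i ∈ D.S
  · have hj := mem_S_of_act h hi
    have h1 : κ.val₂ i = κ.toFun ⟨_, two_smul_Δ_mem_R_iff.mpr hi⟩ :=
      dif_pos (two_smul_Δ_mem_R_iff.mpr hi)
    have h2 : κ.val₂ j = κ.toFun ⟨_, two_smul_Δ_mem_R_iff.mpr hj⟩ :=
      dif_pos (two_smul_Δ_mem_R_iff.mpr hj)
    rw [h1, h2]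
    refine congrArg Units.val (κ.invariant w w.2 _ _ ?_)
    change (2 : ℝ) • D.Δ j = D.act w ((2 : ℝ) • D.Δ i)
    rw [act_smul, h]
  · have h' : D.act w⁻¹ (D.Δ j) = D.Δ i := by rw [← h, act_inv_act]
    have hj : j ∉ D.S := fun hj => hi (mem_S_of_act h' hj)
    rw [κ.val₂_eq_of_notMem hi, κ.val₂_eq_of_notMem hj, κ.val_eq_of_act h]

/-- Two simple affine roots joined by a simple edge of the Dynkin diagram are conjugate. -/
theorem val_eq_of_cartan {i j : Fin (n + 1)} (h1 : D.cartan i j = -1) (h2 : D.cartan j i = -1) :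
    κ.val i = κ.val j := by
  refine κ.val_eq_of_act (w := D.s j * D.s i) (i := j) (j := i) ?_
  rw [act_mul, act_s_Δ, h1, show D.Δ j - ((-1 : ℤ) : ℝ) • D.Δ i = D.Δ j + D.Δ i by
    push_cast; module, act_add, act_s_self, act_s_Δ, h2]
  push_cast; module

/-- The constant term `κ_{aᵢ} - κ_{aᵢ}⁻¹` of the numerator of the basic representation. -/
def diff (i : Fin (n + 1)) : ℂ := κ.val i - (κ.val i)⁻¹

/-- The coefficient `κ_{2aᵢ} - κ_{2aᵢ}⁻¹` in the numerator of the basic representation. -/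
def diff₂ (i : Fin (n + 1)) : ℂ := κ.val₂ i - (κ.val₂ i)⁻¹

theorem diff₂_eq_of_notMem {i : Fin (n + 1)} (h : i ∉ D.S) : κ.diff₂ i = κ.diff i := by
  rw [diff₂, diff, κ.val₂_eq_of_notMem h]

end Multiplicity

/-! ### The operators of the basic representation -/

variable (D) {q : ℝ} (hq : 0 < q)

/-- `W` permutes the characters of the torus up to scalars. -/
theorem qAct_mem (w : D.W) {p : D.Torus → ℂ} (hp : p ∈ D.regular) :
    D.qAct hq w p ∈ D.regular := by
  refine D.regular_induction (P := fun p => D.qAct hq w p ∈ D.regular) (fun v => ?_)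
    D.regular.zero_mem (fun p p' h h' => D.regular.add_mem h h')
    (fun c p h => D.regular.smul_mem h c) hp
  let b := D.act (w⁻¹)⁻¹ (0, (v : Z))
  have hb : b.2 ∈ D.Λ := D.act_snd_mem_Λ _ v.2
  have h1 : D.qAct hq w (D.chi v) = (qpow hq b.1 : ℂ) • D.chi ⟨b.2, hb⟩ := by
    ext t
    rw [qAct, chi, torusAct_apply, evalAff, Units.val_mul]
    rfl
  rw [h1]
  exact D.regular.smul_mem (D.chi_mem _) _

/-- The action of `w ∈ W` on the space of regular functions. -/
def qActEnd (w : D.W) : Module.End ℂ D.regular where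
  toFun p := ⟨D.qAct hq w p, D.qAct_mem hq w p.2⟩
  map_add' _ _ := rfl
  map_smul' _ _ := rfl

theorem qActEnd_apply (w : D.W) (p : D.regular) (t : D.Torus) :
    (D.qActEnd hq w p : D.Torus → ℂ) t = (p : D.Torus → ℂ) (D.torusAct hq w⁻¹ t) := rfl

theorem qActEnd_mul (v w : D.W) : D.qActEnd hq (v * w) = D.qActEnd hq v * D.qActEnd hq w := by
  refine LinearMap.ext fun p => Subtype.ext (funext fun t => ?_)
  rw [Module.End.mul_apply, qActEnd_apply, qActEnd_apply, qActEnd_apply, mul_inv_rev, torusAct_mul]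

theorem qActEnd_one : D.qActEnd hq 1 = 1 := by
  refine LinearMap.ext fun p => Subtype.ext (funext fun t => ?_)
  rw [qActEnd_apply, inv_one, torusAct_one]; rfl

theorem simpleEval_zpow_mem (i : Fin (n + 1)) (m : ℤ) :
    (fun t => ((D.simpleEval hq i t ^ m : ℂˣ) : ℂ)) ∈ D.regular := by
  let v : D.Λ := ⟨(D.Δ i).2, D.Rred_snd_mem_Λ (D.Δ_mem_Rred i)⟩
  have h : (fun t => ((D.simpleEval hq i t ^ m : ℂˣ) : ℂ)) =
      ((qpow hq (D.Δ i).1 ^ m : ℂˣ) : ℂ) • D.chi (m • v) := by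
    ext t
    rw [simpleEval, evalAff, mul_zpow, Units.val_mul, Pi.smul_apply, smul_eq_mul, chi, torus_zsmul]
  rw [h]
  exact D.regular.smul_mem (D.chi_mem _) _

/-- The polynomial identity `1 - y ∣ 1 - y ^ m` for a family `y` of units with regular powers. -/
theorem exists_geom_sum {y : D.Torus → ℂˣ}
    (hy : ∀ m : ℤ, (fun t => ((y t ^ m : ℂˣ) : ℂ)) ∈ D.regular) (m : ℤ) :
    ∃ g ∈ D.regular, ∀ t, g t * (1 - (y t : ℂ)) = 1 - ((y t ^ m : ℂˣ) : ℂ) := by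
  have key : ∀ k : ℕ, ∃ g ∈ D.regular, ∀ t,
      g t * (1 - (y t : ℂ)) = 1 - ((y t ^ (k : ℤ) : ℂˣ) : ℂ) := by
    intro k
    refine ⟨∑ j ∈ Finset.range k, (fun t => ((y t ^ (j : ℤ) : ℂˣ) : ℂ)),
      D.regular.sum_mem fun j _ => hy j, fun t => ?_⟩
    rw [Finset.sum_apply]
    simp only [zpow_natCast, Units.val_pow_eq_pow_val]
    exact geom_sum_mul_neg _ k
  obtain ⟨k, rfl | rfl⟩ := m.eq_nat_or_neg
  · exact key k
  · obtain ⟨g, hg, h⟩ := key k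
    refine ⟨-(fun t => ((y t ^ (-k : ℤ) : ℂˣ) : ℂ)) * g,
      D.regular.mul_mem (D.regular.neg_mem (hy _)) hg, fun t => ?_⟩
    have h1 : ((y t ^ (-k : ℤ) : ℂˣ) : ℂ) * ((y t ^ (k : ℤ) : ℂˣ) : ℂ) = 1 := by
      rw [← Units.val_mul, ← zpow_add, neg_add_cancel, zpow_zero, Units.val_one]
    rw [Pi.mul_apply, mul_assoc, h t, Pi.neg_apply]
    linear_combination h1

/-- The divided differences of the basic representation preserve regularity.  If `i ∈ S`, all
exponents `m` that occur in `χ - χ ∘ sᵢ = χ (1 - x ^ (-m))` are even, so that the denominator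
`1 - x ^ 2` divides; otherwise the numerator is a multiple of `1 + x`. -/
theorem exists_dividedDifference (i : Fin (n + 1)) {k k' : ℂ} (hk : i ∉ D.S → k' = k)
    {p : D.Torus → ℂ} (hp : p ∈ D.regular) :
    ∃ g ∈ D.regular, ∀ t, g t * (1 - D.evalSimple hq i t ^ 2) =
      (k + k' * D.evalSimple hq i t) * (p t - p (D.torusAct hq (D.s i) t)) := by
  refine D.regular_induction (P := fun p => ∃ g ∈ D.regular, ∀ t,
    g t * (1 - D.evalSimple hq i t ^ 2) =
      (k + k' * D.evalSimple hq i t) * (p t - p (D.torusAct hq (D.s i) t)))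
    (fun v => ?_) ⟨0, D.regular.zero_mem, fun t => by simp⟩ ?_ ?_ hp
  · have hx : (fun t => (D.simpleEval hq i t : ℂ)) ∈ D.regular := by
      simpa using D.simpleEval_zpow_mem hq i 1
    obtain ⟨m, hm⟩ := D.exists_cartan_Λ i v
    have hv : ∀ t, D.chi v (D.torusAct hq (D.s i) t) =
        D.chi v t * ((D.simpleEval hq i t ^ (-m) : ℂˣ) : ℂ) := by
      intro t
      rw [chi, D.torusAct_s_apply hq i t v hm, Units.val_mul]; rfl
    by_cases hi : i ∈ D.S
    · obtain ⟨l, hl⟩ := mem_S_iff.mp hi v v.2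
      have hml : m = 2 * l := by
        rw [real_inner_comm, hm] at hl; exact_mod_cast hl
      obtain ⟨g, hg, h⟩ := D.exists_geom_sum (y := fun t => D.simpleEval hq i t ^ (2 : ℤ))
        (fun m => by simpa only [← zpow_mul] using D.simpleEval_zpow_mem hq i (2 * m)) (-l)
      refine ⟨(algebraMap ℂ (D.Torus → ℂ) k + k' • (fun t => (D.simpleEval hq i t : ℂ))) *
        D.chi v * g, D.regular.mul_mem (D.regular.mul_mem (D.regular.add_mem
          (D.regular.algebraMap_mem k) (D.regular.smul_mem hx k')) (D.chi_mem v)) hg, fun t => ?_⟩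
      have h1 := h t
      rw [← zpow_mul, mul_neg, ← hml] at h1
      simp only [zpow_ofNat, Units.val_pow_eq_pow_val] at h1
      rw [hv, evalSimple_eq]
      change (k + k' * (D.simpleEval hq i t : ℂ)) * D.chi v t * g t * _ = _
      linear_combination (k + k' * (D.simpleEval hq i t : ℂ)) * D.chi v t * h1
    · obtain ⟨g, hg, h⟩ := D.exists_geom_sum (y := D.simpleEval hq i)
        (D.simpleEval_zpow_mem hq i) (-m)
      refine ⟨k • (D.chi v * g), D.regular.smul_mem (D.regular.mul_mem (D.chi_mem v) hg) k,
        fun t => ?_⟩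
      rw [hv, evalSimple_eq, hk hi]
      change k * (D.chi v t * g t) * _ = _
      linear_combination k * D.chi v t * (1 + (D.simpleEval hq i t : ℂ)) * h t
  · rintro p p' ⟨g, hg, h⟩ ⟨g', hg', h'⟩
    refine ⟨g + g', D.regular.add_mem hg hg', fun t => ?_⟩
    simp only [Pi.add_apply]
    linear_combination h t + h' t
  · rintro c p ⟨g, hg, h⟩
    refine ⟨c • g, D.regular.smul_mem hg c, fun t => ?_⟩
    simp only [Pi.smul_apply, smul_eq_mul]
    linear_combination c * h t

/-- A regular function is determined by its values at the points with `t_q^{aᵢ} ≠ ±1`. -/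
theorem regular_ext_of_mul [FiniteDimensional ℝ Z] (hq1 : q ≠ 1) (i : Fin (n + 1))
    {p p' : D.Torus → ℂ} (hp : p ∈ D.regular) (hp' : p' ∈ D.regular)
    (h : ∀ t, 1 - D.evalSimple hq i t ^ 2 ≠ 0 → p t = p' t) : p = p' := by
  by_contra hne
  obtain ⟨t, ht, hg⟩ := D.exists_isGeneric hq hq1 (B := fun _ => {1, -1})
    (fun _ => (Set.toFinite _).countable) (D.regular.sub_mem hp hp') (sub_ne_zero.mpr hne)
  have h1 := hg.1 1 i
  rw [torusAct_one, ← evalSimple_eq] at h1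
  refine ht (sub_eq_zero.mpr (h t fun h0 => h1 ?_))
  have h2 : (D.evalSimple hq i t - 1) * (D.evalSimple hq i t + 1) = 0 := by
    linear_combination -h0
  rcases mul_eq_zero.mp h2 with h3 | h3
  · exact Or.inl (sub_eq_zero.mp h3)
  · exact Or.inr (eq_neg_of_add_eq_zero_left h3)

/-- The prescribed formula for `Tᵢ` defines an operator on regular functions. Divided differences
exist for each `p`, and are linear in `p` because a regular function is determined by its values
where the denominator does not vanish. -/
theorem exists_heckeEnd [FiniteDimensional ℝ Z] (hq1 : q ≠ 1) (κ : D.Multiplicity)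
    (i : Fin (n + 1)) : ∃ F : Module.End ℂ D.regular, ∀ (p : D.regular) (t : D.Torus),
      1 - D.evalSimple hq i t ^ 2 ≠ 0 → (F p : D.Torus → ℂ) t =
        κ.val i * (p : D.Torus → ℂ) (D.torusAct hq (D.s i) t) +
        (κ.diff i + κ.diff₂ i * D.evalSimple hq i t) / (1 - D.evalSimple hq i t ^ 2) *
          ((p : D.Torus → ℂ) t - (p : D.Torus → ℂ) (D.torusAct hq (D.s i) t)) := by
  choose g hg h using fun p : D.regular =>
    D.exists_dividedDifference hq i (κ.diff₂_eq_of_notMem (i := i)) p.2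
  have h' : ∀ p t, 1 - D.evalSimple hq i t ^ 2 ≠ 0 → g p t =
      (κ.diff i + κ.diff₂ i * D.evalSimple hq i t) / (1 - D.evalSimple hq i t ^ 2) *
          ((p : D.Torus → ℂ) t - (p : D.Torus → ℂ) (D.torusAct hq (D.s i) t)) := by
    intro p t ht
    rw [div_mul_eq_mul_div, eq_div_iff ht, h]
  let G : Module.End ℂ D.regular :=
    { toFun := fun p => ⟨g p, hg p⟩
      map_add' := fun p p' => Subtype.ext <| D.regular_ext_of_mul hq hq1 i (hg _)
        (D.regular.add_mem (hg p) (hg p')) fun t ht => by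
          change g (p + p') t = g p t + g p' t
          rw [h' _ t ht, h' _ t ht, h' _ t ht]
          simp only [Subalgebra.coe_add, Pi.add_apply]; ring
      map_smul' := fun c p => Subtype.ext <| D.regular_ext_of_mul hq hq1 i (hg _)
        (D.regular.smul_mem (hg p) c) fun t ht => by
          change g (c • p) t = c * g p t
          rw [h' _ t ht, h' _ t ht]
          simp only [Subalgebra.coe_smul, Pi.smul_apply, smul_eq_mul]; ring }
  refine ⟨κ.val i • D.qActEnd hq (D.s i) + G, fun p t ht => ?_⟩
  rw [← h' p t ht]
  change κ.val i * (D.qActEnd hq (D.s i) p : D.Torus → ℂ) t + g p t = _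
  rw [qActEnd_apply, s_inv]

/-- The operator by which `Tᵢ` acts on regular functions. -/
def heckeEnd [FiniteDimensional ℝ Z] (hq1 : q ≠ 1) (κ : D.Multiplicity) (i : Fin (n + 1)) :
    Module.End ℂ D.regular := (D.exists_heckeEnd hq hq1 κ i).choose

end InitialData

/-! ### Relations between the operators -/

namespace InitialData

variable {Z : Type*} [NormedAddCommGroup Z] [InnerProductSpace ℝ Z] {n : ℕ}
  (D : InitialData Z n) {q : ℝ} (hq : 0 < q) (κ : D.Multiplicity)

/-- The values of `x = t_q^{aᵢ}` at which the coefficient `(k + k' x) / (1 - x²)` has a pole or is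
equal to `κ_{aᵢ}`. -/
def exceptional (i : Fin (n + 1)) : Set ℂ :=
  {x | 1 - x ^ 2 = 0} ∪ {x | κ.val i * (1 - x ^ 2) = κ.diff i + κ.diff₂ i * x}

theorem countable_quadratic {a b c : ℂ} (ha : a ≠ 0) :
    {x : ℂ | a * x ^ 2 + b * x + c = 0}.Countable := by
  open Polynomial in
  have h0 : (C a * X ^ 2 + C b * X + C c : ℂ[X]) ≠ 0 := by
    intro h
    have := Polynomial.natDegree_quadratic (b := b) (c := c) ha
    rw [h] at this
    simp at this
  refine (Polynomial.finite_setOfPred_isRoot h0).countable.mono fun x hx => ?_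
  simpa [Polynomial.IsRoot] using hx

theorem countable_exceptional (i : Fin (n + 1)) : (D.exceptional κ i).Countable := by
  refine ((countable_quadratic (a := -1) (b := 0) (c := 1) (by simp)).mono ?_).union
    ((countable_quadratic (a := -κ.val i) (b := -κ.diff₂ i) (c := κ.val i - κ.diff i)
      (neg_ne_zero.mpr (κ.val_ne_zero i))).mono ?_)
  · intro x hx
    have : 1 - x ^ 2 = 0 := hx
    change -1 * x ^ 2 + 0 * x + 1 = 0
    linear_combination this
  · intro x hx
    have : κ.val i * (1 - x ^ 2) = κ.diff i + κ.diff₂ i * x := hx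
    change -κ.val i * x ^ 2 + -κ.diff₂ i * x + (κ.val i - κ.diff i) = 0
    linear_combination this

/-- The points of the torus that are generic with respect to the multiplicity function. -/
def GenericPoint : Type _ := {t : D.Torus // D.IsGeneric hq (D.exceptional κ) t}

variable {D}

namespace GenericPoint

variable {hq κ}

/-- The action of `W` on generic points. -/
def move (w : D.W) (t : D.GenericPoint hq κ) : D.GenericPoint hq κ :=
  ⟨D.torusAct hq w t.1, t.2.torusAct D hq w⟩

theorem move_mul (v w : D.W) (t : D.GenericPoint hq κ) : move (v * w) t = move v (move w t) :=
  Subtype.ext (D.torusAct_mul hq v w t.1)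

theorem move_s_s (i : Fin (n + 1)) (t : D.GenericPoint hq κ) :
    move (D.s i) (move (D.s i) t) = t := by
  rw [← move_mul, s_mul_s]; exact Subtype.ext (D.torusAct_one hq t.1)

/-- The coordinate `t_q^{aᵢ}` of a generic point. -/
def coord (i : Fin (n + 1)) (t : D.GenericPoint hq κ) : ℂ := D.simpleEval hq i t.1

theorem coord_ne_zero (i : Fin (n + 1)) (t : D.GenericPoint hq κ) : coord i t ≠ 0 :=
  Units.ne_zero _

theorem coord_notMem (i : Fin (n + 1)) (t : D.GenericPoint hq κ) :
    coord i t ∉ D.exceptional κ i := by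
  have := t.2.1 1 i
  rwa [torusAct_one] at this

theorem one_sub_sq_ne_zero (i : Fin (n + 1)) (t : D.GenericPoint hq κ) :
    1 - coord i t ^ 2 ≠ 0 := fun h => coord_notMem i t (Or.inl h)

theorem one_sub_ne_zero (i : Fin (n + 1)) (t : D.GenericPoint hq κ) : 1 - coord i t ≠ 0 :=
  fun h => one_sub_sq_ne_zero i t (by linear_combination (1 + coord i t) * h)

theorem coord_s (i j : Fin (n + 1)) (t : D.GenericPoint hq κ) :
    coord j (move (D.s i) t) = coord j t * coord i t ^ (-D.cartan i j) := by
  change ((D.simpleEval hq j (D.torusAct hq (D.s i) t.1) : ℂˣ) : ℂ) = _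
  rw [simpleEval_s, Units.val_mul, Units.val_zpow_eq_zpow_val]; rfl

theorem coord_s_self (i : Fin (n + 1)) (t : D.GenericPoint hq κ) :
    coord i (move (D.s i) t) = (coord i t)⁻¹ := by
  have h : D.cartan i i = 2 := by
    have h1 := D.inner_coroot_Δ_self i
    rw [inner_coroot_Δ] at h1; exact_mod_cast h1
  have h0 := coord_ne_zero i t
  rw [coord_s, h, zpow_neg]
  field_simp

/-- The coefficient `(k + k' x) / (1 - x²)` at a generic point. -/
def coeff (i : Fin (n + 1)) (t : D.GenericPoint hq κ) : ℂ :=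
  (κ.diff i + κ.diff₂ i * coord i t) / (1 - coord i t ^ 2)

theorem coeff_eq_of_notMem {i : Fin (n + 1)} (h : i ∉ D.S) (t : D.GenericPoint hq κ) :
    coeff i t = κ.diff i * (1 - coord i t)⁻¹ := by
  have h1 := one_sub_ne_zero i t
  have h2 := one_sub_sq_ne_zero i t
  rw [coeff, κ.diff₂_eq_of_notMem h]
  field_simp
  ring

theorem coeff_s (i : Fin (n + 1)) (t : D.GenericPoint hq κ) :
    coeff i (move (D.s i) t) = κ.diff i - coeff i t := by
  have h0 := coord_ne_zero i t
  have h1 := one_sub_sq_ne_zero i t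
  have h2 : coord i t ^ 2 - 1 ≠ 0 := fun h => h1 (by linear_combination -h)
  rw [coeff, coeff, coord_s_self]
  field_simp
  ring

theorem val_sub_coeff_ne_zero (i : Fin (n + 1)) (t : D.GenericPoint hq κ) :
    κ.val i - coeff i t ≠ 0 := by
  intro h
  refine coord_notMem i t (Or.inr ?_)
  change κ.val i * (1 - coord i t ^ 2) = κ.diff i + κ.diff₂ i * coord i t
  rw [← eq_div_iff (one_sub_sq_ne_zero i t)]
  exact sub_eq_zero.mp h

end GenericPoint

open GenericPoint

/-- The restriction of a regular function to the generic points. -/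
def toGeneric (p : D.regular) (t : D.GenericPoint hq κ) : ℂ := (p : D.Torus → ℂ) t.1

theorem toGeneric_qActEnd (w : D.W) (p : D.regular) (t : D.GenericPoint hq κ) :
    toGeneric hq κ (D.qActEnd hq w p) t = toGeneric hq κ p (move w⁻¹ t) := rfl

variable [FiniteDimensional ℝ Z]

theorem end_ext (hq1 : q ≠ 1) {F G : Module.End ℂ D.regular}
    (h : ∀ p, toGeneric hq κ (F p) = toGeneric hq κ (G p)) : F = G :=
  D.end_ext_of_isGeneric hq hq1 (D.countable_exceptional κ) fun p t ht =>
    congrFun (h p) ⟨t, ht⟩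

variable (hq1 : q ≠ 1)

theorem toGeneric_heckeEnd (i : Fin (n + 1)) (p : D.regular) :
    toGeneric hq κ (D.heckeEnd hq hq1 κ i p) =
      lusztigOp (κ.val i) (coeff i) (move (D.s i)) (toGeneric hq κ p) := by
  ext t
  have h := (D.exists_heckeEnd hq hq1 κ i).choose_spec p t.1 (one_sub_sq_ne_zero i t)
  refine h.trans ?_
  change _ + coeff i t * (toGeneric hq κ p t - toGeneric hq κ p (move (D.s i) t)) = _
  rw [lusztigOp]
  change κ.val i * toGeneric hq κ p (move (D.s i) t) + _ = _
  ring

theorem heckeEnd_sq (i : Fin (n + 1)) :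
    D.heckeEnd hq hq1 κ i * D.heckeEnd hq hq1 κ i =
      κ.diff i • D.heckeEnd hq hq1 κ i + 1 := by
  refine end_ext hq κ hq1 fun p => ?_
  ext t
  have h1 : toGeneric hq κ ((κ.diff i • D.heckeEnd hq hq1 κ i + 1) p) t =
      κ.diff i * toGeneric hq κ (D.heckeEnd hq hq1 κ i p) t + toGeneric hq κ p t := rfl
  have h2 : κ.val i * κ.val i = κ.diff i * κ.val i + 1 := by
    have := κ.val_ne_zero i
    rw [Multiplicity.diff]; field_simp; ring
  rw [h1, Module.End.mul_apply, toGeneric_heckeEnd, toGeneric_heckeEnd]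
  simp only [lusztigOp, move_s_s, coeff_s]
  linear_combination toGeneric hq κ p t * h2

theorem heckeEnd_braid_two {i j : Fin (n + 1)} (h1 : D.cartan i j = 0) (h2 : D.cartan j i = 0) :
    D.heckeEnd hq hq1 κ i * D.heckeEnd hq hq1 κ j =
      D.heckeEnd hq hq1 κ j * D.heckeEnd hq hq1 κ i := by
  have hc : ∀ {i j : Fin (n + 1)}, D.cartan i j = 0 → ∀ t : D.GenericPoint hq κ,
      coeff j (move (D.s i) t) = coeff j t := by
    intro i j h t
    rw [coeff, coeff, coord_s, h, neg_zero, zpow_zero, mul_one]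
  refine end_ext hq κ hq1 fun p => ?_
  simp only [Module.End.mul_apply, toGeneric_heckeEnd]
  exact lusztigOp_braid_two (fun t => by rw [← move_mul, D.s_braid_two h1 h2, move_mul]) (hc h2)
    (hc h1) _

theorem heckeEnd_braid_three {i j : Fin (n + 1)} (h1 : D.cartan i j = -1)
    (h2 : D.cartan j i = -1) :
    D.heckeEnd hq hq1 κ i * (D.heckeEnd hq hq1 κ j * D.heckeEnd hq hq1 κ i) =
      D.heckeEnd hq hq1 κ j * (D.heckeEnd hq hq1 κ i * D.heckeEnd hq hq1 κ j) := by
  have hi : i ∉ D.S := notMem_S_of_odd (j := j) (by rw [h1]; decide)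
  have hj : j ∉ D.S := notMem_S_of_odd (j := i) (by rw [h2]; decide)
  have hκ := κ.val_eq_of_cartan h1 h2
  have hκ' : κ.diff j = κ.diff i := by rw [Multiplicity.diff, Multiplicity.diff, hκ]
  refine end_ext hq κ hq1 fun p => ?_
  simp only [Module.End.mul_apply, toGeneric_heckeEnd, hκ]
  exact lusztigOp_braid_three (move_s_s i) (move_s_s j)
    (fun t => by simp only [← move_mul, D.s_braid_three h1 h2])
    (coord_ne_zero i) (one_sub_ne_zero i) (coord_ne_zero j) (one_sub_ne_zero j)
    (coord_s_self i) (fun t => by rw [coord_s, h2]; simp)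
    (fun t => by rw [coord_s, h1]; simp) (coord_s_self j)
    (coeff_eq_of_notMem hi) (fun t => by rw [coeff_eq_of_notMem hj, hκ']) _

theorem heckeEnd_braid_four {i j : Fin (n + 1)} (h1 : D.cartan i j = -2)
    (h2 : D.cartan j i = -1) :
    D.heckeEnd hq hq1 κ i * (D.heckeEnd hq hq1 κ j *
        (D.heckeEnd hq hq1 κ i * D.heckeEnd hq hq1 κ j)) =
      D.heckeEnd hq hq1 κ j * (D.heckeEnd hq hq1 κ i *
        (D.heckeEnd hq hq1 κ j * D.heckeEnd hq hq1 κ i)) := by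
  have hj : j ∉ D.S := notMem_S_of_odd (j := i) (by rw [h2]; decide)
  refine end_ext hq κ hq1 fun p => ?_
  simp only [Module.End.mul_apply, toGeneric_heckeEnd]
  exact lusztigOp_braid_four (move_s_s i) (move_s_s j)
    (fun t => by simp only [← move_mul, D.s_braid_four h1 h2])
    (coord_ne_zero i) (one_sub_sq_ne_zero i) (coord_ne_zero j) (one_sub_ne_zero j)
    (coord_s_self i) (fun t => by rw [coord_s, h2]; simp)
    (fun t => by rw [coord_s, h1]; norm_cast) (coord_s_self j)
    (fun _ => rfl) (coeff_eq_of_notMem hj) _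

theorem heckeEnd_braid_six {i j : Fin (n + 1)} (h1 : D.cartan i j = -3)
    (h2 : D.cartan j i = -1) :
    D.heckeEnd hq hq1 κ i * (D.heckeEnd hq hq1 κ j * (D.heckeEnd hq hq1 κ i *
        (D.heckeEnd hq hq1 κ j * (D.heckeEnd hq hq1 κ i * D.heckeEnd hq hq1 κ j)))) =
      D.heckeEnd hq hq1 κ j * (D.heckeEnd hq hq1 κ i * (D.heckeEnd hq hq1 κ j *
        (D.heckeEnd hq hq1 κ i * (D.heckeEnd hq hq1 κ j * D.heckeEnd hq hq1 κ i)))) := by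
  have hi : i ∉ D.S := notMem_S_of_odd (j := j) (by rw [h1]; decide)
  have hj : j ∉ D.S := notMem_S_of_odd (j := i) (by rw [h2]; decide)
  refine end_ext hq κ hq1 fun p => ?_
  simp only [Module.End.mul_apply, toGeneric_heckeEnd]
  exact lusztigOp_braid_six (move_s_s i) (move_s_s j)
    (fun t => by simp only [← move_mul, D.s_braid_six h1 h2])
    (coord_ne_zero i) (one_sub_ne_zero i) (coord_ne_zero j) (one_sub_ne_zero j)
    (coord_s_self i) (fun t => by rw [coord_s, h2]; simp)
    (fun t => by rw [coord_s, h1]; norm_cast) (coord_s_self j)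
    (coeff_eq_of_notMem hi) (coeff_eq_of_notMem hj) _

theorem qActEnd_mul_heckeEnd {ω : D.W} {i j : Fin (n + 1)} (h : D.act ω (D.Δ i) = D.Δ j) :
    D.qActEnd hq ω * D.heckeEnd hq hq1 κ i = D.heckeEnd hq hq1 κ j * D.qActEnd hq ω := by
  refine end_ext hq κ hq1 fun p => ?_
  ext t
  have h' : D.act ω⁻¹ (D.Δ j) = D.Δ i := by rw [← h, act_inv_act]
  have hx : coord i (move ω⁻¹ t) = coord j t := congrArg Units.val (D.simpleEval_omega hq h' t.1)
  have hb : coeff i (move ω⁻¹ t) = coeff j t := by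
    rw [coeff, coeff, hx, Multiplicity.diff, Multiplicity.diff, Multiplicity.diff₂,
      Multiplicity.diff₂, κ.val_eq_of_act h, κ.val₂_eq_of_act h]
  have hs : move (D.s i) (move ω⁻¹ t) = move ω⁻¹ (move (D.s j) t) := by
    rw [← move_mul, ← move_mul]
    congr 1
    have := congrArg (·⁻¹) (D.omega_mul_s h)
    simpa [mul_inv_rev, s_inv] using this
  rw [Module.End.mul_apply, Module.End.mul_apply, toGeneric_qActEnd, toGeneric_heckeEnd,
    toGeneric_heckeEnd, lusztigOp, lusztigOp, toGeneric_qActEnd, toGeneric_qActEnd, hb, hs,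
    κ.val_eq_of_act h]

end InitialData

/-! ### The standard spanning set of the Hecke algebra -/

namespace InitialData

variable {Z : Type*} [NormedAddCommGroup Z] [InnerProductSpace ℝ Z] {n : ℕ} {D : InitialData Z n}

section Quadratic

variable {A : Type*} [Ring A] [Algebra ℂ A] {c : ℂ}

theorem quadratic_relation_iff (hc : c ≠ 0) (x : A) :
    (x - algebraMap ℂ A c) * (x + algebraMap ℂ A c⁻¹) = 0 ↔ x * x = (c - c⁻¹) • x + 1 := by
  have h1 : algebraMap ℂ A c * algebraMap ℂ A c⁻¹ = 1 := by
    rw [← map_mul, mul_inv_cancel₀ hc, map_one]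
  rw [sub_mul, mul_add, mul_add, h1, ← Algebra.commutes, ← Algebra.smul_def, ← Algebra.smul_def,
    sub_smul, ← sub_eq_zero (a := x * x)]
  refine Eq.congr_left ?_
  abel

theorem mul_sub_eq_one {x : A} (h : x * x = c • x + 1) : x * (x - c • 1) = 1 := by
  rw [mul_sub, h, mul_smul_comm, mul_one, add_sub_cancel_left]

theorem sub_mul_eq_one {x : A} (h : x * x = c • x + 1) : (x - c • 1) * x = 1 := by
  rw [sub_mul, h, smul_mul_assoc, one_mul, add_sub_cancel_left]

end Quadratic

section Hecke

variable (k : D.Rred → ℂˣ)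

theorem braid_of_mul {v w : D.W} (h : D.length (v * w) = D.length v + D.length w) :
    (PresentedGroup.of (v * w) : D.Braid) = PresentedGroup.of v * PresentedGroup.of w :=
  (PresentedGroup.mk_eq_mk_of_mul_inv_mem
    (rels := {r : FreeGroup D.W | ∃ v w : D.W, D.length (v * w) = D.length v + D.length w ∧
      r = FreeGroup.of v * FreeGroup.of w * (FreeGroup.of (v * w))⁻¹})
    (x := FreeGroup.of v * FreeGroup.of w) (y := FreeGroup.of (v * w)) ⟨v, w, h, rfl⟩).symm

theorem braid_of_one : (PresentedGroup.of (1 : D.W) : D.Braid) = 1 := by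
  have h := D.braid_of_mul (v := 1) (w := 1) (by rw [mul_one, D.length_one])
  rw [mul_one] at h
  exact left_eq_mul.mp h

/-- The image of the braid group in the Hecke algebra. -/
def braidToHecke : D.Braid →* D.Hecke k :=
  (RingQuot.mkAlgHom ℂ (D.HeckeRel k) : MonoidAlgebra ℂ D.Braid →* D.Hecke k).comp
    (MonoidAlgebra.of ℂ D.Braid)

theorem braidToHecke_of (w : D.W) : braidToHecke k (PresentedGroup.of w) = D.T k w := rfl

theorem T_mul {v w : D.W} (h : D.length (v * w) = D.length v + D.length w) :
    D.T k (v * w) = D.T k v * D.T k w := by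
  rw [← braidToHecke_of, braid_of_mul h, map_mul]; rfl

theorem T_one : D.T k 1 = 1 := by
  rw [← braidToHecke_of, braid_of_one, map_one]

theorem T_omega_mul {ω : D.W} (h : D.length ω = 0) (w : D.W) :
    D.T k (ω * w) = D.T k ω * D.T k w :=
  T_mul k (by rw [D.length_omega_mul h, h, zero_add])

theorem T_s_sq (i : Fin (n + 1)) : D.T k (D.s i) * D.T k (D.s i) =
    (D.simpleValue k i - (D.simpleValue k i)⁻¹) • D.T k (D.s i) + 1 := by
  have h := RingQuot.mkAlgHom_rel ℂ (HeckeRel.quadratic (D := D) (k := k) i)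
  rw [map_zero, map_mul, map_sub, map_add, AlgHom.commutes, AlgHom.commutes] at h
  change (D.T k (D.s i) - _) * (D.T k (D.s i) + _) = 0 at h
  exact (quadratic_relation_iff (Units.ne_zero _) _).mp h

theorem T_s_mul_mem (i : Fin (n + 1)) (w : D.W) :
    D.T k (D.s i) * D.T k w ∈ Submodule.span ℂ (Set.range (D.T k)) := by
  have hmem : ∀ w, D.T k w ∈ Submodule.span ℂ (Set.range (D.T k)) :=
    fun w => Submodule.subset_span ⟨w, rfl⟩
  rcases D.act_inv_Δ_mem i w with h | h
  · have h1 := D.length_s_mul_of_pos h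
    rw [← T_mul k (by rw [h1, D.length_s, add_comm])]
    exact hmem _
  · have h1 := D.length_s_mul_of_neg h
    have h2 : D.T k w = D.T k (D.s i) * D.T k (D.s i * w) := by
      conv_lhs => rw [← D.s_mul_cancel_left i w]
      exact T_mul k (by rw [D.s_mul_cancel_left, D.length_s, h1, add_comm])
    rw [h2, ← mul_assoc, T_s_sq, add_mul, smul_mul_assoc, ← h2, one_mul]
    exact Submodule.add_mem _ (Submodule.smul_mem _ _ (hmem _)) (hmem _)

/-- The elements `T_w` span the Hecke algebra. -/
theorem span_T : Submodule.span ℂ (Set.range (D.T k)) = ⊤ := by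
  set N := Submodule.span ℂ (Set.range (D.T k)) with hN
  have hmem : ∀ w, D.T k w ∈ N := fun w => Submodule.subset_span ⟨w, rfl⟩
  have hmul : ∀ y : D.Hecke k, (∀ w, y * D.T k w ∈ N) → ∀ x ∈ N, y * x ∈ N := by
    intro y hy x hx
    refine Submodule.span_induction (p := fun x _ => y * x ∈ N) ?_ ?_ ?_ ?_ hx
    · rintro _ ⟨w, rfl⟩; exact hy w
    · rw [mul_zero]; exact N.zero_mem
    · intro a b _ _ ha hb; rw [mul_add]; exact N.add_mem ha hb
    · intro c a _ ha; rw [mul_smul_comm]; exact N.smul_mem c ha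
  -- The elements of the braid group that, together with their inverses, preserve the span.
  let G : Subgroup D.Braid :=
    { carrier := {g | (∀ x ∈ N, braidToHecke k g * x ∈ N) ∧ ∀ x ∈ N, braidToHecke k g⁻¹ * x ∈ N}
      one_mem' := by simp
      mul_mem' := by
        rintro g h ⟨hg, hg'⟩ ⟨hh, hh'⟩
        refine ⟨fun x hx => ?_, fun x hx => ?_⟩
        · rw [map_mul, mul_assoc]; exact hg _ (hh _ hx)
        · rw [mul_inv_rev, map_mul, mul_assoc]; exact hh' _ (hg' _ hx)
      inv_mem' := by
        rintro g ⟨hg, hg'⟩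
        exact ⟨hg', by rwa [inv_inv]⟩ }
  have hinv : ∀ (g : D.Braid) (y : D.Hecke k), braidToHecke k g * y = 1 →
      braidToHecke k g⁻¹ = y := by
    intro g y h
    rw [← mul_one (braidToHecke k g⁻¹), ← h, ← mul_assoc, ← map_mul, inv_mul_cancel, map_one,
      one_mul]
  have hGω : ∀ ω, D.length ω = 0 → (PresentedGroup.of ω : D.Braid) ∈ G := by
    intro ω h
    refine ⟨hmul _ fun w => ?_, hmul _ fun w => ?_⟩
    · rw [braidToHecke_of, ← T_omega_mul k h]; exact hmem _
    · rw [hinv _ (D.T k ω⁻¹) (by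
        rw [braidToHecke_of, ← T_omega_mul k h, mul_inv_cancel, T_one]),
        ← T_omega_mul k (D.length_inv_of_length_eq_zero h)]
      exact hmem _
  have hGs : ∀ i, (PresentedGroup.of (D.s i) : D.Braid) ∈ G := by
    intro i
    refine ⟨hmul _ fun w => T_s_mul_mem k i w, hmul _ fun w => ?_⟩
    rw [hinv _ (D.T k (D.s i) - (D.simpleValue k i - (D.simpleValue k i)⁻¹) • 1) 
      (mul_sub_eq_one (T_s_sq k i)),
      sub_mul, smul_mul_assoc, one_mul]
    exact N.sub_mem (T_s_mul_mem k i w) (N.smul_mem _ (hmem w))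
  have hG : ∀ g, g ∈ G := by
    refine PresentedGroup.generated_by _ G fun w => ?_
    refine D.reduced_induction (P := fun w => (PresentedGroup.of w : D.Braid) ∈ G) hGω ?_ w
    intro i w h hw
    rw [braid_of_mul (by rw [h, D.length_s, add_comm])]
    exact G.mul_mem (hGs i) hw
  rw [eq_top_iff]
  rintro x -
  obtain ⟨a, rfl⟩ := RingQuot.mkAlgHom_surjective ℂ (D.HeckeRel k) x
  induction a using MonoidAlgebra.induction_on with
  | of g =>
    have h := (hG g).1 1 (T_one k ▸ hmem 1)
    rw [mul_one] at h
    exact h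
  | add a b ha hb => rw [map_add]; exact N.add_mem ha hb
  | smul c a ha => rw [map_smul]; exact N.smul_mem c ha

/-- Algebra homomorphisms from the Hecke algebra are determined by the images of the elements `Tᵢ`
and `T_ω` with `l(ω) = 0`. -/
theorem hecke_hom_ext {A : Type*} [Semiring A] [Algebra ℂ A] {f g : D.Hecke k →ₐ[ℂ] A}
    (hs : ∀ i, f (D.T k (D.s i)) = g (D.T k (D.s i)))
    (hω : ∀ ω, D.length ω = 0 → f (D.T k ω) = g (D.T k ω)) : f = g := by
  have h : ∀ w, f (D.T k w) = g (D.T k w) := by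
    refine D.reduced_induction hω fun i w h hw => ?_
    rw [T_mul k (by rw [h, D.length_s, add_comm]), map_mul, map_mul, hs, hw]
  have h1 : f.toLinearMap = g.toLinearMap :=
    LinearMap.ext_on (span_T k) (by rintro _ ⟨w, rfl⟩; exact h w)
  exact AlgHom.ext fun x => LinearMap.congr_fun h1 x

end Hecke

/-! ### The basic representation -/

open GenericPoint

/-- Evaluations at distinct points of the torus are linearly independent on regular functions. -/
theorem eq_zero_of_sum_chi_eq_zero {ι : Type*} {e : ι → D.Torus} (he : Function.Injective e)
    (f : ι →₀ ℂ) (h : ∀ v, (f.sum fun x c => c * D.chi v (e x)) = 0) : f = 0 := by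
  let m : ι → (Multiplicative D.Λ →* ℂ) := fun x =>
    (Units.coeHom ℂ).comp (e x).toMonoidHom
  have hm : Function.Injective m := by
    intro x y hxy
    refine he (DFunLike.ext _ _ fun v => Units.ext ?_)
    exact DFunLike.congr_fun hxy (Multiplicative.ofAdd v)
  have hli := (linearIndependent_monoidHom (Multiplicative D.Λ) ℂ).comp m hm
  refine (linearIndependent_iff.mp hli) f (funext fun v => ?_)
  rw [Finsupp.linearCombination_apply, Finsupp.sum, Finset.sum_apply]
  exact h v.toAdd

variable [FiniteDimensional ℝ Z] {q : ℝ} (hq : 0 < q) (hq1 : q ≠ 1) (κ : D.Multiplicity)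

/-- The invertible operator by which `Tᵢ` acts. -/
def heckeUnit (i : Fin (n + 1)) : (Module.End ℂ D.regular)ˣ where
  val := D.heckeEnd hq hq1 κ i
  inv := D.heckeEnd hq hq1 κ i - κ.diff i • 1
  val_inv := mul_sub_eq_one (A := Module.End ℂ D.regular) (heckeEnd_sq hq κ hq1 i)
  inv_val := sub_mul_eq_one (A := Module.End ℂ D.regular) (heckeEnd_sq hq κ hq1 i)

/-- The invertible operator by which `w ∈ W` acts on regular functions. -/
def qActUnit (w : D.W) : (Module.End ℂ D.regular)ˣ where
  val := D.qActEnd hq w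
  inv := D.qActEnd hq w⁻¹
  val_inv := by rw [← qActEnd_mul, mul_inv_cancel, qActEnd_one]
  inv_val := by rw [← qActEnd_mul, inv_mul_cancel, qActEnd_one]

theorem braidFamily_heckeUnit : D.BraidFamily (heckeUnit hq hq1 κ) (qActUnit hq) where
  braid_two _ _ _ h1 h2 := Units.ext (heckeEnd_braid_two hq κ hq1 h1 h2)
  braid_three _ _ _ h1 h2 := Units.ext (heckeEnd_braid_three hq κ hq1 h1 h2)
  braid_four _ _ _ h1 h2 := Units.ext (heckeEnd_braid_four hq κ hq1 h1 h2)
  braid_six _ _ _ h1 h2 := Units.ext (heckeEnd_braid_six hq κ hq1 h1 h2)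
  omega_mul _ _ _ _ := Units.ext (D.qActEnd_mul hq _ _)
  omega_conj _ _ _ _ h := Units.ext (qActEnd_mul_heckeEnd hq κ hq1 h)

theorem exists_representation : ∃ π : D.Hecke κ.restrict →ₐ[ℂ] Module.End ℂ D.regular,
    (∀ i, π (D.T κ.restrict (D.s i)) = D.heckeEnd hq hq1 κ i) ∧
    ∀ ω, D.length ω = 0 → π (D.T κ.restrict ω) = D.qActEnd hq ω := by
  obtain ⟨F, hs, hω, hmul⟩ := (braidFamily_heckeUnit hq hq1 κ).exists_extension
  have hrel : ∀ r ∈ {r : FreeGroup D.W | ∃ v w : D.W,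
      D.length (v * w) = D.length v + D.length w ∧
      r = FreeGroup.of v * FreeGroup.of w * (FreeGroup.of (v * w))⁻¹},
      FreeGroup.lift F r = 1 := by
    rintro _ ⟨v, w, h, rfl⟩
    rw [map_mul, map_mul, map_inv, FreeGroup.lift_apply_of, FreeGroup.lift_apply_of,
      FreeGroup.lift_apply_of, hmul v w h, mul_inv_cancel]
  let f : MonoidAlgebra ℂ D.Braid →ₐ[ℂ] Module.End ℂ D.regular :=
    MonoidAlgebra.lift ℂ _ _ ((Units.coeHom _).comp (PresentedGroup.toGroup hrel))
  have hf : ∀ w, f (D.braidT w) = F w := by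
    intro w
    change MonoidAlgebra.lift ℂ _ _ _ (MonoidAlgebra.of ℂ D.Braid _) = _
    rw [MonoidAlgebra.lift_of, MonoidHom.comp_apply, PresentedGroup.toGroup.of]; rfl
  have hFs : ∀ i, (F (D.s i) : Module.End ℂ D.regular) = D.heckeEnd hq hq1 κ i := by
    intro i
    rw [hs, Units.val_mul]
    change D.heckeEnd hq hq1 κ i * D.qActEnd hq 1 = _
    rw [qActEnd_one, mul_one]
  have hquad : ∀ ⦃x y⦄, D.HeckeRel κ.restrict x y → f x = f y := by
    rintro _ _ ⟨i⟩
    rw [map_zero, map_mul, map_sub, map_add, AlgHom.commutes, AlgHom.commutes, hf, hFs]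
    exact (quadratic_relation_iff (A := Module.End ℂ D.regular) (κ.val_ne_zero i) _).mpr (heckeEnd_sq hq κ hq1 i)
  refine ⟨RingQuot.liftAlgHom ℂ ⟨f, hquad⟩, fun i => ?_, fun ω h => ?_⟩
  · rw [T, RingQuot.liftAlgHom_mkAlgHom_apply, hf, hFs]
  · rw [T, RingQuot.liftAlgHom_mkAlgHom_apply, hf, hω ω h]; rfl

variable {hq hq1 κ} {π : D.Hecke κ.restrict →ₐ[ℂ] Module.End ℂ D.regular}

/-- At a generic point `t` the operator of `T_w` is a combination of evaluations at points `v⁻¹ t`,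
in which `v = w` occurs with a nonzero coefficient and all other `v` are shorter than `w`. -/
theorem exists_expansion (hs : ∀ i, π (D.T κ.restrict (D.s i)) = D.heckeEnd hq hq1 κ i)
    (hω : ∀ ω, D.length ω = 0 → π (D.T κ.restrict ω) = D.qActEnd hq ω) (w : D.W) :
    ∀ t : D.GenericPoint hq κ, ∃ f : D.W →₀ ℂ, f w ≠ 0 ∧
      (∀ v, f v ≠ 0 → v = w ∨ D.length v < D.length w) ∧
      ∀ p, toGeneric hq κ (π (D.T κ.restrict w) p) t =
        f.sum fun v c => c * toGeneric hq κ p (move v⁻¹ t) := by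
  classical
  refine D.reduced_induction (P := fun w => ∀ t : D.GenericPoint hq κ, ∃ f : D.W →₀ ℂ, f w ≠ 0 ∧
      (∀ v, f v ≠ 0 → v = w ∨ D.length v < D.length w) ∧
      ∀ p, toGeneric hq κ (π (D.T κ.restrict w) p) t =
        f.sum fun v c => c * toGeneric hq κ p (move v⁻¹ t)) ?_ ?_ w
  · intro ω h t
    refine ⟨Finsupp.single ω 1, by simp, fun v hv => Or.inl ?_, fun p => ?_⟩
    · by_contra hne
      exact hv (Finsupp.single_eq_of_ne hne)
    · rw [hω ω h, toGeneric_qActEnd, Finsupp.sum_single_index (zero_mul _), one_mul]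
  · intro i w hlen ih t
    obtain ⟨f, hf0, hf1, hf⟩ := ih t
    obtain ⟨g, hg0, hg1, hg⟩ := ih (move (D.s i) t)
    have hinj : Function.Injective (D.s i * ·) := mul_right_injective (D.s i)
    have hval : ∀ v, (coeff i t • f + (κ.val i - coeff i t) • g.mapDomain (D.s i * ·)) (D.s i * v) =
        coeff i t * f (D.s i * v) + (κ.val i - coeff i t) * g v := by
      intro v
      rw [Finsupp.add_apply, Finsupp.smul_apply, Finsupp.smul_apply,
        Finsupp.mapDomain_apply hinj, smul_eq_mul, smul_eq_mul]
    refine ⟨coeff i t • f + (κ.val i - coeff i t) • g.mapDomain (D.s i * ·), ?_, ?_, ?_⟩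
    · have h0 : f (D.s i * w) = 0 := by
        by_contra h
        rcases hf1 _ h with h1 | h1
        · rw [h1] at hlen; omega
        · omega
      rw [hval, h0, mul_zero, zero_add]
      exact mul_ne_zero (val_sub_coeff_ne_zero i t) hg0
    · intro v hv
      obtain ⟨u, rfl⟩ : ∃ u, v = D.s i * u := ⟨D.s i * v, (D.s_mul_cancel_left i v).symm⟩
      rw [hval] at hv
      by_cases hgu : g u = 0
      · have hfu : f (D.s i * u) ≠ 0 := by
          intro h; rw [h, hgu, mul_zero, mul_zero, add_zero] at hv; exact hv rfl
        rcases hf1 _ hfu with h1 | h1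
        · rw [h1]; right; omega
        · right; omega
      · rcases hg1 _ hgu with rfl | h1
        · exact Or.inl rfl
        · have := D.length_s_mul_le i u
          right; omega
    · intro p
      rw [T_mul _ (by rw [hlen, D.length_s, add_comm]), map_mul, hs, Module.End.mul_apply,
        toGeneric_heckeEnd, lusztigOp, hf, hg, Finsupp.sum_add_index', Finsupp.sum_smul_index',
        Finsupp.sum_smul_index', Finsupp.sum_mapDomain_index, Finsupp.mul_sum, Finsupp.mul_sum]
      · congr 1
        · exact Finsupp.sum_congr fun v _ => by rw [smul_eq_mul, mul_assoc]
        · refine Finsupp.sum_congr fun v _ => ?_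
          rw [smul_eq_mul, mul_assoc, mul_inv_rev, s_inv, move_mul]
      all_goals intros; simp [add_mul, mul_add]

/-- The operators of the `T_w` are triangular at a generic point: evaluation at `w₀⁻¹ t`, for an
element `w₀` of maximal length in the support of a combination, receives a nonzero contribution
from `w₀` and none from the other elements of the support. -/
theorem injective_of_apply_T (hs : ∀ i, π (D.T κ.restrict (D.s i)) = D.heckeEnd hq hq1 κ i)
    (hω : ∀ ω, D.length ω = 0 → π (D.T κ.restrict ω) = D.qActEnd hq ω) :
    Function.Injective π := by
  classical
  rw [injective_iff_map_eq_zero]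
  intro x hx
  have hx' : x ∈ Submodule.span ℂ (Set.range (D.T κ.restrict)) := span_T κ.restrict ▸ trivial
  obtain ⟨c, rfl⟩ := Finsupp.mem_span_range_iff_exists_finsupp.mp hx'
  by_contra hne
  have hsupp : c.support.Nonempty := by
    rw [Finset.nonempty_iff_ne_empty]
    intro h
    exact hne (by rw [Finsupp.sum, h, Finset.sum_empty])
  obtain ⟨w₀, hw₀, hmax⟩ := c.support.exists_max_image D.length hsupp
  obtain ⟨t, -, ht⟩ := D.exists_isGeneric hq hq1 (D.countable_exceptional κ)
    (p := 1) D.regular.one_mem one_ne_zero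
  let t' : D.GenericPoint hq κ := ⟨t, ht⟩
  choose f hf0 hf1 hf using fun w => exists_expansion hs hω w t'
  have hsum : c.sum (fun w a => a • f w) = 0 := by
    refine eq_zero_of_sum_chi_eq_zero (e := fun v => (move v⁻¹ t').1) ?_ _ fun v => ?_
    · intro v w h
      exact inv_injective (ht.2 _ _ h)
    · have h1 := congrArg (fun F : Module.End ℂ D.regular =>
        toGeneric hq κ (F ⟨_, D.chi_mem v⟩) t') hx
      have h2 : toGeneric hq κ (π (c.sum fun i a => a • D.T κ.restrict i) ⟨_, D.chi_mem v⟩) t' =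
          c.sum fun w a => a * toGeneric hq κ (π (D.T κ.restrict w) ⟨_, D.chi_mem v⟩) t' := by
        rw [map_finsuppSum, Finsupp.sum, Finsupp.sum, LinearMap.sum_apply, toGeneric,
          AddSubmonoidClass.coe_finsetSum, Finset.sum_apply]
        refine Finset.sum_congr rfl fun w _ => ?_
        rw [map_smul]; rfl
      have h3 : toGeneric hq κ ((0 : Module.End ℂ D.regular) ⟨_, D.chi_mem v⟩) t' = 0 := rfl
      rw [← h3, ← h1, h2]
      rw [Finsupp.sum_sum_index (by simp) (by intros; rw [add_mul])]
      refine Finsupp.sum_congr fun w _ => ?_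
      rw [hf w, Finsupp.sum_smul_index (by simp), Finsupp.mul_sum]
      exact Finsupp.sum_congr fun u _ => by rw [mul_assoc]; rfl
  have hval := DFunLike.congr_fun hsum w₀
  rw [Finsupp.sum, Finsupp.finsetSum_apply, Finset.sum_eq_single w₀] at hval
  · exact mul_ne_zero (Finsupp.mem_support_iff.mp hw₀) (hf0 w₀) hval
  · intro w hw hne'
    rw [Finsupp.smul_apply]
    by_contra h
    rcases hf1 w w₀ (right_ne_zero_of_mul h) with h1 | h1
    · exact hne' h1.symm
    · exact absurd (hmax w hw) (not_le.mpr h1)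
  · exact fun h => absurd hw₀ h

variable (hq hq1 κ)

/-- The prescribed formulas pin down the operators of the `Tᵢ`, although they say nothing at points
with `t_q^{2aᵢ} = 1`. -/
theorem isBasicRepresentation_iff : D.IsBasicRepresentation κ hq π ↔
    (∀ i, π (D.T κ.restrict (D.s i)) = D.heckeEnd hq hq1 κ i) ∧
    ∀ ω, D.length ω = 0 → π (D.T κ.restrict ω) = D.qActEnd hq ω := by
  have hqAct : ∀ i (p : D.regular) t, D.qAct hq (D.s i) p t =
      (p : D.Torus → ℂ) (D.torusAct hq (D.s i) t) := fun i p t => by rw [qAct, s_inv]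
  constructor
  · rintro ⟨h1, h2⟩
    refine ⟨fun i => LinearMap.ext fun p => Subtype.ext ?_, fun ω h => LinearMap.ext fun p =>
      Subtype.ext (funext fun t => h2 ω h p t)⟩
    refine D.regular_ext_of_mul hq hq1 i (π _ p).2 (D.heckeEnd hq hq1 κ i p).2 fun t ht => ?_
    rw [h1 i p t ht, hqAct]
    exact ((D.exists_heckeEnd hq hq1 κ i).choose_spec p t ht).symm
  · rintro ⟨h1, h2⟩
    refine ⟨fun i p t ht => ?_, fun ω h p t => by rw [h2 ω h]; rfl⟩
    rw [h1, heckeEnd, (D.exists_heckeEnd hq hq1 κ i).choose_spec p t ht, hqAct]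
    rfl

end InitialData

end

theorem mainTheorem8 {Z : Type*} [NormedAddCommGroup Z] [InnerProductSpace ℝ Z]
    [FiniteDimensional ℝ Z] {n : ℕ} (D : InitialData Z n) (κ : D.Multiplicity)
    (q : ℝ) (hq : 0 < q) (hq1 : q ≠ 1) :
    ∃! π : D.Hecke κ.restrict →ₐ[ℂ] Module.End ℂ D.regular,
      Function.Injective π ∧ D.IsBasicRepresentation κ hq π := by
  obtain ⟨π, hs, hω⟩ := InitialData.exists_representation hq hq1 κ
  refine ⟨π, ⟨InitialData.injective_of_apply_T hs hω,
    (InitialData.isBasicRepresentation_iff hq hq1 κ).mpr ⟨hs, hω⟩⟩, ?_⟩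
  rintro π' ⟨-, hπ'⟩
  obtain ⟨hs', hω'⟩ := (InitialData.isBasicRepresentation_iff hq hq1 κ).mp hπ'
  exact InitialData.hecke_hom_ext (D := D) κ.restrict (fun i => by rw [hs', hs]) fun ω h => by rw [hω' ω h, hω ω h]
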